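/- Let $M$ be a finite-dimensional smooth manifold without boundary (Hausdorff, second countable), $H$ a smooth closed $3$-form on $M$, and let $\Gamma(TM\oplus T^*M)$ carry the $H$-twisted Courant bracket $$[X+\xi,Y+\eta]_H=[X,Y]+\mathcal L_X\eta-\mathcal L_Y\xi-\tfrac12 d(\iota_X\eta-\iota_Y\xi)+\iota_Y\iota_X H .$$ Let $\mathbb J$ be an $H$-twisted generalized complex structure: a smooth bundle endomorphism of $TM\oplus T^*M$ with $\mathbb J^2=-1$, orthogonal for the pairing $\langle X+\xi,Y+\eta\rangle=\tfrac12(\eta(X)+\xi(Y))$, whose $+i$-eigenbundle is closed under the complexified bracket $[\,,]_H$. The group of generalized symmetries is $\mathscr G=\mathrm{Diff}(M)\ltimes\Omega^2(M)$ with $(\lambda,\alpha)\cdot(\mu,\beta)=(\lambda\mu,\mu^*\alpha+\beta)$, acting on $TM\oplus T^*M$ by $(\lambda,\alpha)\circ(X+\xi)=\lambda_*X+(\lambda^{-1})^*(\xi+\iota_X\alpha)$. Let $\mathscr G_{\mathbb J}\subset\mathscr G$ be the subgroup of those symmetries that preserve $[\,,]_H$ and commute with $\mathbb J$. For a smooth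 function $f:M\to\mathbb R$ write $\mathbb J(df)=X_f+\xi_f$. A smooth time-dependent function $F_t$ ($t\in\mathbb R$) *generates* a smooth path $(\lambda_t,\alpha_t)$, $t\in\mathbb R$, in $\mathscr G$ if $(\lambda_0,\alpha_0)$ is the identity and, for all $t$, $$\frac{d}{dt}\lambda_t=X_{F_t}\circ\lambda_t,\qquad \frac{d}{dt}\alpha_t=\lambda_t^*\bigl(d\xi_{F_t}-\iota_{X_{F_t}}H\bigr),$$ that is, the path is generated by the infinitesimal symmetries $\psi_H(X_{F_t},d\xi_{F_t})$, where $\psi_H(X,A)=(X,A-\iota_XH)$. Let $\mathrm{Ham}(M,\mathbb J)\subset\mathscr G$ be the set of all $(\lambda_1,\alpha_1)$ for such paths. Then: 1. $\mathrm{Ham}(M,\mathbb J)$ is a subgroup of $\mathscr G$ and is contained in $\mathscr G_{\mathbb J}$. 2. If $F_t$ generates $(\lambda_t,\alpha_t)$ and $G_t$ generates $(\mu_t,\beta_t)$, then $F_t+(\lambda_t^{-1})^*G_t$ generates the composite path $(\lambda_t,\alpha_t)\cdot(\mu_t,\beta_t)=(\lambda_t\mu_t,\mu_t^*\alpha_t+\beta_t)$.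 -/

import Mathlib

set_option linter.unusedSectionVars false
open scoped Manifold ContDiff Bundle
open Bundle VectorField

noncomputable section

namespace GenGeom

/-! ### The generalized tangent bundle, differential forms -/

section Basic

variable (E : Type*) [NormedAddCommGroup E] [NormedSpace ℝ E]
  {M : Type*} [TopologicalSpace M] [ChartedSpace E M]

/-- The tangent space `T_x M`. -/
abbrev TanSp (x : M) : Type _ := TangentSpace 𝓘(ℝ, E) x

/-- The cotangent space `T_x^* M`. -/
abbrev CotSp (x : M) : Type _ := TangentSpace 𝓘(ℝ, E) x →L[ℝ] ℝ

/-- The fibre `T_x M ⊕ T_x^* M` of the generalized tangent bundle. -/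
abbrev GTan (x : M) : Type _ := TanSp E x × CotSp E x

variable (M)

/-- Vector fields (not necessarily smooth). -/
abbrev VField : Type _ := (x : M) → TanSp E x

/-- Covector fields (not necessarily smooth). -/
abbrev CoField : Type _ := (x : M) → CotSp E x

/-- Sections of the generalized tangent bundle (not necessarily smooth). -/
abbrev GField : Type _ := (x : M) → GTan E x

/-- Differential `n`-forms (not necessarily smooth). -/
abbrev DForm (n : ℕ) : Type _ := (x : M) → TangentSpace 𝓘(ℝ, E) x [⋀^Fin n]→L[ℝ] ℝ

end Basic

section Calculus

variable {E : Type*} [NormedAddCommGroup E] [NormedSpace ℝ E]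
  {M : Type*} [TopologicalSpace M] [ChartedSpace E M]

/-- The covector field `df`. -/
def dfun (f : M → ℝ) : CoField E M := fun x => mfderiv 𝓘(ℝ, E) 𝓘(ℝ, ℝ) f x

/-- A covector field, viewed as a `1`-form. -/
def CoField.toDForm (ξ : CoField E M) : DForm E M 1 :=
  fun x => ContinuousAlternatingMap.ofSubsingleton ℝ (TangentSpace 𝓘(ℝ, E) x) ℝ (0 : Fin 1) (ξ x)

/-- Pullback `f^* w` of an `n`-form along a map `f : M → M`. -/
def DForm.pullback {n : ℕ} (f : M → M) (w : DForm E M n) : DForm E M n :=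
  fun x => (w (f x)).compContinuousLinearMap (mfderiv 𝓘(ℝ, E) 𝓘(ℝ, E) f x)

/-- The representative of an `n`-form in the preferred chart at `c`, an `n`-form on (the target
of the chart in) `E`. -/
def DForm.inChart {n : ℕ} (w : DForm E M n) (c : M) : E → E [⋀^Fin n]→L[ℝ] ℝ :=
  fun e => (w ((extChartAt 𝓘(ℝ, E) c).symm e)).compContinuousLinearMap
    (mfderiv 𝓘(ℝ, E) 𝓘(ℝ, E) (extChartAt 𝓘(ℝ, E) c).symm e)

/-- The exterior derivative on a manifold: at `x`, it is the pullback along the preferred chart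
at `x` of the exterior derivative of the representative in that chart. -/
def DForm.d {n : ℕ} (w : DForm E M n) : DForm E M (n + 1) :=
  fun x => (extDeriv (w.inChart x) (extChartAt 𝓘(ℝ, E) x x)).compContinuousLinearMap
    (mfderiv 𝓘(ℝ, E) 𝓘(ℝ, E) (extChartAt 𝓘(ℝ, E) x) x)

/-- The interior product `ι_v w` of a vector with a `2`-form at a point, a covector. -/
def iota₂ {x : M} (v : TanSp E x) (w : TangentSpace 𝓘(ℝ, E) x [⋀^Fin 2]→L[ℝ] ℝ) : CotSp E x :=
  w.toContinuousLinearMap ![v, 0] 1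

/-- `ι_v ι_u w` for a `3`-form `w` at a point: the covector `z ↦ w(u, v, z)`. -/
def iota₃ {x : M} (u v : TanSp E x) (w : TangentSpace 𝓘(ℝ, E) x [⋀^Fin 3]→L[ℝ] ℝ) : CotSp E x :=
  w.toContinuousLinearMap ![u, v, 0] 2

/-- The interior product `ι_X w` of a vector field with a `3`-form, a `2`-form. -/
def DForm.interior (X : VField E M) (w : DForm E M 3) : DForm E M 2 :=
  fun x => ContinuousAlternatingMap.curryLeft (E := E) (w x) (X x)

/-- The Lie derivative of a `1`-form, `L_X ξ = ι_X dξ + d(ξ(X))`. -/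
def lieDeriv (X : VField E M) (ξ : CoField E M) : CoField E M :=
  fun x => iota₂ (X x) (ξ.toDForm.d x) + dfun (fun y => ξ y (X y)) x

/-- The `H`-twisted Courant bracket
`[X + ξ, Y + η]_H = [X, Y] + L_X η - L_Y ξ - ½ d(η(X) - ξ(Y)) + ι_Y ι_X H`. -/
def courant (H : DForm E M 3) (A B : GField E M) : GField E M :=
  fun x =>
    (mlieBracket 𝓘(ℝ, E) (fun y => (A y).1) (fun y => (B y).1) x,
      lieDeriv (fun y => (A y).1) (fun y => (B y).2) x
        - lieDeriv (fun y => (B y).1) (fun y => (A y).2) x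
        - (1 / 2 : ℝ) • dfun (fun y => (B y).2 (A y).1 - (A y).2 (B y).1) x
        + iota₃ (A x).1 (B x).1 (H x))

/-- The natural pairing `⟨X + ξ, Y + η⟩ = ½ (η(X) + ξ(Y))`. -/
def pairing {x : M} (u v : GTan E x) : ℝ := (1 / 2 : ℝ) * (v.2 u.1 + u.2 v.1)

end Calculus

section Smooth

variable {E : Type*} [NormedAddCommGroup E] [NormedSpace ℝ E]
  {M : Type*} [TopologicalSpace M] [ChartedSpace E M] [IsManifold 𝓘(ℝ, E) ∞ M]

/-- Smoothness of an `n`-form, as a section of the bundle of alternating forms. -/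
def DForm.Smooth {n : ℕ} (w : DForm E M n) : Prop :=
  ContMDiff 𝓘(ℝ, E) (𝓘(ℝ, E).prod 𝓘(ℝ, E [⋀^Fin n]→L[ℝ] ℝ)) ∞
    (fun x : M => TotalSpace.mk' (E [⋀^Fin n]→L[ℝ] ℝ)
      (E := fun x : M => TangentSpace 𝓘(ℝ, E) x [⋀^Fin n]→L[ℝ] ℝ) x (w x))

/-- Joint smoothness in `(t, x)` of a time-dependent `n`-form. -/
def DForm.SmoothFamily {n : ℕ} (w : ℝ → DForm E M n) : Prop :=
  ContMDiff (𝓘(ℝ, ℝ).prod 𝓘(ℝ, E)) (𝓘(ℝ, E).prod 𝓘(ℝ, E [⋀^Fin n]→L[ℝ] ℝ)) ∞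
    (fun p : ℝ × M => TotalSpace.mk' (E [⋀^Fin n]→L[ℝ] ℝ)
      (E := fun x : M => TangentSpace 𝓘(ℝ, E) x [⋀^Fin n]→L[ℝ] ℝ) p.2 (w p.1 p.2))

/-- Smoothness of a section of `TM ⊕ T^*M`: the vector field and the covector field are smooth
sections of the tangent and the cotangent bundle. -/
def GField.Smooth (A : GField E M) : Prop :=
  ContMDiff 𝓘(ℝ, E) (𝓘(ℝ, E).prod 𝓘(ℝ, E)) ∞
      (fun x : M => TotalSpace.mk' E (E := fun x : M => TangentSpace 𝓘(ℝ, E) x) x (A x).1) ∧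
    ContMDiff 𝓘(ℝ, E) (𝓘(ℝ, E).prod 𝓘(ℝ, E →L[ℝ] ℝ)) ∞
      (fun x : M => TotalSpace.mk' (E →L[ℝ] ℝ)
        (E := fun x : M => TangentSpace 𝓘(ℝ, E) x →L[ℝ] ℝ) x (A x).2)

/-! ### Generalized complex structures -/

variable (E M) in
/-- A generalized almost complex structure: a smooth bundle endomorphism `J` of `TM ⊕ T^*M` with
`J² = -1` that is orthogonal for the natural pairing. -/
structure GenAlmostComplex where
  toFun : (x : M) → GTan E x →L[ℝ] GTan E x
  smooth : ContMDiff 𝓘(ℝ, E)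
    (𝓘(ℝ, E).prod 𝓘(ℝ, (E × (E →L[ℝ] ℝ)) →L[ℝ] (E × (E →L[ℝ] ℝ)))) ∞
    (fun x : M => TotalSpace.mk' ((E × (E →L[ℝ] ℝ)) →L[ℝ] (E × (E →L[ℝ] ℝ)))
      (E := fun x : M => GTan E x →L[ℝ] GTan E x) x (toFun x))
  sq : ∀ (x : M) (u : GTan E x), toFun x (toFun x u) = -u
  orthogonal : ∀ (x : M) (u v : GTan E x), pairing (toFun x u) (toFun x v) = pairing u v

variable (E M) in
/-- Sections `A + iB` of the complexified generalized tangent bundle, as pairs of real sections. -/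
structure CGField where
  re : GField E M
  im : GField E M

/-- Smoothness of a complex section. -/
def CGField.Smooth (S : CGField E M) : Prop := S.re.Smooth ∧ S.im.Smooth

/-- The complex bilinear extension of the twisted Courant bracket. -/
def courantC (H : DForm E M 3) (S T : CGField E M) : CGField E M where
  re := courant H S.re T.re - courant H S.im T.im
  im := courant H S.re T.im + courant H S.im T.re

/-- `A + iB` lies in the `+i`-eigenbundle of `J`: `J A + i J B = i (A + iB) = -B + iA`. -/
def GenAlmostComplex.IsEigen (J : GenAlmostComplex E M) (S : CGField E M) : Prop :=
  ∀ x, J.toFun x (S.re x) = -S.im x ∧ J.toFun x (S.im x) = S.re x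

/-- Integrability: the `+i`-eigenbundle is involutive for the `H`-twisted Courant bracket. -/
def GenAlmostComplex.Integrable (H : DForm E M 3) (J : GenAlmostComplex E M) : Prop :=
  ∀ S T : CGField E M, S.Smooth → T.Smooth → J.IsEigen S → J.IsEigen T →
    J.IsEigen (courantC H S T)

/-! ### Generalized symmetries -/

variable (E M) in
/-- A generalized symmetry `(λ, α)`: a diffeomorphism and a smooth `2`-form. -/
@[ext]
structure GenSym where
  diffeo : M ≃ₘ^∞⟮𝓘(ℝ, E), 𝓘(ℝ, E)⟯ M
  bField : DForm E M 2
  smooth : bField.Smooth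


/-- Alternatization as a continuous linear map. -/
def altCLM (n : ℕ) : ContinuousMultilinearMap ℝ (fun _ : Fin n => E) ℝ →L[ℝ] E [⋀^Fin n]→L[ℝ] ℝ :=
  LinearMap.mkContinuous
    { toFun := fun f => ContinuousMultilinearMap.alternatization f
      map_add' := fun f g => map_add _ f g
      map_smul' := fun c f => by
        ext v
        have h1 : ∀ σ : Equiv.Perm (Fin n), Equiv.Perm.sign σ • ((c • f) (v ∘ σ)) =
            c • (Equiv.Perm.sign σ • f (v ∘ σ)) := fun σ => smul_comm (Equiv.Perm.sign σ) c _
        change ContinuousMultilinearMap.alternatization (c • f) v =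
          c • ContinuousMultilinearMap.alternatization f v
        simp only [ContinuousMultilinearMap.alternatization_apply_apply, Finset.smul_sum, h1] }
    (Nat.factorial n) (fun f => by
      refine ContinuousAlternatingMap.opNorm_le_bound _ (by positivity) (fun v => ?_)
      simp only [LinearMap.coe_mk, AddHom.coe_mk,
        ContinuousMultilinearMap.alternatization_apply_apply]
      refine (norm_sum_le _ _).trans ?_
      have h : ∀ σ : Equiv.Perm (Fin n), ‖Equiv.Perm.sign σ • f (v ∘ σ)‖ ≤ ‖f‖ * ∏ i, ‖v i‖ := by
        intro σ
        have h1 : ‖Equiv.Perm.sign σ • f (v ∘ σ)‖ = ‖f (v ∘ σ)‖ := by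
          rcases Int.units_eq_one_or (Equiv.Perm.sign σ) with h | h <;> simp [h]
        rw [h1]
        refine (f.le_opNorm _).trans (le_of_eq ?_)
        congr 1
        exact Equiv.prod_comp σ (fun i => ‖v i‖)
      refine (Finset.sum_le_sum (fun σ _ => h σ)).trans (le_of_eq ?_)
      simp [Fintype.card_perm, mul_assoc])

lemma contDiff_altComp (n : ℕ) :
    ContDiff ℝ ∞ (fun p : (E [⋀^Fin n]→L[ℝ] ℝ) × (E →L[ℝ] E) =>
      p.1.compContinuousLinearMap p.2) := by
  have h : (fun p : (E [⋀^Fin n]→L[ℝ] ℝ) × (E →L[ℝ] E) => p.1.compContinuousLinearMap p.2) =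
      fun p => ((Nat.factorial n : ℝ)⁻¹) • altCLM (E := E) n
        (ContinuousMultilinearMap.compContinuousLinearMapContinuousMultilinear ℝ
          (fun _ : Fin n => E) (fun _ : Fin n => E) ℝ (fun _ => p.2)
          (ContinuousAlternatingMap.toContinuousMultilinearMapCLM ℝ p.1)) := by
    funext p
    ext v
    have hs : ∀ σ : Equiv.Perm (Fin n),
        Equiv.Perm.sign σ • (p.1 : (Fin n → E) → ℝ) (fun i => p.2 (v (σ i))) =
          p.1 (fun i => p.2 (v i)) := by
      intro σ
      have := p.1.toAlternatingMap.map_perm (fun i => p.2 (v i)) σ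
      change p.1 (fun i => p.2 (v (σ i))) = Equiv.Perm.sign σ • p.1 (fun i => p.2 (v i)) at this
      rw [this, smul_smul, Int.units_mul_self, one_smul]
    have hn : (Nat.factorial n : ℝ) ≠ 0 := by positivity
    simp [altCLM, ContinuousMultilinearMap.alternatization_apply_apply, Function.comp_def, hs,
      Fintype.card_perm, hn]
  rw [h]
  have h0 : ContDiff ℝ ∞ (fun f : ContinuousMultilinearMap ℝ (fun _ : Fin n => E) ℝ =>
      altCLM (E := E) n f) := (altCLM (E := E) n).contDiff
  have h1 : ContDiff ℝ ∞ (fun p : (E [⋀^Fin n]→L[ℝ] ℝ) × (E →L[ℝ] E) =>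
      ContinuousMultilinearMap.compContinuousLinearMapContinuousMultilinear ℝ
        (fun _ : Fin n => E) (fun _ : Fin n => E) ℝ (fun _ => p.2)
        (ContinuousAlternatingMap.toContinuousMultilinearMapCLM ℝ p.1)) := by
    refine ContDiff.clm_apply ?_ ?_
    · exact (ContinuousMultilinearMap.contDiff _).comp (contDiff_pi.2 (fun _ => contDiff_snd))
    · exact ContDiff.comp (ContinuousLinearMap.contDiff
        (ContinuousAlternatingMap.toContinuousMultilinearMapCLM ℝ :
          (E [⋀^Fin n]→L[ℝ] ℝ) →L[ℝ] ContinuousMultilinearMap ℝ (fun _ : Fin n => E) ℝ))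
        contDiff_fst
  exact (h0.comp h1).const_smul ((Nat.factorial n : ℝ)⁻¹)

/-- Reading a form in the trivialization at `x₀`. -/
def DForm.coord {n : ℕ} (w : DForm E M n) (x₀ x : M) : E [⋀^Fin n]→L[ℝ] ℝ :=
  (w x).compContinuousLinearMap ((trivializationAt E (TangentSpace 𝓘(ℝ, E)) x₀).symmL ℝ x)

lemma DForm.smooth_iff {n : ℕ} (w : DForm E M n) :
    w.Smooth ↔ ∀ x₀, ContMDiffAt 𝓘(ℝ, E) 𝓘(ℝ, E [⋀^Fin n]→L[ℝ] ℝ) ∞ (w.coord x₀) x₀ := by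
  refine forall_congr' (fun x₀ => ?_)
  rw [contMDiffAt_totalSpace]
  have h : (fun x => (trivializationAt (E [⋀^Fin n]→L[ℝ] ℝ)
      (fun x : M => TangentSpace 𝓘(ℝ, E) x [⋀^Fin n]→L[ℝ] ℝ) x₀
        (TotalSpace.mk' (E [⋀^Fin n]→L[ℝ] ℝ) x (w x))).2) = w.coord x₀ := by
    funext x
    ext v
    simp [FiberBundle.trivializationAt_continuousAlternatingMap_apply,
      ContinuousAlternatingMap.inCoordinates, DForm.coord]
  constructor
  · intro H
    exact h ▸ H.2
  · intro H
    refine ⟨contMDiffAt_id, ?_⟩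
    exact h.symm ▸ H

lemma DForm.Smooth.pullback {n : ℕ} {w : DForm E M n} (hw : w.Smooth) {f : M → M}
    (hf : ContMDiff 𝓘(ℝ, E) 𝓘(ℝ, E) ∞ f) : (w.pullback f).Smooth := by
  rw [DForm.smooth_iff] at hw ⊢
  intro x₀
  have h1 : ContMDiffAt 𝓘(ℝ, E) 𝓘(ℝ, E [⋀^Fin n]→L[ℝ] ℝ) ∞ (fun x => w.coord (f x₀) (f x)) x₀ :=
    (hw (f x₀)).comp x₀ (hf x₀)
  have h2 := (hf x₀).mfderiv_const (m := ∞) (by simp)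
  have h3 := (contDiff_altComp (E := E) n).contMDiff.contMDiffAt.comp x₀ (h1.prodMk_space h2)
  refine h3.congr_of_eventuallyEq ?_
  have hb : ∀ᶠ x in nhds x₀, f x ∈ (trivializationAt E (TangentSpace 𝓘(ℝ, E)) (f x₀)).baseSet :=
    (hf x₀).continuousAt.preimage_mem_nhds
      ((trivializationAt E (TangentSpace 𝓘(ℝ, E)) (f x₀)).open_baseSet.mem_nhds
        (FiberBundle.mem_baseSet_trivializationAt' (f x₀)))
  filter_upwards [hb] with x hx
  ext v
  simp only [DForm.coord, DForm.pullback, inTangentCoordinates, ContinuousLinearMap.inCoordinates,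
    Function.comp_def, ContinuousAlternatingMap.compContinuousLinearMap_apply,
    ContinuousLinearMap.comp_apply, id_eq]
  congr 1
  funext i
  exact ((trivializationAt E (TangentSpace 𝓘(ℝ, E)) (f x₀)).symmL_continuousLinearMapAt
    (R := ℝ) hx _).symm

lemma DForm.smooth_zero (n : ℕ) : (0 : DForm E M n).Smooth := by
  rw [DForm.smooth_iff]
  intro x₀
  have h : DForm.coord (0 : DForm E M n) x₀ = fun _ => 0 := by
    funext x; ext v; simp [DForm.coord]
  rw [h]
  exact contMDiffAt_const

lemma DForm.Smooth.add {n : ℕ} {v w : DForm E M n} (hv : v.Smooth) (hw : w.Smooth) :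
    (v + w).Smooth := by
  rw [DForm.smooth_iff] at *
  intro x₀
  have h : DForm.coord (v + w) x₀ = fun x => v.coord x₀ x + w.coord x₀ x := by
    funext x; ext v; simp [DForm.coord]
  rw [h]
  exact (hv x₀).add (hw x₀)

lemma DForm.Smooth.neg {n : ℕ} {w : DForm E M n} (hw : w.Smooth) : (-w).Smooth := by
  rw [DForm.smooth_iff] at *
  intro x₀
  have h : DForm.coord (-w) x₀ = fun x => -(w.coord x₀ x) := by
    funext x; ext v; simp [DForm.coord]
  rw [h]
  exact (hw x₀).neg

lemma DForm.pullback_id {n : ℕ} (w : DForm E M n) : w.pullback id = w := by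
  funext x
  ext v
  simp [DForm.pullback]

lemma DForm.pullback_comp {n : ℕ} (w : DForm E M n) {f g : M → M}
    (hf : ContMDiff 𝓘(ℝ, E) 𝓘(ℝ, E) ∞ f) (hg : ContMDiff 𝓘(ℝ, E) 𝓘(ℝ, E) ∞ g) :
    w.pullback (f ∘ g) = (w.pullback f).pullback g := by
  funext x
  ext v
  have h := mfderiv_comp x ((hf.mdifferentiable (by simp)) (g x)) ((hg.mdifferentiable (by simp)) x)
  simp only [DForm.pullback, ContinuousAlternatingMap.compContinuousLinearMap_apply]
  rw [h]
  rfl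

lemma DForm.pullback_add {n : ℕ} (v w : DForm E M n) (f : M → M) :
    (v + w).pullback f = v.pullback f + w.pullback f := rfl

lemma DForm.pullback_neg {n : ℕ} (w : DForm E M n) (f : M → M) :
    (-w).pullback f = -(w.pullback f) := rfl

lemma DForm.pullback_zero {n : ℕ} (f : M → M) :
    (0 : DForm E M n).pullback f = 0 := rfl

/-- The composition law `(λ, α) · (μ, β) = (λ μ, μ^* α + β)`. -/
instance : Mul (GenSym E M) where
  mul g h :=
    { diffeo := h.diffeo.trans g.diffeo
      bField := g.bField.pullback h.diffeo + h.bField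
      smooth := (g.smooth.pullback h.diffeo.contMDiff).add h.smooth }

instance : One (GenSym E M) where
  one :=
    { diffeo := Diffeomorph.refl 𝓘(ℝ, E) M ∞
      bField := 0
      smooth := DForm.smooth_zero 2 }

instance : Inv (GenSym E M) where
  inv g :=
    { diffeo := g.diffeo.symm
      bField := -(g.bField.pullback g.diffeo.symm)
      smooth := (g.smooth.pullback g.diffeo.symm.contMDiff).neg }

/-- The group `Diff(M) ⋉ Ω²(M)` of generalized symmetries. -/
instance : Group (GenSym E M) :=
  Group.ofLeftAxioms
    (by
      intro g h k
      refine GenSym.ext (Diffeomorph.ext fun x => rfl) ?_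
      change ((g.bField.pullback h.diffeo + h.bField).pullback k.diffeo) + k.bField =
        g.bField.pullback (h.diffeo ∘ k.diffeo) + (h.bField.pullback k.diffeo + k.bField)
      rw [DForm.pullback_add, DForm.pullback_comp _ h.diffeo.contMDiff k.diffeo.contMDiff, add_assoc])
    (by
      intro g
      refine GenSym.ext (Diffeomorph.ext fun x => rfl) ?_
      change (0 : DForm E M 2).pullback g.diffeo + g.bField = g.bField
      rw [DForm.pullback_zero, zero_add])
    (by
      intro g
      refine GenSym.ext (Diffeomorph.ext fun x => g.diffeo.symm_apply_apply x) ?_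
      change (-(g.bField.pullback g.diffeo.symm)).pullback g.diffeo + g.bField = 0
      rw [DForm.pullback_neg, ← DForm.pullback_comp _ g.diffeo.symm.contMDiff g.diffeo.contMDiff]
      have h : (g.diffeo.symm ∘ g.diffeo : M → M) = id :=
        funext fun x => g.diffeo.symm_apply_apply x
      rw [h, DForm.pullback_id, neg_add_cancel])

/-- The action of `(λ, α)` on generalized tangent vectors: with `x = λ⁻¹(y)`, it sends
`X + ξ ∈ T_x M ⊕ T_x^* M` to `λ_* X + (λ⁻¹)^* (ξ + ι_X α) ∈ T_y M ⊕ T_y^* M`. The push-forward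
`λ_* = dλ_x` is written as the inverse of `d(λ⁻¹)_y`. -/
def GenSym.act (g : GenSym E M) (y : M) (u : GTan E (g.diffeo.symm y)) : GTan E y :=
  ((mfderiv 𝓘(ℝ, E) 𝓘(ℝ, E) g.diffeo.symm y).inverse u.1,
    (u.2 + iota₂ u.1 (g.bField (g.diffeo.symm y))).comp
      (mfderiv 𝓘(ℝ, E) 𝓘(ℝ, E) g.diffeo.symm y))

/-- The action of a generalized symmetry on sections of `TM ⊕ T^*M`. -/
def GenSym.push (g : GenSym E M) (A : GField E M) : GField E M :=
  fun y => g.act y (A (g.diffeo.symm y))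

/-- `g` preserves the `H`-twisted Courant bracket. -/
def GenSym.PreservesBracket (H : DForm E M 3) (g : GenSym E M) : Prop :=
  ∀ A B : GField E M, A.Smooth → B.Smooth →
    g.push (courant H A B) = courant H (g.push A) (g.push B)

/-- `g` preserves `J`: the action of `g` on `TM ⊕ T^*M` commutes with `J`. -/
def GenSym.PreservesStructure (J : GenAlmostComplex E M) (g : GenSym E M) : Prop :=
  ∀ (y : M) (u : GTan E (g.diffeo.symm y)),
    g.act y (J.toFun (g.diffeo.symm y) u) = J.toFun y (g.act y u)

lemma iota₃_apply {x : M} (u v z : TanSp E x) (w : TangentSpace 𝓘(ℝ, E) x [⋀^Fin 3]→L[ℝ] ℝ) :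
    iota₃ u v w z = w ![u, v, z] := by
  have h : Function.update ![u, v, 0] 2 z = ![u, v, z] := by
    ext i; fin_cases i <;> rfl
  change w (Function.update ![u, v, 0] 2 z) = w ![u, v, z]
  rw [h]

/-- The formula for the action, in a fixed vector space. -/
def actE (D : E →L[ℝ] E) (a : E [⋀^Fin 2]→L[ℝ] ℝ) (u : E × (E →L[ℝ] ℝ)) : E × (E →L[ℝ] ℝ) :=
  (D.inverse u.1, (u.2 + a.toContinuousLinearMap ![u.1, 0] 1).comp D)

lemma iotaE_apply (a : E [⋀^Fin 2]→L[ℝ] ℝ) (v z : E) :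
    a.toContinuousLinearMap ![v, 0] 1 z = a ![v, z] := by
  have h : Function.update ![v, 0] 1 z = ![v, z] := by
    ext i; fin_cases i <;> rfl
  change a (Function.update ![v, 0] 1 z) = a ![v, z]
  rw [h]

lemma iota₂_apply {x : M} (v z : TanSp E x) (w : TangentSpace 𝓘(ℝ, E) x [⋀^Fin 2]→L[ℝ] ℝ) :
    iota₂ v w z = w ![v, z] := iotaE_apply (E := E) w v z

lemma actE_id (u : E × (E →L[ℝ] ℝ)) : actE (ContinuousLinearMap.id ℝ E) 0 u = u := by
  refine Prod.ext (by simp [actE]) ?_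
  ext z
  simp [actE]

lemma actE_comp {D D' D₁ : E →L[ℝ] E} (hD : D' ∘L D = ContinuousLinearMap.id ℝ E)
    (hD' : D ∘L D' = ContinuousLinearMap.id ℝ E) (a b : E [⋀^Fin 2]→L[ℝ] ℝ)
    (u : E × (E →L[ℝ] ℝ)) :
    actE (D ∘L D₁) (a.compContinuousLinearMap D' + b) u = actE D₁ a (actE D b u) := by
  have hinv : D.IsInvertible := ⟨ContinuousLinearEquiv.equivOfInverse D D'
    (fun x => congrArg (fun L : E →L[ℝ] E => L x) hD)
    (fun x => congrArg (fun L : E →L[ℝ] E => L x) hD'), rfl⟩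
  have hi : D.inverse = D' := by
    have h1 := hinv.inverse_comp_self
    have h2 : (D.inverse ∘L D) ∘L D' = D' := by rw [h1]; rfl
    rw [ContinuousLinearMap.comp_assoc, hD'] at h2
    exact h2
  refine Prod.ext ?_ ?_
  · simp [actE, hinv.inverse_comp_of_left]
  · ext z
    have h3 : D' (D (D₁ z)) = D₁ z := congrArg (fun L : E →L[ℝ] E => L (D₁ z)) hD
    have h4 : (fun i => D' ((![u.1, D (D₁ z)] : Fin 2 → E) i)) = ![D' u.1, D₁ z] := by
      funext i; fin_cases i
      · rfl
      · exact h3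
    have h5 : (a.compContinuousLinearMap D' + b) ![u.1, D (D₁ z)] =
        a ![D' u.1, D₁ z] + b ![u.1, D (D₁ z)] := by
      rw [← h4]; rfl
    simp only [actE, hi, ContinuousLinearMap.comp_apply, add_apply, iotaE_apply, h5]
    ring

lemma GenSym.act_one (y : M) (u : GTan E y) : (1 : GenSym E M).act y u = u := by
  have h : (mfderiv 𝓘(ℝ, E) 𝓘(ℝ, E) ((1 : GenSym E M).diffeo.symm) y : E →L[ℝ] E) =
    ContinuousLinearMap.id ℝ E := mfderiv_id
  have h1 := actE_id (E := E) u
  rw [← h] at h1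
  exact h1

lemma mfderiv_comp_eq_id {f g : M → M} (hf : ContMDiff 𝓘(ℝ, E) 𝓘(ℝ, E) ∞ f)
    (hg : ContMDiff 𝓘(ℝ, E) 𝓘(ℝ, E) ∞ g) (h : ∀ x, f (g x) = x) (x : M) :
    (mfderiv 𝓘(ℝ, E) 𝓘(ℝ, E) f (g x) : E →L[ℝ] E) ∘L
      (mfderiv 𝓘(ℝ, E) 𝓘(ℝ, E) g x : E →L[ℝ] E) = ContinuousLinearMap.id ℝ E := by
  have h1 := mfderiv_comp x ((hf.mdifferentiable (by simp)) (g x)) ((hg.mdifferentiable (by simp)) x)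
  have h2 : f ∘ g = id := funext h
  rw [h2, mfderiv_id] at h1
  exact h1.symm

lemma isInvertible_mfderiv_symm (f : M ≃ₘ^∞⟮𝓘(ℝ, E), 𝓘(ℝ, E)⟯ M) (y : M) :
    (mfderiv 𝓘(ℝ, E) 𝓘(ℝ, E) f.symm y).IsInvertible :=
  ⟨f.symm.mfderivToContinuousLinearEquiv (by simp) y, rfl⟩

lemma GenSym.act_mul (g h : GenSym E M) (y : M) (u : GTan E ((g * h).diffeo.symm y)) :
    (g * h).act y u = g.act y (h.act (g.diffeo.symm y) u) := by
  have hc : (mfderiv 𝓘(ℝ, E) 𝓘(ℝ, E) (g * h).diffeo.symm y : E →L[ℝ] E) =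
      (mfderiv 𝓘(ℝ, E) 𝓘(ℝ, E) h.diffeo.symm (g.diffeo.symm y) : E →L[ℝ] E) ∘L
        (mfderiv 𝓘(ℝ, E) 𝓘(ℝ, E) g.diffeo.symm y : E →L[ℝ] E) :=
    mfderiv_comp y ((h.diffeo.symm.mdifferentiable (by simp)) (g.diffeo.symm y))
      ((g.diffeo.symm.mdifferentiable (by simp)) y)
  set p := g.diffeo.symm y with hp
  have hD := mfderiv_comp_eq_id (E := E) h.diffeo.contMDiff h.diffeo.symm.contMDiff
    h.diffeo.apply_symm_apply p
  have hD' := mfderiv_comp_eq_id (E := E) h.diffeo.symm.contMDiff h.diffeo.contMDiff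
    h.diffeo.symm_apply_apply (h.diffeo.symm p)
  have e1 : h.diffeo (h.diffeo.symm p) = p := h.diffeo.apply_symm_apply p
  have e2 : ∀ q : M, q = p → (g.bField q : E [⋀^Fin 2]→L[ℝ] ℝ) = g.bField p ∧
      (mfderiv 𝓘(ℝ, E) 𝓘(ℝ, E) h.diffeo.symm q : E →L[ℝ] E) =
        mfderiv 𝓘(ℝ, E) 𝓘(ℝ, E) h.diffeo.symm p := by
    rintro q rfl; exact ⟨rfl, rfl⟩
  obtain ⟨e3, e4⟩ := e2 _ e1
  rw [e4] at hD'
  have key := actE_comp (E := E) (D₁ := mfderiv 𝓘(ℝ, E) 𝓘(ℝ, E) g.diffeo.symm y) hD hD'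
    (g.bField p) (h.bField (h.diffeo.symm p)) u
  rw [← e3] at key
  refine Eq.trans (Eq.trans ?_ (congrArg (fun L => actE (E := E) L _ u) hc)) (key.trans ?_)
  · rfl
  · rw [e3]
    rfl

/-- Smoothness of a covector field, as a section of the cotangent bundle. -/
def CoField.Smooth (ξ : CoField E M) : Prop :=
  ContMDiff 𝓘(ℝ, E) (𝓘(ℝ, E).prod 𝓘(ℝ, E →L[ℝ] ℝ)) ∞
    (fun x : M => TotalSpace.mk' (E →L[ℝ] ℝ)
      (E := fun x : M => TangentSpace 𝓘(ℝ, E) x →L[ℝ] ℝ) x (ξ x))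

/-- Reading a covector field in the trivialization at `x₀`. -/
def CoField.coord (ξ : CoField E M) (x₀ x : M) : E →L[ℝ] ℝ :=
  (ξ x).comp ((trivializationAt E (TangentSpace 𝓘(ℝ, E)) x₀).symmL ℝ x)

lemma CoField.smooth_iff (ξ : CoField E M) :
    ξ.Smooth ↔ ∀ x₀, ContMDiffAt 𝓘(ℝ, E) 𝓘(ℝ, E →L[ℝ] ℝ) ∞ (ξ.coord x₀) x₀ := by
  refine forall_congr' (fun x₀ => ?_)
  rw [contMDiffAt_totalSpace]
  have h : (fun x => (trivializationAt (E →L[ℝ] ℝ)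
      (fun x : M => TangentSpace 𝓘(ℝ, E) x →L[ℝ] ℝ) x₀
        (TotalSpace.mk' (E →L[ℝ] ℝ) x (ξ x))).2) = ξ.coord x₀ := by
    funext x
    ext v
    simp [hom_trivializationAt_apply, ContinuousLinearMap.inCoordinates, CoField.coord]
  constructor
  · intro H
    exact h ▸ H.2
  · intro H
    refine ⟨contMDiffAt_id, ?_⟩
    exact h.symm ▸ H

lemma contDiff_iotaE :
    ContDiff ℝ ∞ (fun p : (E [⋀^Fin 2]→L[ℝ] ℝ) × E => p.1.toContinuousLinearMap ![p.2, 0] 1) := by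
  have h : (fun p : (E [⋀^Fin 2]→L[ℝ] ℝ) × E => p.1.toContinuousLinearMap ![p.2, 0] 1) =
      fun p => (ContinuousAlternatingMap.ofSubsingletonLIE (𝕜 := ℝ) (E := E) (F := ℝ) (0 : Fin 1)).symm
        (ContinuousAlternatingMap.curryLeftLI (𝕜 := ℝ) (E := E) (F := ℝ) (n := 1) p.1 p.2) := by
    funext p
    ext z
    rw [iotaE_apply]
    change p.1 ![p.2, z] = p.1 (Matrix.vecCons p.2 (fun _ => z))
    congr 1
    ext i; fin_cases i <;> rfl
  rw [h]
  refine (LinearIsometryEquiv.contDiff _).comp (ContDiff.clm_apply ?_ contDiff_snd)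
  exact (LinearIsometry.contDiff _).comp contDiff_fst

lemma GenSym.push_smooth [FiniteDimensional ℝ E] (g : GenSym E M) {A : GField E M} (hA : A.Smooth) :
    (g.push A).Smooth := by
  have : CompleteSpace E := FiniteDimensional.complete ℝ E
  refine ⟨?_, ?_⟩
  · exact ContMDiff.mpullback_vectorField (n := ∞) hA.1 g.diffeo.symm.contMDiff
      (isInvertible_mfderiv_symm g.diffeo) (by simp)
  · let f : M → M := fun y => g.diffeo.symm y
    have hf : ContMDiff 𝓘(ℝ, E) 𝓘(ℝ, E) ∞ f := g.diffeo.symm.contMDiff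
    have hα := (DForm.smooth_iff _).1 g.smooth
    have hξ := (CoField.smooth_iff (fun x => (A x).2)).1 hA.2
    refine (CoField.smooth_iff _).2 (fun y₀ => ?_)
    have hX := (contMDiffAt_totalSpace.1 (hA.1 (f y₀))).2
    have h1 := (hξ (f y₀)).add ((contDiff_iotaE (E := E)).contMDiff.contMDiffAt.comp (f y₀)
      ((hα (f y₀)).prodMk_space hX))
    have h2 := (hf y₀).mfderiv_const (m := ∞) (by simp)
    have h3 := (h1.comp y₀ (hf y₀)).clm_comp h2
    refine h3.congr_of_eventuallyEq ?_
    have hb : ∀ᶠ y in nhds y₀, f y ∈ (trivializationAt E (TangentSpace 𝓘(ℝ, E)) (f y₀)).baseSet :=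
      (hf y₀).continuousAt.preimage_mem_nhds
        ((trivializationAt E (TangentSpace 𝓘(ℝ, E)) (f y₀)).open_baseSet.mem_nhds
          (FiberBundle.mem_baseSet_trivializationAt' (f y₀)))
    filter_upwards [hb] with y hy
    ext v
    set T := trivializationAt E (TangentSpace (M := M) 𝓘(ℝ, E)) (f y₀) with hT
    have e1 : T.symmL ℝ (f y) ((T (TotalSpace.mk' E (f y) (A (f y)).1)).2) = (A (f y)).1 := by
      have h := T.symmL_continuousLinearMapAt (R := ℝ) hy (A (f y)).1
      rwa [Trivialization.continuousLinearMapAt_apply, Trivialization.linearMapAt_apply,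
        if_pos hy] at h
    let w : TanSp E (f y) := mfderiv 𝓘(ℝ, E) 𝓘(ℝ, E) f y
      ((trivializationAt E (TangentSpace (M := M) 𝓘(ℝ, E)) y₀).symmL ℝ y v)
    have e2 : T.symmL ℝ (f y) (T.continuousLinearMapAt ℝ (f y) w) = w :=
      T.symmL_continuousLinearMapAt (R := ℝ) hy w
    have e3 : ((A (f y)).2 + iota₂ (A (f y)).1 (g.bField (f y))) w =
        (A (f y)).2 w + g.bField (f y) ![(A (f y)).1, w] := by
      rw [add_apply, iota₂_apply]
    have e4 : (g.bField.coord (f y₀) (f y)).toContinuousLinearMap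
        ![(T (TotalSpace.mk' E (f y) (A (f y)).1)).2, 0] 1 (T.continuousLinearMapAt ℝ (f y) w) =
        g.bField (f y) ![(A (f y)).1, w] := by
      rw [iotaE_apply]
      change g.bField (f y) (fun i => T.symmL ℝ (f y)
        ((![(T (TotalSpace.mk' E (f y) (A (f y)).1)).2, T.continuousLinearMapAt ℝ (f y) w] :
          Fin 2 → E) i)) = _
      congr 1
      funext i
      fin_cases i
      · exact e1
      · exact e2
    have e5 : (A (f y)).2 (T.symmL ℝ (f y) (T.continuousLinearMapAt ℝ (f y) w)) =
        (A (f y)).2 w := by rw [e2]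
    exact e3.trans (congrArg₂ (· + ·) e5 e4).symm

lemma GenSym.push_one (A : GField E M) : (1 : GenSym E M).push A = A :=
  funext fun y => GenSym.act_one y _

lemma GenSym.push_mul (g h : GenSym E M) (A : GField E M) :
    (g * h).push A = g.push (h.push A) :=
  funext fun y => GenSym.act_mul g h y _

/-- The group `𝒢_H` of generalized symmetries preserving the `H`-twisted Courant bracket. -/
def twistedSymGroup [FiniteDimensional ℝ E] (H : DForm E M 3) : Subgroup (GenSym E M) where
  carrier := {g | g.PreservesBracket H}
  mul_mem' := by
    intro g h hg hh A B hA hB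
    rw [GenSym.push_mul, GenSym.push_mul, GenSym.push_mul, hh A B hA hB,
      hg _ _ (h.push_smooth hA) (h.push_smooth hB)]
  one_mem' := by
    intro A B _ _
    rw [GenSym.push_one, GenSym.push_one, GenSym.push_one]
  inv_mem' := by
    intro g hg A B hA hB
    have h := congrArg g⁻¹.push (hg _ _ (g⁻¹.push_smooth hA) (g⁻¹.push_smooth hB))
    rw [← GenSym.push_mul, inv_mul_cancel, GenSym.push_one, ← GenSym.push_mul, ← GenSym.push_mul,
      mul_inv_cancel, GenSym.push_one, GenSym.push_one] at h
    exact h.symm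

lemma GenSym.preservesStructure_iff (J : GenAlmostComplex E M) (g : GenSym E M) :
    g.PreservesStructure J ↔ ∀ A : GField E M,
      g.push (fun x => J.toFun x (A x)) = fun y => J.toFun y (g.push A y) := by
  constructor
  · intro h A
    exact funext fun y => h y _
  · intro h y u
    classical
    have h1 := congrFun (h (Function.update (fun _ => 0) (g.diffeo.symm y) u)) y
    simpa [GenSym.push] using h1

/-- The group of generalized symmetries whose action commutes with `J`. -/
def structureSymGroup (J : GenAlmostComplex E M) : Subgroup (GenSym E M) where
  carrier := {g | g.PreservesStructure J}
  mul_mem' := by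
    intro g h hg hh
    rw [Set.mem_ofPred_eq, GenSym.preservesStructure_iff] at *
    intro A
    rw [GenSym.push_mul, GenSym.push_mul, hh A, hg]
  one_mem' := by
    rw [Set.mem_ofPred_eq, GenSym.preservesStructure_iff]
    intro A
    rw [GenSym.push_one, GenSym.push_one]
  inv_mem' := by
    intro g hg
    rw [Set.mem_ofPred_eq, GenSym.preservesStructure_iff] at *
    intro A
    have h := congrArg g⁻¹.push (hg (g⁻¹.push A))
    rw [← GenSym.push_mul, inv_mul_cancel, GenSym.push_one, ← GenSym.push_mul, mul_inv_cancel,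
      GenSym.push_one] at h
    exact h.symm

/-- The group `𝒢_J` of generalized symmetries preserving the `H`-twisted Courant bracket and the
generalized complex structure `J`. -/
def symGroup [FiniteDimensional ℝ E] (H : DForm E M 3) (J : GenAlmostComplex E M) :
    Subgroup (GenSym E M) :=
  twistedSymGroup H ⊓ structureSymGroup J

/-! ### Hamiltonian symmetries -/

/-- The twisted infinitesimal symmetry `ψ_H(X, A) = (X, A - ι_X H)`. -/
def psi (H : DForm E M 3) (x : VField E M × DForm E M 2) : VField E M × DForm E M 2 :=
  (x.1, x.2 - DForm.interior x.1 H)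

/-- The Hamiltonian field `X_f + ξ_f = J(df)` of a function `f`. -/
def GenAlmostComplex.hamField (J : GenAlmostComplex E M) (f : M → ℝ) : GField E M :=
  fun x => J.toFun x (0, dfun f x)

/-- The twisted infinitesimal symmetry `ψ_H(X_f, dξ_f)` of a Hamiltonian function `f`. -/
def hamInfinitesimal (H : DForm E M 3) (J : GenAlmostComplex E M) (f : M → ℝ) :
    VField E M × DForm E M 2 :=
  psi H (fun x => (J.hamField f x).1, DForm.d (CoField.toDForm fun x => (J.hamField f x).2))

/-- A smooth path `g_t = (λ_t, α_t)` of generalized symmetries starting from the identity is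
generated by the path `(X_t, A_t)` of infinitesimal symmetries if
`d/dt λ_t(x) = X_t(λ_t(x))` and `d/dt α_t = λ_t^* A_t`. -/
structure GenSym.IsGeneratedBy (g : ℝ → GenSym E M) (a : ℝ → VField E M × DForm E M 2) :
    Prop where
  smooth_diffeo : ContMDiff (𝓘(ℝ, ℝ).prod 𝓘(ℝ, E)) 𝓘(ℝ, E) ∞
    (fun p : ℝ × M => (g p.1).diffeo p.2)
  smooth_bField : DForm.SmoothFamily (fun t => (g t).bField)
  start : g 0 = 1
  deriv_diffeo : ∀ (t : ℝ) (x : M),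
    HasMFDerivAt 𝓘(ℝ, ℝ) 𝓘(ℝ, E) (fun s : ℝ => (g s).diffeo x) t
      ((1 : ℝ →L[ℝ] ℝ).smulRight ((a t).1 ((g t).diffeo x)))
  deriv_bField : ∀ (t : ℝ) (x : M) (u v : TanSp E x),
    HasDerivAt (fun s : ℝ => (g s).bField x ![u, v])
      (((a t).2.pullback (g t).diffeo) x ![u, v]) t

/-- The time-dependent Hamiltonian function `F_t` generates the path `g_t` of generalized
symmetries. -/
def IsHamPath (H : DForm E M 3) (J : GenAlmostComplex E M) (F : ℝ → M → ℝ)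
    (g : ℝ → GenSym E M) : Prop :=
  ContMDiff (𝓘(ℝ, ℝ).prod 𝓘(ℝ, E)) 𝓘(ℝ, ℝ) ∞ (fun p : ℝ × M => F p.1 p.2) ∧
    GenSym.IsGeneratedBy g (fun t => hamInfinitesimal H J (F t))

/-- The set `Ham(M, J)` of time-`1` maps of paths of generalized symmetries generated by
time-dependent Hamiltonian functions. -/
def hamSet (H : DForm E M 3) (J : GenAlmostComplex E M) : Set (GenSym E M) :=
  {g | ∃ (F : ℝ → M → ℝ) (γ : ℝ → GenSym E M), IsHamPath H J F γ ∧ γ 1 = g}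

end Smooth

end GenGeom

end

open GenGeom

/-!
The theorem rests on four facts. The local computations are made at the centre of a preferred
chart, where the derivative of the chart is the identity.

*The twisting form.* Along a path generated by `(X_t, A_t)`, Cartan's formula and `dH = 0` give
`d/dt (λ_t^* H + dα_t) = λ_t^* d(ι_{X_t} H + A_t)`. For Hamiltonian paths
`A_t = dξ_t - ι_{X_t} H`, so that `λ_t^* H + dα_t = H` for all `t`
(`IsHamPath.pullback_add_d`). A generalized symmetry with this property preserves the twisted
Courant bracket (`GenSym.preservesBracket_of_pullback_add_d`).

*The complex structure.* Replacing the Courant bracket by the Dorfman bracket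
`[A, B]_H + d⟨A, B⟩`, integrability tested on the `+i`-sections `J(df) + i df` and `J B + i B` says
that the Dorfman bracket with `J(df)` commutes with `J`, because exact sections act trivially and
the exact terms cancel by orthogonality (`GenAlmostComplex.Integrable.dorfman_hamField`). The
Dorfman bracket with `J(df)` is the infinitesimal action of the symmetry `ψ_H(X_f, dξ_f)`; hence the
endomorphism `J`, transported back along a Hamiltonian path to the initial point, is constant. This
is shown for the scalar functions `⟨J g_t u, g_t v⟩` of `t` (`IsHamPath.hasDerivAt_pairE`), and the
nondegeneracy of the pairing gives `IsHamPath.preservesStructure`.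

*Products.* As `(λ, α) = g_t` commutes with `J`, the Hamiltonian field of `f ∘ λ⁻¹` is the
push-forward by `(λ, α)` of that of `f`. On form parts the push-forward produces, through `λ^* H + dα = H`,
exactly the Lie derivative `L_{X_f} α = d ι_{X_f} α + ι_{X_f} dα`
(`GenSym.pullback_hamInfinitesimal_comp_symm`), which is also what appears when `μ_t^* α_t` is
differentiated along the second flow. This gives the composition formula `IsHamPath.mul`. The
Hamiltonian `F_t + G_t ∘ λ_t⁻¹` is smooth by the inverse function theorem with a parameter
(`contMDiff_symm_family`).

*Inverses.* The path `g_{1-t} g_1⁻¹` is generated by `-F_{1-t}` and ends at `g_1⁻¹`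
(`IsHamPath.reverse`).
-/

noncomputable section

namespace GenGeom

/-! ### Calculus of forms in a normed space -/

section Model

variable {E : Type*} [NormedAddCommGroup E] [NormedSpace ℝ E]

lemma two_le_infty : (2 : ℕ∞ω) ≤ ∞ := WithTop.coe_le_coe.2 (le_top (a := (2 : ℕ∞)))

lemma fderiv_form_apply {n : ℕ} {a : E → E [⋀^Fin n]→L[ℝ] ℝ} {z : E} (ha : DifferentiableAt ℝ a z)
    (v : Fin n → E) (u : E) : fderiv ℝ (fun e => a e v) z u = fderiv ℝ a z u v := by
  have h := ((ContinuousAlternatingMap.apply ℝ E ℝ v).hasFDerivAt.comp z ha.hasFDerivAt).fderiv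
  exact congrArg (fun L : E →L[ℝ] ℝ => L u) h

lemma extDeriv_one_apply {ξ : E → E →L[ℝ] ℝ} {z : E} (hξ : DifferentiableAt ℝ ξ z) (u v : E) :
    extDeriv (fun e => ContinuousAlternatingMap.ofSubsingleton ℝ E ℝ (0 : Fin 1) (ξ e)) z ![u, v] =
      fderiv ℝ ξ z u v - fderiv ℝ ξ z v u := by
  have h1 : DifferentiableAt ℝ
      (fun e => ContinuousAlternatingMap.ofSubsingleton ℝ E ℝ (0 : Fin 1) (ξ e)) z :=
    (ContinuousAlternatingMap.ofSubsingletonLIE (𝕜 := ℝ) (E := E) (F := ℝ)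
      (0 : Fin 1)).differentiable.differentiableAt.comp z hξ
  have h2 : ∀ w t : E, fderiv ℝ (fun e => ξ e w) z t = fderiv ℝ ξ z t w := by
    intro w t
    rw [fderiv_clm_apply hξ (differentiableAt_const w)]
    simp
  rw [extDeriv_apply h1, Fin.sum_univ_two]
  simp [Fin.removeNth, h2, sub_eq_add_neg]

lemma extDeriv_two_apply {a : E → E [⋀^Fin 2]→L[ℝ] ℝ} {z : E} (ha : DifferentiableAt ℝ a z)
    (u v w : E) : extDeriv a z ![u, v, w] =
      fderiv ℝ a z u ![v, w] - fderiv ℝ a z v ![u, w] + fderiv ℝ a z w ![u, v] := by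
  have e0 : (0 : Fin 3).removeNth ![u, v, w] = ![v, w] := by ext i; fin_cases i <;> rfl
  have e1 : (1 : Fin 3).removeNth ![u, v, w] = ![u, w] := by ext i; fin_cases i <;> rfl
  have e2 : (2 : Fin 3).removeNth ![u, v, w] = ![u, v] := by ext i; fin_cases i <;> rfl
  rw [extDeriv_apply ha, Fin.sum_univ_three, e0, e1, e2]
  simp [fderiv_form_apply ha, sub_eq_add_neg]

lemma extDeriv_three_apply {a : E → E [⋀^Fin 3]→L[ℝ] ℝ} {z : E} (ha : DifferentiableAt ℝ a z)
    (t u v w : E) : extDeriv a z ![t, u, v, w] =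
      fderiv ℝ a z t ![u, v, w] - fderiv ℝ a z u ![t, v, w] + fderiv ℝ a z v ![t, u, w]
        - fderiv ℝ a z w ![t, u, v] := by
  have e0 : (0 : Fin 4).removeNth ![t, u, v, w] = ![u, v, w] := by ext i; fin_cases i <;> rfl
  have e1 : (1 : Fin 4).removeNth ![t, u, v, w] = ![t, v, w] := by ext i; fin_cases i <;> rfl
  have e2 : (2 : Fin 4).removeNth ![t, u, v, w] = ![t, u, w] := by ext i; fin_cases i <;> rfl
  have e3 : (3 : Fin 4).removeNth ![t, u, v, w] = ![t, u, v] := by ext i; fin_cases i <;> rfl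
  rw [extDeriv_apply ha, Fin.sum_univ_four, e0, e1, e2, e3]
  simp [fderiv_form_apply ha, sub_eq_add_neg, pow_succ]

lemma compCLM_two (a : E [⋀^Fin 2]→L[ℝ] ℝ) (D : E →L[ℝ] E) (u v : E) :
    a.compContinuousLinearMap D ![u, v] = a ![D u, D v] := by
  change a (fun i => D (![u, v] i)) = _
  congr 1; ext i; fin_cases i <;> rfl

lemma compCLM_three (a : E [⋀^Fin 3]→L[ℝ] ℝ) (D : E →L[ℝ] E) (u v w : E) :
    a.compContinuousLinearMap D ![u, v, w] = a ![D u, D v, D w] := by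
  change a (fun i => D (![u, v, w] i)) = _
  congr 1; ext i; fin_cases i <;> rfl

lemma map_swap_two (a : E [⋀^Fin 2]→L[ℝ] ℝ) (u v : E) : a ![u, v] = -a ![v, u] := by
  have h := a.toAlternatingMap.map_swap ![v, u] (i := 0) (j := 1) (by decide)
  have h' : (![v, u] ∘ Equiv.swap (0 : Fin 2) 1) = ![u, v] := by
    ext i; fin_cases i <;> rfl
  rw [h'] at h
  exact h

lemma map_sub_two (a : E [⋀^Fin 2]→L[ℝ] ℝ) (u v w : E) :
    a ![u - v, w] = a ![u, w] - a ![v, w] := by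
  have h : ∀ t, a ![t, w] = ContinuousAlternatingMap.curryLeft a t ![w] := fun t => rfl
  rw [h, h, h, map_sub]
  rfl

lemma hasDerivAt_compCLM_two {a : ℝ → E [⋀^Fin 2]→L[ℝ] ℝ} {a' : E [⋀^Fin 2]→L[ℝ] ℝ}
    {D : ℝ → E →L[ℝ] E} {D' : E →L[ℝ] E} {t : ℝ} (ha : HasDerivAt a a' t) (hD : HasDerivAt D D' t)
    (u v : E) :
    HasDerivAt (fun s => (a s).compContinuousLinearMap (D s) ![u, v])
      (a' ![D t u, D t v] + a t ![D' u, D t v] + a t ![D t u, D' v]) t := by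
  have h := (ha.hasFDerivAt.continuousAlternatingMapCompContinuousLinearMap
    hD.hasFDerivAt).hasDerivAt
  have h2 := (ContinuousAlternatingMap.apply ℝ E ℝ ![u, v]).hasFDerivAt.comp_hasDerivAt t h
  have h3 := h2.congr_deriv (g' := a' ![D t u, D t v] + a t ![D' u, D t v] + a t ![D t u, D' v]) ?_
  · exact h3
  · have e1 : (fun j : Fin 2 => (Function.update (fun _ => D t) 0 D' j) (![u, v] j)) =
        ![D' u, D t v] := by ext i; fin_cases i <;> rfl
    have e2 : (fun j : Fin 2 => (Function.update (fun _ => D t) 1 D' j) (![u, v] j)) =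
        ![D t u, D' v] := by ext i; fin_cases i <;> rfl
    have e3 : (fun i : Fin 2 => D t (![u, v] i)) = ![D t u, D t v] := by
      ext i; fin_cases i <;> rfl
    simp [Fin.sum_univ_two, e1, e2, Function.comp_def, e3]
    ring

lemma hasDerivAt_compCLM_three {a : ℝ → E [⋀^Fin 3]→L[ℝ] ℝ} {a' : E [⋀^Fin 3]→L[ℝ] ℝ}
    {D : ℝ → E →L[ℝ] E} {D' : E →L[ℝ] E} {t : ℝ} (ha : HasDerivAt a a' t) (hD : HasDerivAt D D' t)
    (u v w : E) :
    HasDerivAt (fun s => (a s).compContinuousLinearMap (D s) ![u, v, w])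
      (a' ![D t u, D t v, D t w] + a t ![D' u, D t v, D t w] + a t ![D t u, D' v, D t w]
        + a t ![D t u, D t v, D' w]) t := by
  have h := (ha.hasFDerivAt.continuousAlternatingMapCompContinuousLinearMap
    hD.hasFDerivAt).hasDerivAt
  have h2 := (ContinuousAlternatingMap.apply ℝ E ℝ ![u, v, w]).hasFDerivAt.comp_hasDerivAt t h
  have h3 := h2.congr_deriv (g' := a' ![D t u, D t v, D t w] + a t ![D' u, D t v, D t w]
    + a t ![D t u, D' v, D t w] + a t ![D t u, D t v, D' w]) ?_
  · exact h3
  · have e1 : (fun j : Fin 3 => (Function.update (fun _ => D t) 0 D' j) (![u, v, w] j)) =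
        ![D' u, D t v, D t w] := by ext i; fin_cases i <;> rfl
    have e2 : (fun j : Fin 3 => (Function.update (fun _ => D t) 1 D' j) (![u, v, w] j)) =
        ![D t u, D' v, D t w] := by ext i; fin_cases i <;> rfl
    have e4 : (fun j : Fin 3 => (Function.update (fun _ => D t) 2 D' j) (![u, v, w] j)) =
        ![D t u, D t v, D' w] := by ext i; fin_cases i <;> rfl
    have e3 : (fun i : Fin 3 => D t (![u, v, w] i)) = ![D t u, D t v, D t w] := by
      ext i; fin_cases i <;> rfl
    simp [Fin.sum_univ_three, e1, e2, e4, Function.comp_def, e3]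
    ring

/-- Time and space derivatives commute. -/
lemma hasDerivAt_fderiv_of_contDiffAt {G : Type*} [NormedAddCommGroup G] [NormedSpace ℝ G]
    {f : ℝ × E → G} {t : ℝ} {z : E} (hf : ContDiffAt ℝ ∞ f (t, z)) :
    HasDerivAt (fun s => fderiv ℝ (fun e => f (s, e)) z)
      (fderiv ℝ (fun e => deriv (fun s => f (s, e)) t) z) t := by
  have hf2 : ContDiffAt ℝ 2 f (t, z) := hf.of_le two_le_infty
  have hev : ∀ᶠ p in nhds (t, z), DifferentiableAt ℝ f p := by
    filter_upwards [(hf2.of_le (m := 1) one_le_two).eventually (by decide)] with p hp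
    exact hp.differentiableAt one_ne_zero
  have hd : DifferentiableAt ℝ (fderiv ℝ f) (t, z) :=
    (hf2.fderiv_right (m := 1) (by norm_num)).differentiableAt one_ne_zero
  have hsymm : IsSymmSndFDerivAt ℝ f (t, z) := hf2.isSymmSndFDerivAt (by simp)
  have hc1 : HasDerivAt (fun s : ℝ => (s, z)) ((1 : ℝ), (0 : E)) t :=
    (hasDerivAt_id t).prodMk (hasDerivAt_const t z)
  have hc2 : HasFDerivAt (fun e : E => (t, e)) (ContinuousLinearMap.inr ℝ ℝ E) z :=
    hasFDerivAt_prodMk_right t z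
  have hs : ∀ᶠ s in nhds t, fderiv ℝ (fun e => f (s, e)) z =
      (fderiv ℝ f (s, z)).comp (ContinuousLinearMap.inr ℝ ℝ E) := by
    have := hc1.continuousAt.eventually hev
    filter_upwards [this] with s hs
    exact (HasFDerivAt.comp z hs.hasFDerivAt (hasFDerivAt_prodMk_right s z)).fderiv
  have he : ∀ᶠ e in nhds z, deriv (fun s => f (s, e)) t = fderiv ℝ f (t, e) ((1 : ℝ), (0 : E)) := by
    have := hc2.continuousAt.eventually hev
    filter_upwards [this] with e he
    exact (HasFDerivAt.comp_hasDerivAt t he.hasFDerivAt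
      ((hasDerivAt_id t).prodMk (hasDerivAt_const t e))).deriv
  have h1 : HasDerivAt (fun s => (fderiv ℝ f (s, z)).comp (ContinuousLinearMap.inr ℝ ℝ E))
      ((fderiv ℝ (fderiv ℝ f) (t, z) ((1 : ℝ), (0 : E))).comp (ContinuousLinearMap.inr ℝ ℝ E)) t :=
    ((ContinuousLinearMap.compL ℝ E (ℝ × E) G).flip
      (ContinuousLinearMap.inr ℝ ℝ E)).hasFDerivAt.comp_hasDerivAt t
        (hd.hasFDerivAt.comp_hasDerivAt t hc1)
  have h2 : fderiv ℝ (fun e => deriv (fun s => f (s, e)) t) z =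
      (fderiv ℝ (fderiv ℝ f) (t, z) ((1 : ℝ), (0 : E))).comp (ContinuousLinearMap.inr ℝ ℝ E) := by
    rw [Filter.EventuallyEq.fderiv_eq he]
    have h3 : HasFDerivAt (fun e => fderiv ℝ f (t, e))
        ((fderiv ℝ (fderiv ℝ f) (t, z)).comp (ContinuousLinearMap.inr ℝ ℝ E)) z :=
      HasFDerivAt.comp z hd.hasFDerivAt hc2
    have h4 := ((ContinuousLinearMap.apply ℝ G ((1 : ℝ), (0 : E))).hasFDerivAt.comp z h3).fderiv
    refine h4.trans ?_
    ext u
    exact hsymm.eq _ _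
  rw [h2]
  exact h1.congr_of_eventuallyEq hs

end Model

/-! ### Reading tensor fields in the preferred charts -/

section Charts

variable {E : Type*} [NormedAddCommGroup E] [NormedSpace ℝ E]
  {M : Type*} [TopologicalSpace M] [ChartedSpace E M]

variable (E) in
/-- The derivative of `f` at `x`, as a map between copies of `E`. -/
def dmap (f : M → M) (x : M) : E →L[ℝ] E := mfderiv 𝓘(ℝ, E) 𝓘(ℝ, E) f x

variable (E) in
/-- The derivative at `x` of the preferred chart at `c`, as a map between copies of `E`. -/
def dchart (c x : M) : E →L[ℝ] E := mfderiv 𝓘(ℝ, E) 𝓘(ℝ, E) (extChartAt 𝓘(ℝ, E) c) x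

/-- The derivative at `e` of the inverse of the preferred chart at `c`. -/
def dchartSymm (c : M) (e : E) : E →L[ℝ] E :=
  mfderiv 𝓘(ℝ, E) 𝓘(ℝ, E) (extChartAt 𝓘(ℝ, E) c).symm e

variable [IsManifold 𝓘(ℝ, E) ∞ M]

instance : IsManifold 𝓘(ℝ, E) 1 M := IsManifold.of_le (n := ∞) (by simp)

lemma dchart_dchartSymm {c : M} {e : E} (he : e ∈ (extChartAt 𝓘(ℝ, E) c).target) (v : E) :
    dchart E c ((extChartAt 𝓘(ℝ, E) c).symm e) (dchartSymm c e v) = v := by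
  have h := mfderiv_extChartAt_comp_mfderivWithin_extChartAt_symm (I := 𝓘(ℝ, E)) he
  rw [ModelWithCorners.range_eq_univ, mfderivWithin_univ] at h
  exact congrArg (fun L : E →L[ℝ] E => L v) h

lemma dchartSymm_dchart {c : M} {e : E} (he : e ∈ (extChartAt 𝓘(ℝ, E) c).target) (v : E) :
    dchartSymm c e (dchart E c ((extChartAt 𝓘(ℝ, E) c).symm e) v) = v := by
  have h := mfderivWithin_extChartAt_symm_comp_mfderiv_extChartAt (I := 𝓘(ℝ, E)) he
  rw [ModelWithCorners.range_eq_univ, mfderivWithin_univ] at h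
  exact congrArg (fun L : E →L[ℝ] E => L v) h

lemma dchartSymm_dchart' {c x : M} (hx : x ∈ (extChartAt 𝓘(ℝ, E) c).source) (v : E) :
    dchartSymm c (extChartAt 𝓘(ℝ, E) c x) (dchart E c x v) = v := by
  have h := dchartSymm_dchart ((extChartAt 𝓘(ℝ, E) c).map_source hx) v
  rwa [(extChartAt 𝓘(ℝ, E) c).left_inv hx] at h

lemma dchart_dchartSymm' {c x : M} (hx : x ∈ (extChartAt 𝓘(ℝ, E) c).source) (v : E) :
    dchart E c x (dchartSymm c (extChartAt 𝓘(ℝ, E) c x) v) = v := by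
  have h := dchart_dchartSymm ((extChartAt 𝓘(ℝ, E) c).map_source hx) v
  rwa [(extChartAt 𝓘(ℝ, E) c).left_inv hx] at h

lemma dchart_self (c : M) : dchart E c c = ContinuousLinearMap.id ℝ E := mfderiv_extChartAt_self

lemma dchartSymm_self (c : M) :
    dchartSymm c (extChartAt 𝓘(ℝ, E) c c) = ContinuousLinearMap.id ℝ E := by
  have h := mfderivWithin_range_extChartAt_symm (I := 𝓘(ℝ, E)) (x := c)
  rwa [ModelWithCorners.range_eq_univ, mfderivWithin_univ] at h

/-- The trivialization of the tangent bundle at `c` is given by the derivative of the chart at `c`. -/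
lemma symmL_eq_dchartSymm {c x : M} (hx : x ∈ (extChartAt 𝓘(ℝ, E) c).source) :
    (trivializationAt E (TangentSpace 𝓘(ℝ, E)) c).symmL ℝ x =
      dchartSymm c (extChartAt 𝓘(ℝ, E) c x) := by
  have h := TangentBundle.symmL_trivializationAt (I := 𝓘(ℝ, E)) (x₀ := c) (x := x)
    (by rwa [extChartAt_source] at hx)
  rwa [ModelWithCorners.range_eq_univ, mfderivWithin_univ] at h

lemma continuousLinearMapAt_eq_dchart {c x : M} (hx : x ∈ (extChartAt 𝓘(ℝ, E) c).source) :
    (trivializationAt E (TangentSpace 𝓘(ℝ, E)) c).continuousLinearMapAt ℝ x =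
      (dchart E c x : TangentSpace 𝓘(ℝ, E) x →L[ℝ] E) :=
  TangentBundle.continuousLinearMapAt_trivializationAt (I := 𝓘(ℝ, E)) (x₀ := c) (x := x)
    (by rwa [extChartAt_source] at hx)

/-- The value of a form at `x`, as a form on the model space: the tangent spaces are by definition
copies of `E`, and this map makes the identification explicit. -/
def DForm.val {n : ℕ} (w : DForm E M n) (x : M) : E [⋀^Fin n]→L[ℝ] ℝ := w x

lemma DForm.inChart_self {n : ℕ} (w : DForm E M n) (c : M) :
    w.inChart c (extChartAt 𝓘(ℝ, E) c c) = w c := by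
  have h : ∀ q : M, q = c → (w q : E [⋀^Fin n]→L[ℝ] ℝ) = w c := by rintro q rfl; rfl
  have h1 := h _ (extChartAt_to_inv (I := 𝓘(ℝ, E)) c)
  ext v
  change (w ((extChartAt 𝓘(ℝ, E) c).symm (extChartAt 𝓘(ℝ, E) c c)) : E [⋀^Fin n]→L[ℝ] ℝ)
    (fun i => dchartSymm c (extChartAt 𝓘(ℝ, E) c c) (v i)) = _
  rw [h1, dchartSymm_self]
  rfl

lemma DForm.d_eq {n : ℕ} (w : DForm E M n) (c : M) :
    w.d c = extDeriv (w.inChart c) (extChartAt 𝓘(ℝ, E) c c) := by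
  ext v
  change extDeriv (w.inChart c) (extChartAt 𝓘(ℝ, E) c c) (fun i => dchart E c c (v i)) = _
  rw [dchart_self]
  rfl

/-- Smoothness of a family of forms may be read in the trivialization at any centre `c`, not only
at the point under consideration. -/
lemma DForm.smoothFamily_iff {n : ℕ} (w : ℝ → DForm E M n) :
    DForm.SmoothFamily w ↔ ∀ (t : ℝ) (c x : M), x ∈ (extChartAt 𝓘(ℝ, E) c).source →
      ContMDiffAt (𝓘(ℝ, ℝ).prod 𝓘(ℝ, E)) 𝓘(ℝ, E [⋀^Fin n]→L[ℝ] ℝ) ∞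
        (fun p : ℝ × M => (w p.1).coord c p.2) (t, x) := by
  have h : ∀ c : M, (fun p : ℝ × M => (trivializationAt (E [⋀^Fin n]→L[ℝ] ℝ)
      (fun x : M => TangentSpace 𝓘(ℝ, E) x [⋀^Fin n]→L[ℝ] ℝ) c
        (TotalSpace.mk' (E [⋀^Fin n]→L[ℝ] ℝ) p.2 (w p.1 p.2))).2) =
      fun p : ℝ × M => (w p.1).coord c p.2 := by
    intro c
    funext p
    ext v
    simp [FiberBundle.trivializationAt_continuousAlternatingMap_apply,
      ContinuousAlternatingMap.inCoordinates, DForm.coord]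
  constructor
  · intro H t c x hx
    have hx' : x ∈ (chartAt E c).source := by rwa [extChartAt_source] at hx
    have h1 := (contMDiffAt_totalSpace.1 (H (t, x))).2
    have h0 := h x
    dsimp only at h1
    rw [h0] at h1
    have h2 := contMDiffAt_coordChangeL (IB := 𝓘(ℝ, E)) (n := ∞)
      (e := trivializationAt E (TangentSpace (M := M) 𝓘(ℝ, E)) c)
      (e' := trivializationAt E (TangentSpace (M := M) 𝓘(ℝ, E)) x) (x := x) (by simpa using hx') (by simp)
    have h3 := ContMDiffAt.comp (t, x) h2 (contMDiffAt_snd (I := 𝓘(ℝ, ℝ)))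
    have h4 := (contDiff_altComp (E := E) n).contMDiff.contMDiffAt.comp (t, x) (h1.prodMk_space h3)
    refine h4.congr_of_eventuallyEq ?_
    have hb : (chartAt E c).source ∩ (chartAt E x).source ∈ nhds x :=
      Filter.inter_mem ((chartAt E c).open_source.mem_nhds hx') (chart_source_mem_nhds E x)
    filter_upwards [(continuousAt_snd (p := (t, x))).preimage_mem_nhds hb] with p hp
    have hp' : p.2 ∈ (chartAt E c).source ∧ p.2 ∈ (chartAt E x).source := hp
    ext v
    change (w p.1 p.2) _ = (w p.1 p.2) _
    congr 1
    funext i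
    have hc : p.2 ∈ (trivializationAt E (TangentSpace (M := M) 𝓘(ℝ, E)) c).baseSet ∩
        (trivializationAt E (TangentSpace (M := M) 𝓘(ℝ, E)) x).baseSet := by simpa using hp'
    have e1 := (trivializationAt E (TangentSpace (M := M) 𝓘(ℝ, E)) x).symmL_continuousLinearMapAt
      (R := ℝ) hc.2 ((trivializationAt E (TangentSpace (M := M) 𝓘(ℝ, E)) c).symmL ℝ p.2 (v i))
    have e2 : (trivializationAt E (TangentSpace (M := M) 𝓘(ℝ, E)) x).continuousLinearMapAt ℝ p.2
        ((trivializationAt E (TangentSpace (M := M) 𝓘(ℝ, E)) c).symmL ℝ p.2 (v i)) =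
        Trivialization.coordChangeL ℝ (trivializationAt E (TangentSpace (M := M) 𝓘(ℝ, E)) c)
          (trivializationAt E (TangentSpace (M := M) 𝓘(ℝ, E)) x) p.2 (v i) := by
      rw [Trivialization.continuousLinearMapAt_apply, Trivialization.linearMapAt_apply,
        if_pos hc.2]
      rw [Trivialization.symmL_apply _ hc.1]
      exact (Trivialization.coordChangeL_apply (R := ℝ) _ _ hc (v i)).symm
    rw [e2] at e1
    exact e1.symm
  · rintro H ⟨t, x⟩
    rw [contMDiffAt_totalSpace]
    exact ⟨contMDiffAt_snd, h x ▸ H t x x (mem_extChartAt_source x)⟩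

lemma DForm.Smooth.smoothFamily {n : ℕ} {w : DForm E M n} (hw : w.Smooth) :
    DForm.SmoothFamily (fun _ => w) :=
  ContMDiff.comp (g := fun x : M => TotalSpace.mk' (E [⋀^Fin n]→L[ℝ] ℝ)
      (E := fun x : M => TangentSpace 𝓘(ℝ, E) x [⋀^Fin n]→L[ℝ] ℝ) x (w x)) hw contMDiff_snd

lemma DForm.SmoothFamily.comp_left {n : ℕ} {w : ℝ → DForm E M n} (hw : DForm.SmoothFamily w)
    {θ : ℝ → ℝ} (hθ : ContMDiff 𝓘(ℝ, ℝ) 𝓘(ℝ, ℝ) ∞ θ) : DForm.SmoothFamily (fun t => w (θ t)) :=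
  ContMDiff.comp (g := fun p : ℝ × M => TotalSpace.mk' (E [⋀^Fin n]→L[ℝ] ℝ)
      (E := fun x : M => TangentSpace 𝓘(ℝ, E) x [⋀^Fin n]→L[ℝ] ℝ) p.2 (w p.1 p.2)) hw
      ((hθ.comp contMDiff_fst).prodMk contMDiff_snd)

lemma DForm.inChart_eq_coord {n : ℕ} (w : DForm E M n) {c : M} {e : E}
    (he : e ∈ (extChartAt 𝓘(ℝ, E) c).target) :
    w.inChart c e = w.coord c ((extChartAt 𝓘(ℝ, E) c).symm e) := by
  have h := symmL_eq_dchartSymm ((extChartAt 𝓘(ℝ, E) c).map_target he)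
  rw [(extChartAt 𝓘(ℝ, E) c).right_inv he] at h
  unfold DForm.coord
  rw [h]
  rfl

lemma extChartAt_target_mem_nhds_of_mem {c : M} {e : E}
    (he : e ∈ (extChartAt 𝓘(ℝ, E) c).target) : (extChartAt 𝓘(ℝ, E) c).target ∈ nhds e :=
  (isOpen_extChartAt_target c).mem_nhds he

lemma contMDiffAt_extChartAt_symm {c : M} {e : E} (he : e ∈ (extChartAt 𝓘(ℝ, E) c).target) :
    ContMDiffAt 𝓘(ℝ, E) 𝓘(ℝ, E) ∞ (extChartAt 𝓘(ℝ, E) c).symm e :=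
  (contMDiffOn_extChartAt_symm c).contMDiffAt (extChartAt_target_mem_nhds_of_mem he)

lemma contMDiffAt_prod_iff_contDiffAt {G : Type*} [NormedAddCommGroup G] [NormedSpace ℝ G]
    {f : ℝ × E → G} {p : ℝ × E} :
    ContMDiffAt (𝓘(ℝ, ℝ).prod 𝓘(ℝ, E)) 𝓘(ℝ, G) ∞ f p ↔ ContDiffAt ℝ ∞ f p := by
  rw [← contMDiffAt_iff_contDiffAt, modelWithCornersSelf_prod, ← chartedSpaceSelf_prod]

lemma DForm.SmoothFamily.contDiffAt_inChart {n : ℕ} {w : ℝ → DForm E M n}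
    (hw : DForm.SmoothFamily w) (t : ℝ) {c : M} {e : E}
    (he : e ∈ (extChartAt 𝓘(ℝ, E) c).target) :
    ContDiffAt ℝ ∞ (fun p : ℝ × E => (w p.1).inChart c p.2) (t, e) := by
  have h1 := (DForm.smoothFamily_iff w).1 hw t c _ ((extChartAt 𝓘(ℝ, E) c).map_target he)
  have h2 : ContMDiffAt (𝓘(ℝ, ℝ).prod 𝓘(ℝ, E)) (𝓘(ℝ, ℝ).prod 𝓘(ℝ, E)) ∞
      (fun p : ℝ × E => (p.1, (extChartAt 𝓘(ℝ, E) c).symm p.2)) (t, e) :=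
    contMDiffAt_fst.prodMk
      (ContMDiffAt.comp (t, e) (contMDiffAt_extChartAt_symm he) contMDiffAt_snd)
  have h3 := ContMDiffAt.comp (t, e) h1 h2
  rw [contMDiffAt_prod_iff_contDiffAt] at h3
  refine h3.congr_of_eventuallyEq ?_
  filter_upwards [continuousAt_snd.preimage_mem_nhds (extChartAt_target_mem_nhds_of_mem he)] with p hp
  exact DForm.inChart_eq_coord _ hp

lemma DForm.Smooth.contDiffAt_inChart {n : ℕ} {w : DForm E M n} (hw : w.Smooth) {c : M} {e : E}
    (he : e ∈ (extChartAt 𝓘(ℝ, E) c).target) : ContDiffAt ℝ ∞ (w.inChart c) e :=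
  (hw.smoothFamily.contDiffAt_inChart 0 he).comp e (contDiffAt_const.prodMk contDiffAt_id)

/-- The map `f` read in the preferred charts at `c` and `c'`. -/
def mapInChart (f : M → M) (c c' : M) (e : E) : E :=
  extChartAt 𝓘(ℝ, E) c' (f ((extChartAt 𝓘(ℝ, E) c).symm e))

lemma contDiffAt_mapInChart_family {f : ℝ → M → M}
    (hf : ContMDiff (𝓘(ℝ, ℝ).prod 𝓘(ℝ, E)) 𝓘(ℝ, E) ∞ (fun p : ℝ × M => f p.1 p.2)) (t : ℝ)
    {c c' : M} {e : E} (he : e ∈ (extChartAt 𝓘(ℝ, E) c).target)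
    (he' : f t ((extChartAt 𝓘(ℝ, E) c).symm e) ∈ (extChartAt 𝓘(ℝ, E) c').source) :
    ContDiffAt ℝ ∞ (fun p : ℝ × E => mapInChart (f p.1) c c' p.2) (t, e) := by
  have h2 : ContMDiffAt (𝓘(ℝ, ℝ).prod 𝓘(ℝ, E)) (𝓘(ℝ, ℝ).prod 𝓘(ℝ, E)) ∞
      (fun p : ℝ × E => (p.1, (extChartAt 𝓘(ℝ, E) c).symm p.2)) (t, e) :=
    contMDiffAt_fst.prodMk
      (ContMDiffAt.comp (t, e) (contMDiffAt_extChartAt_symm he) contMDiffAt_snd)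
  have h1 := contMDiffAt_extChartAt' (I := 𝓘(ℝ, E)) (n := ∞)
    (by rwa [extChartAt_source] at he')
  have h3 := ContMDiffAt.comp (t, e) h1 (ContMDiffAt.comp (t, e) (hf _) h2)
  rw [contMDiffAt_prod_iff_contDiffAt] at h3
  exact h3

lemma contDiffAt_mapInChart {f : M → M} (hf : ContMDiff 𝓘(ℝ, E) 𝓘(ℝ, E) ∞ f)
    {c c' : M} {e : E} (he : e ∈ (extChartAt 𝓘(ℝ, E) c).target)
    (he' : f ((extChartAt 𝓘(ℝ, E) c).symm e) ∈ (extChartAt 𝓘(ℝ, E) c').source) :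
    ContDiffAt ℝ ∞ (mapInChart f c c') e :=
  (contDiffAt_mapInChart_family (f := fun _ => f) (hf.comp contMDiff_snd) 0 he he').comp e
    (contDiffAt_const.prodMk contDiffAt_id)

/-- Chain rule for a map read in charts. -/
lemma fderiv_mapInChart {f : M → M} (hf : ContMDiff 𝓘(ℝ, E) 𝓘(ℝ, E) ∞ f)
    {c c' : M} {e : E} (he : e ∈ (extChartAt 𝓘(ℝ, E) c).target)
    (he' : f ((extChartAt 𝓘(ℝ, E) c).symm e) ∈ (extChartAt 𝓘(ℝ, E) c').source) :
    fderiv ℝ (mapInChart f c c') e =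
      (dchart E c' (f ((extChartAt 𝓘(ℝ, E) c).symm e))).comp
        ((dmap E f ((extChartAt 𝓘(ℝ, E) c).symm e)).comp
          (dchartSymm c e)) := by
  have h1 := (contMDiffAt_extChartAt' (I := 𝓘(ℝ, E)) (n := ∞)
    (by rwa [extChartAt_source] at he')).mdifferentiableAt (by simp) |>.hasMFDerivAt
  have h2 := (hf ((extChartAt 𝓘(ℝ, E) c).symm e)).mdifferentiableAt (by simp) |>.hasMFDerivAt
  have h3 := (contMDiffAt_extChartAt_symm he).mdifferentiableAt (by simp) |>.hasMFDerivAt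
  have h : HasMFDerivAt 𝓘(ℝ, E) 𝓘(ℝ, E) (mapInChart f c c') e
      ((dchart E c' (f ((extChartAt 𝓘(ℝ, E) c).symm e))).comp
        ((dmap E f ((extChartAt 𝓘(ℝ, E) c).symm e)).comp (dchartSymm c e)) : E →L[ℝ] E) :=
    HasMFDerivAt.comp e h1 (HasMFDerivAt.comp e h2 h3)
  have h' : HasFDerivAt (mapInChart f c c')
      ((dchart E c' (f ((extChartAt 𝓘(ℝ, E) c).symm e))).comp
        ((dmap E f ((extChartAt 𝓘(ℝ, E) c).symm e)).comp (dchartSymm c e)) : E →L[ℝ] E) e := by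
    exact hasMFDerivAt_iff_hasFDerivAt.1 h
  exact h'.fderiv

lemma DForm.inChart_extChartAt {n : ℕ} (w : DForm E M n) {c x : M}
    (hx : x ∈ (extChartAt 𝓘(ℝ, E) c).source) :
    w.inChart c (extChartAt 𝓘(ℝ, E) c x) =
      (w.val x).compContinuousLinearMap (dchartSymm c (extChartAt 𝓘(ℝ, E) c x)) := by
  have h1 : w.val ((extChartAt 𝓘(ℝ, E) c).symm (extChartAt 𝓘(ℝ, E) c x)) = w.val x := by
    rw [(extChartAt 𝓘(ℝ, E) c).left_inv hx]
  rw [← h1]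
  rfl

/-- Pulling back and reading in charts commute. -/
lemma DForm.inChart_pullback {n : ℕ} (w : DForm E M n) {f : M → M}
    (hf : ContMDiff 𝓘(ℝ, E) 𝓘(ℝ, E) ∞ f) {c c' : M} {e : E}
    (he : e ∈ (extChartAt 𝓘(ℝ, E) c).target)
    (he' : f ((extChartAt 𝓘(ℝ, E) c).symm e) ∈ (extChartAt 𝓘(ℝ, E) c').source) :
    (w.pullback f).inChart c e = (w.inChart c' (mapInChart f c c' e)).compContinuousLinearMap
      (fderiv ℝ (mapInChart f c c') e) := by
  rw [fderiv_mapInChart hf he he']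
  unfold mapInChart
  rw [DForm.inChart_extChartAt w he']
  ext v
  change w.val (f ((extChartAt 𝓘(ℝ, E) c).symm e)) _ =
    w.val (f ((extChartAt 𝓘(ℝ, E) c).symm e)) _
  congr 1
  funext i
  exact (dchartSymm_dchart' he' _).symm

/-- The points of a chart domain which `f` maps to another chart domain form a neighbourhood. -/
lemma eventually_mem_charts {f : M → M} (hf : ContMDiff 𝓘(ℝ, E) 𝓘(ℝ, E) ∞ f) {c c' : M} {e : E}
    (he : e ∈ (extChartAt 𝓘(ℝ, E) c).target)
    (he' : f ((extChartAt 𝓘(ℝ, E) c).symm e) ∈ (extChartAt 𝓘(ℝ, E) c').source) :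
    ∀ᶠ e in nhds e, e ∈ (extChartAt 𝓘(ℝ, E) c).target ∧
      f ((extChartAt 𝓘(ℝ, E) c).symm e) ∈ (extChartAt 𝓘(ℝ, E) c').source :=
  Filter.Eventually.and (extChartAt_target_mem_nhds_of_mem he)
    ((hf.continuous.continuousAt.comp (contMDiffAt_extChartAt_symm he).continuousAt)
      ((isOpen_extChartAt_source c').mem_nhds he'))

lemma extDeriv_inChart_pullback {n : ℕ} {w : DForm E M n} (hw : w.Smooth) {f : M → M}
    (hf : ContMDiff 𝓘(ℝ, E) 𝓘(ℝ, E) ∞ f) {c c' : M} {e : E}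
    (he : e ∈ (extChartAt 𝓘(ℝ, E) c).target)
    (he' : f ((extChartAt 𝓘(ℝ, E) c).symm e) ∈ (extChartAt 𝓘(ℝ, E) c').source) :
    extDeriv ((w.pullback f).inChart c) e =
      (extDeriv (w.inChart c') (mapInChart f c c' e)).compContinuousLinearMap
        (fderiv ℝ (mapInChart f c c') e) := by
  have h : (w.pullback f).inChart c =ᶠ[nhds e] fun e =>
      (w.inChart c' (mapInChart f c c' e)).compContinuousLinearMap
        (fderiv ℝ (mapInChart f c c') e) := by
    filter_upwards [eventually_mem_charts hf he he'] with e he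
    exact w.inChart_pullback hf he.1 he.2
  rw [h.extDeriv_eq]
  exact extDeriv_pullback ((hw.contDiffAt_inChart
    ((extChartAt 𝓘(ℝ, E) c').map_source he')).differentiableAt (by simp))
    ((contDiffAt_mapInChart hf he he').of_le two_le_infty) (by simp)

lemma dmap_id (x : M) : dmap E id x = ContinuousLinearMap.id ℝ E :=
  mfderiv_id (I := 𝓘(ℝ, E)) (x := x)

/-- The exterior derivative may be computed in any chart. -/
lemma DForm.inChart_d {n : ℕ} {w : DForm E M n} (hw : w.Smooth) {c : M} {e : E}
    (he : e ∈ (extChartAt 𝓘(ℝ, E) c).target) :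
    w.d.inChart c e = extDeriv (w.inChart c) e := by
  have hs : id ((extChartAt 𝓘(ℝ, E) c).symm e) ∈
      (extChartAt 𝓘(ℝ, E) ((extChartAt 𝓘(ℝ, E) c).symm e)).source := mem_extChartAt_source _
  have h := extDeriv_inChart_pullback hw contMDiff_id he hs
  rw [DForm.pullback_id, fderiv_mapInChart contMDiff_id he hs] at h
  rw [h]
  ext v
  change (w.d ((extChartAt 𝓘(ℝ, E) c).symm e) : E [⋀^Fin (n + 1)]→L[ℝ] ℝ)
    (fun i => dchartSymm c e (v i)) = _
  rw [DForm.d_eq]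
  simp only [id_eq, dchart_self, dmap_id]
  rfl

/-- The derivative of a map, read in the charts at a point and at its image. -/
lemma fderiv_mapInChart_self {f : M → M} (hf : ContMDiff 𝓘(ℝ, E) 𝓘(ℝ, E) ∞ f) (x : M) :
    fderiv ℝ (mapInChart f x (f x)) (extChartAt 𝓘(ℝ, E) x x) = dmap E f x := by
  have h := fderiv_mapInChart hf (c' := f x) (mem_extChartAt_target (I := 𝓘(ℝ, E)) x)
    (by rw [extChartAt_to_inv]; exact mem_extChartAt_source _)
  rw [h, dchartSymm_self, extChartAt_to_inv, dchart_self]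
  rfl

/-- The exterior derivative commutes with pullbacks. -/
lemma DForm.d_pullback {n : ℕ} {w : DForm E M n} (hw : w.Smooth) {f : M → M}
    (hf : ContMDiff 𝓘(ℝ, E) 𝓘(ℝ, E) ∞ f) : (w.pullback f).d = w.d.pullback f := by
  funext x
  have h := extDeriv_inChart_pullback hw hf (c' := f x) (mem_extChartAt_target (I := 𝓘(ℝ, E)) x)
    (by rw [extChartAt_to_inv]; exact mem_extChartAt_source _)
  rw [fderiv_mapInChart_self hf, mapInChart, extChartAt_to_inv] at h
  refine (DForm.d_eq _ x).trans (h.trans ?_)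
  rw [← DForm.d_eq]
  rfl

/-- It suffices to check smoothness at the centres of the preferred charts. -/
lemma DForm.smoothFamily_of_inChart {n : ℕ} {w : ℝ → DForm E M n}
    (h : ∀ (t : ℝ) (c : M), ContDiffAt ℝ ∞ (fun p : ℝ × E => (w p.1).inChart c p.2)
      (t, extChartAt 𝓘(ℝ, E) c c)) : DForm.SmoothFamily w := by
  rintro ⟨t, x⟩
  rw [contMDiffAt_totalSpace]
  refine ⟨contMDiffAt_snd, ?_⟩
  have h1 := contMDiffAt_prod_iff_contDiffAt.2 (h t x)
  have h2 : ContMDiffAt (𝓘(ℝ, ℝ).prod 𝓘(ℝ, E)) (𝓘(ℝ, ℝ).prod 𝓘(ℝ, E)) ∞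
      (fun p : ℝ × M => (p.1, extChartAt 𝓘(ℝ, E) x p.2)) (t, x) :=
    contMDiffAt_fst.prodMk
      (ContMDiffAt.comp (t, x) contMDiffAt_extChartAt contMDiffAt_snd)
  refine (ContMDiffAt.comp (t, x) h1 h2).congr_of_eventuallyEq ?_
  filter_upwards [(continuousAt_snd (p := (t, x))).preimage_mem_nhds
    (extChartAt_source_mem_nhds (I := 𝓘(ℝ, E)) x)] with p hp
  have hp' : p.2 ∈ (extChartAt 𝓘(ℝ, E) x).source := hp
  have h3 := (w p.1).inChart_eq_coord ((extChartAt 𝓘(ℝ, E) x).map_source hp')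
  rw [(extChartAt 𝓘(ℝ, E) x).left_inv hp'] at h3
  refine Eq.trans ?_ h3.symm
  ext v
  simp [FiberBundle.trivializationAt_continuousAlternatingMap_apply,
    ContinuousAlternatingMap.inCoordinates, DForm.coord]

lemma DForm.smooth_of_inChart {n : ℕ} {w : DForm E M n}
    (h : ∀ c : M, ContDiffAt ℝ ∞ (w.inChart c) (extChartAt 𝓘(ℝ, E) c c)) : w.Smooth := by
  have h1 : DForm.SmoothFamily (fun _ => w) :=
    DForm.smoothFamily_of_inChart fun t c => (h c).comp (t, extChartAt 𝓘(ℝ, E) c c) contDiffAt_snd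
  exact ContMDiff.comp (g := fun p : ℝ × M => TotalSpace.mk' (E [⋀^Fin n]→L[ℝ] ℝ)
      (E := fun x : M => TangentSpace 𝓘(ℝ, E) x [⋀^Fin n]→L[ℝ] ℝ) p.2 (w p.2)) h1
    ((contMDiff_const (c := (0 : ℝ))).prodMk contMDiff_id)

lemma DForm.SmoothFamily.pullback {n : ℕ} {w : ℝ → DForm E M n} (hw : DForm.SmoothFamily w)
    {f : ℝ → M → M}
    (hf : ContMDiff (𝓘(ℝ, ℝ).prod 𝓘(ℝ, E)) 𝓘(ℝ, E) ∞ (fun p : ℝ × M => f p.1 p.2)) :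
    DForm.SmoothFamily (fun t => (w t).pullback (f t)) := by
  refine DForm.smoothFamily_of_inChart fun t c => ?_
  have hft : ∀ t, ContMDiff 𝓘(ℝ, E) 𝓘(ℝ, E) ∞ (f t) := fun t =>
    hf.comp (contMDiff_const.prodMk contMDiff_id)
  set z := extChartAt 𝓘(ℝ, E) c c with hz
  have hzt : z ∈ (extChartAt 𝓘(ℝ, E) c).target := mem_extChartAt_target c
  set c' := f t c with hc'
  have hc : f t ((extChartAt 𝓘(ℝ, E) c).symm z) = c' := by rw [hz, extChartAt_to_inv]
  have hs : f t ((extChartAt 𝓘(ℝ, E) c).symm z) ∈ (extChartAt 𝓘(ℝ, E) c').source := by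
    rw [hc]; exact mem_extChartAt_source _
  have h1 := contDiffAt_mapInChart_family hf t hzt hs
  have h2 : ContDiffAt ℝ ∞ (fun p : ℝ × E => (w p.1).inChart c' (mapInChart (f p.1) c c' p.2))
      (t, z) := by
    refine ContDiffAt.comp (g := fun p : ℝ × E => (w p.1).inChart c' p.2) (t, z) ?_
      (contDiffAt_fst.prodMk h1)
    exact hw.contDiffAt_inChart t ((extChartAt 𝓘(ℝ, E) c').map_source hs)
  have h3 : ContDiffAt ℝ ∞ (fun p : ℝ × E => fderiv ℝ (mapInChart (f p.1) c c') p.2) (t, z) := by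
    refine ContDiffAt.fderiv (n := ∞) (f := fun (p : ℝ × E) e => mapInChart (f p.1) c c' e)
      (g := fun p => p.2) ?_ contDiffAt_snd (by simp)
    exact ContDiffAt.comp (g := fun p : ℝ × E => mapInChart (f p.1) c c' p.2) ((t, z), z) h1
      ((contDiffAt_fst.comp _ contDiffAt_fst).prodMk contDiffAt_snd)
  have h4 := (contDiff_altComp (E := E) n).contDiffAt.comp (t, z) (h2.prodMk h3)
  refine h4.congr_of_eventuallyEq ?_
  have hcont : ContinuousAt (fun p : ℝ × E => f p.1 ((extChartAt 𝓘(ℝ, E) c).symm p.2)) (t, z) := by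
    refine ContinuousAt.comp (g := fun p : ℝ × M => f p.1 p.2)
      (f := fun p : ℝ × E => (p.1, (extChartAt 𝓘(ℝ, E) c).symm p.2))
      hf.continuous.continuousAt ?_
    exact continuousAt_fst.prodMk
      (ContinuousAt.comp (g := (extChartAt 𝓘(ℝ, E) c).symm) (f := Prod.snd) (x := (t, z))
        (contMDiffAt_extChartAt_symm hzt).continuousAt continuousAt_snd)
  filter_upwards [hcont.preimage_mem_nhds ((isOpen_extChartAt_source (I := 𝓘(ℝ, E)) c').mem_nhds hs),
    (continuousAt_snd (p := (t, z))).preimage_mem_nhds (extChartAt_target_mem_nhds_of_mem hzt)]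
    with p hp1 hp2
  exact DForm.inChart_pullback _ (hft p.1) hp2 hp1

end Charts

/-! ### Vector and covector fields in charts -/

section Fields

variable {E : Type*} [NormedAddCommGroup E] [NormedSpace ℝ E]
  {M : Type*} [TopologicalSpace M] [ChartedSpace E M]

/-- A vector field read in the preferred chart at `c`. -/
def VField.inChart (X : VField E M) (c : M) (e : E) : E :=
  dchart E c ((extChartAt 𝓘(ℝ, E) c).symm e) (X ((extChartAt 𝓘(ℝ, E) c).symm e))

/-- A covector field read in the preferred chart at `c`. -/
def CoField.inChart (ξ : CoField E M) (c : M) (e : E) : E →L[ℝ] ℝ :=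
  ContinuousLinearMap.comp (σ₁₂ := RingHom.id ℝ)
    (ξ ((extChartAt 𝓘(ℝ, E) c).symm e) : E →L[ℝ] ℝ) (dchartSymm c e)

variable [IsManifold 𝓘(ℝ, E) ∞ M]

/-- Smoothness of a vector field, as a section of the tangent bundle. -/
def VField.Smooth (X : VField E M) : Prop :=
  ContMDiff 𝓘(ℝ, E) (𝓘(ℝ, E).prod 𝓘(ℝ, E)) ∞
    (fun x : M => TotalSpace.mk' E (E := fun x : M => TangentSpace 𝓘(ℝ, E) x) x (X x))

lemma contMDiffAt_comp_extChartAt_symm {G : Type*} [NormedAddCommGroup G] [NormedSpace ℝ G]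
    {f : M → G} {c : M} {e : E} (he : e ∈ (extChartAt 𝓘(ℝ, E) c).target)
    (hf : ContMDiffAt 𝓘(ℝ, E) 𝓘(ℝ, G) ∞ f ((extChartAt 𝓘(ℝ, E) c).symm e)) :
    ContDiffAt ℝ ∞ (fun e => f ((extChartAt 𝓘(ℝ, E) c).symm e)) e :=
  contMDiffAt_iff_contDiffAt.1 (ContMDiffAt.comp e hf (contMDiffAt_extChartAt_symm he))

lemma VField.inChart_eq (X : VField E M) {c : M} {e : E}
    (he : e ∈ (extChartAt 𝓘(ℝ, E) c).target) : X.inChart c e =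
      (trivializationAt E (TangentSpace (M := M) 𝓘(ℝ, E)) c (TotalSpace.mk' E
        ((extChartAt 𝓘(ℝ, E) c).symm e) (X ((extChartAt 𝓘(ℝ, E) c).symm e)))).2 := by
  have hs := (extChartAt 𝓘(ℝ, E) c).map_target he
  have h := continuousLinearMapAt_eq_dchart hs
  have hb : (extChartAt 𝓘(ℝ, E) c).symm e ∈
      (trivializationAt E (TangentSpace (M := M) 𝓘(ℝ, E)) c).baseSet := by
    rw [extChartAt_source] at hs
    simpa using hs
  have h1 := congrArg (fun L : TangentSpace 𝓘(ℝ, E) ((extChartAt 𝓘(ℝ, E) c).symm e) →L[ℝ] E =>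
    L (X ((extChartAt 𝓘(ℝ, E) c).symm e))) h
  rw [Trivialization.continuousLinearMapAt_apply, Trivialization.linearMapAt_apply,
    if_pos hb] at h1
  exact h1.symm

lemma VField.Smooth.contDiffAt_inChart {X : VField E M} (hX : X.Smooth) {c : M} {e : E}
    (he : e ∈ (extChartAt 𝓘(ℝ, E) c).target) : ContDiffAt ℝ ∞ (X.inChart c) e := by
  have hs := (extChartAt 𝓘(ℝ, E) c).map_target he
  have hb : (extChartAt 𝓘(ℝ, E) c).symm e ∈
      (trivializationAt E (TangentSpace (M := M) 𝓘(ℝ, E)) c).baseSet := by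
    rw [extChartAt_source] at hs
    simpa using hs
  have h1 := ((trivializationAt E (TangentSpace (M := M) 𝓘(ℝ, E)) c).contMDiffAt_section_iff
    (IB := 𝓘(ℝ, E)) (n := ∞) hb).1 (hX _)
  refine (contMDiffAt_comp_extChartAt_symm he h1).congr_of_eventuallyEq ?_
  filter_upwards [extChartAt_target_mem_nhds_of_mem he] with e he
  exact X.inChart_eq he

lemma VField.smooth_of_inChart {X : VField E M}
    (h : ∀ c : M, ContDiffAt ℝ ∞ (X.inChart c) (extChartAt 𝓘(ℝ, E) c c)) : X.Smooth := by
  intro c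
  rw [contMDiffAt_section]
  have h1 := ContMDiffAt.comp c (contMDiffAt_iff_contDiffAt.2 (h c)) contMDiffAt_extChartAt
  refine h1.congr_of_eventuallyEq ?_
  filter_upwards [extChartAt_source_mem_nhds (I := 𝓘(ℝ, E)) c] with x hx
  have h2 := X.inChart_eq ((extChartAt 𝓘(ℝ, E) c).map_source hx)
  rw [(extChartAt 𝓘(ℝ, E) c).left_inv hx] at h2
  exact h2.symm

lemma CoField.inChart_eq (ξ : CoField E M) {c : M} {e : E}
    (he : e ∈ (extChartAt 𝓘(ℝ, E) c).target) : ξ.inChart c e =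
      (trivializationAt (E →L[ℝ] ℝ) (fun x : M => TangentSpace 𝓘(ℝ, E) x →L[ℝ] ℝ) c
        (TotalSpace.mk' (E →L[ℝ] ℝ) ((extChartAt 𝓘(ℝ, E) c).symm e)
          (ξ ((extChartAt 𝓘(ℝ, E) c).symm e)))).2 := by
  have h := symmL_eq_dchartSymm ((extChartAt 𝓘(ℝ, E) c).map_target he)
  rw [(extChartAt 𝓘(ℝ, E) c).right_inv he] at h
  ext v
  simp only [hom_trivializationAt_apply, ContinuousLinearMap.inCoordinates]
  rw [h]
  simp
  rfl

lemma CoField.Smooth.contDiffAt_inChart {ξ : CoField E M} (hξ : ξ.Smooth) {c : M} {e : E}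
    (he : e ∈ (extChartAt 𝓘(ℝ, E) c).target) : ContDiffAt ℝ ∞ (ξ.inChart c) e := by
  have hs := (extChartAt 𝓘(ℝ, E) c).map_target he
  have hb : (extChartAt 𝓘(ℝ, E) c).symm e ∈ (trivializationAt (E →L[ℝ] ℝ)
      (fun x : M => TangentSpace 𝓘(ℝ, E) x →L[ℝ] ℝ) c).baseSet := by
    rw [extChartAt_source] at hs
    simpa using hs
  have h1 := ((trivializationAt (E →L[ℝ] ℝ)
    (fun x : M => TangentSpace 𝓘(ℝ, E) x →L[ℝ] ℝ) c).contMDiffAt_section_iff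
    (IB := 𝓘(ℝ, E)) (n := ∞) hb).1 (hξ _)
  refine (contMDiffAt_comp_extChartAt_symm he h1).congr_of_eventuallyEq ?_
  filter_upwards [extChartAt_target_mem_nhds_of_mem he] with e he
  exact ξ.inChart_eq he

lemma CoField.smooth_of_inChart {ξ : CoField E M}
    (h : ∀ c : M, ContDiffAt ℝ ∞ (ξ.inChart c) (extChartAt 𝓘(ℝ, E) c c)) : ξ.Smooth := by
  intro c
  rw [contMDiffAt_section]
  have h1 := ContMDiffAt.comp c (contMDiffAt_iff_contDiffAt.2 (h c)) contMDiffAt_extChartAt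
  refine h1.congr_of_eventuallyEq ?_
  filter_upwards [extChartAt_source_mem_nhds (I := 𝓘(ℝ, E)) c] with x hx
  have h2 := ξ.inChart_eq ((extChartAt 𝓘(ℝ, E) c).map_source hx)
  rw [(extChartAt 𝓘(ℝ, E) c).left_inv hx] at h2
  exact h2.symm

/-- The value of a vector field at `x`, as a vector of the model space. -/
def VField.val (X : VField E M) (x : M) : E := X x

lemma VField.inChart_self (X : VField E M) (c : M) :
    X.inChart c (extChartAt 𝓘(ℝ, E) c c) = X.val c := by
  unfold VField.inChart
  rw [extChartAt_to_inv, dchart_self]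
  rfl

/-- The value of a covector field at `x`, as a covector of the model space. -/
def CoField.val (ξ : CoField E M) (x : M) : E →L[ℝ] ℝ := ξ x

lemma CoField.inChart_self (ξ : CoField E M) (c : M) :
    ξ.inChart c (extChartAt 𝓘(ℝ, E) c c) = ξ.val c := by
  have h : ξ.val ((extChartAt 𝓘(ℝ, E) c).symm (extChartAt 𝓘(ℝ, E) c c)) = ξ.val c := by
    rw [extChartAt_to_inv]
  unfold CoField.inChart
  rw [dchartSymm_self]
  exact h

lemma CoField.Smooth.toDForm {ξ : CoField E M} (hξ : ξ.Smooth) : ξ.toDForm.Smooth := by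
  refine DForm.smooth_of_inChart fun c => ?_
  exact (ContinuousAlternatingMap.ofSubsingletonLIE (𝕜 := ℝ) (E := E) (F := ℝ)
    (0 : Fin 1)).contDiff.contDiffAt.comp _ (hξ.contDiffAt_inChart (mem_extChartAt_target c))

lemma CoField.d_apply {ξ : CoField E M} (hξ : ξ.Smooth) (x : M) (u v : E) :
    ξ.toDForm.d.val x ![u, v] = fderiv ℝ (ξ.inChart x) (extChartAt 𝓘(ℝ, E) x x) u v -
      fderiv ℝ (ξ.inChart x) (extChartAt 𝓘(ℝ, E) x x) v u := by
  rw [← extDeriv_one_apply ((hξ.contDiffAt_inChart (mem_extChartAt_target x)).differentiableAt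
    (by simp))]
  exact congrArg (fun a : E [⋀^Fin 2]→L[ℝ] ℝ => a ![u, v]) (DForm.d_eq ξ.toDForm x)

lemma dfun_eq {f : M → ℝ} {g : E → ℝ} {x : M}
    (hg : DifferentiableAt ℝ g (extChartAt 𝓘(ℝ, E) x x))
    (h : ∀ᶠ e in nhds (extChartAt 𝓘(ℝ, E) x x), f ((extChartAt 𝓘(ℝ, E) x).symm e) = g e) :
    CoField.val (dfun f) x = fderiv ℝ g (extChartAt 𝓘(ℝ, E) x x) := by
  have h1 : f =ᶠ[nhds x] g ∘ extChartAt 𝓘(ℝ, E) x := by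
    filter_upwards [(continuousAt_extChartAt (I := 𝓘(ℝ, E)) x).eventually h,
      extChartAt_source_mem_nhds (I := 𝓘(ℝ, E)) x] with y hy hy'
    rw [← (extChartAt 𝓘(ℝ, E) x).left_inv hy', hy, (extChartAt 𝓘(ℝ, E) x).left_inv hy']
    rfl
  have h2 : HasMFDerivAt 𝓘(ℝ, E) 𝓘(ℝ, E) (extChartAt 𝓘(ℝ, E) x) x (dchart E x x) :=
    (contMDiffAt_extChartAt (n := ∞)).mdifferentiableAt (by simp) |>.hasMFDerivAt
  have h3 := (HasMFDerivAt.comp x hg.hasFDerivAt.hasMFDerivAt h2).congr_of_eventuallyEq h1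
  refine h3.mfderiv.trans ?_
  rw [dchart_self]
  rfl

/-- The Lie bracket of vector fields at the centre of a chart. -/
lemma mlieBracket_eq (X Y : VField E M) (x : M) :
    VField.val (mlieBracket 𝓘(ℝ, E) X Y) x =
      fderiv ℝ (Y.inChart x) (extChartAt 𝓘(ℝ, E) x x) (X.val x) -
        fderiv ℝ (X.inChart x) (extChartAt 𝓘(ℝ, E) x x) (Y.val x) := by
  have h : ∀ Z : VField E M, mpullbackWithin 𝓘(ℝ, E) 𝓘(ℝ, E) (extChartAt 𝓘(ℝ, E) x).symm Z
      (Set.range 𝓘(ℝ, E)) =ᶠ[nhds (extChartAt 𝓘(ℝ, E) x x)] Z.inChart x := by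
    intro Z
    filter_upwards [extChartAt_target_mem_nhds (I := 𝓘(ℝ, E)) x] with e he
    rw [mpullbackWithin_apply]
    have h1 := (isInvertible_mfderivWithin_extChartAt_symm (I := 𝓘(ℝ, E)) he)
    refine (h1.inverse_apply_eq).2 ?_
    rw [ModelWithCorners.range_eq_univ, mfderivWithin_univ]
    exact (dchartSymm_dchart he _).symm
  have h0 := mlieBracketWithin_apply (I := 𝓘(ℝ, E)) (V := X) (W := Y) (s := Set.univ) (x₀ := x)
  have e1 : (mfderiv 𝓘(ℝ, E) 𝓘(ℝ, E) (extChartAt 𝓘(ℝ, E) x) x : E →L[ℝ] E).inverse =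
      ContinuousLinearMap.id ℝ E :=
    (congrArg (fun L : E →L[ℝ] E => L.inverse) (dchart_self x)).trans
      ContinuousLinearMap.inverse_id
  refine h0.trans ((congrArg (fun L : E →L[ℝ] E => L _) e1).trans ?_)
  have hu : (extChartAt 𝓘(ℝ, E) x).symm ⁻¹' Set.univ ∩ Set.range 𝓘(ℝ, E) = Set.univ := by
    rw [Set.preimage_univ, Set.univ_inter, ModelWithCorners.range_eq_univ]
  have h2 : ∀ S : Set E, S = Set.univ → ∀ A B : E → E,
      A =ᶠ[nhds (extChartAt 𝓘(ℝ, E) x x)] X.inChart x →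
      B =ᶠ[nhds (extChartAt 𝓘(ℝ, E) x x)] Y.inChart x →
      lieBracketWithin ℝ A B S (extChartAt 𝓘(ℝ, E) x x) =
        fderiv ℝ (Y.inChart x) (extChartAt 𝓘(ℝ, E) x x) (X.val x) -
          fderiv ℝ (X.inChart x) (extChartAt 𝓘(ℝ, E) x x) (Y.val x) := by
    rintro S rfl A B hA hB
    rw [lieBracketWithin_univ, hA.lieBracket_vectorField_eq hB, lieBracket_eq]
    simp only [VField.inChart_self]
  exact h2 _ hu _ _ (h X) (h Y)

/-- The vector part of a section of the generalized tangent bundle. -/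
def GField.vec (A : GField E M) : VField E M := fun x => (A x).1

/-- The covector part of a section of the generalized tangent bundle. -/
def GField.cov (A : GField E M) : CoField E M := fun x => (A x).2

lemma GField.smooth_iff (A : GField E M) : A.Smooth ↔ A.vec.Smooth ∧ A.cov.Smooth := Iff.rfl

lemma CoField.inChart_apply_inChart (ξ : CoField E M) (X : VField E M) {c : M} {e : E}
    (he : e ∈ (extChartAt 𝓘(ℝ, E) c).target) :
    ξ ((extChartAt 𝓘(ℝ, E) c).symm e) (X ((extChartAt 𝓘(ℝ, E) c).symm e)) =
      ξ.inChart c e (X.inChart c e) :=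
  congrArg (ξ.val ((extChartAt 𝓘(ℝ, E) c).symm e)) (dchartSymm_dchart he _).symm

/-- The differential of `ξ(X)` at the centre of a chart. -/
lemma contraction_eq {ξ : CoField E M} {X : VField E M} (hξ : ξ.Smooth) (hX : X.Smooth) (x : M)
    (v : E) : CoField.val (dfun fun y => ξ y (X y)) x v =
      fderiv ℝ (ξ.inChart x) (extChartAt 𝓘(ℝ, E) x x) v (X.val x) +
        ξ.val x (fderiv ℝ (X.inChart x) (extChartAt 𝓘(ℝ, E) x x) v) := by
  have h1 := (hξ.contDiffAt_inChart (mem_extChartAt_target x)).differentiableAt (by simp)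
  have h2 := (hX.contDiffAt_inChart (mem_extChartAt_target x)).differentiableAt (by simp)
  rw [dfun_eq (h1.clm_apply h2), fderiv_clm_apply h1 h2]
  · rw [add_apply, ContinuousLinearMap.comp_apply, ContinuousLinearMap.flip_apply,
      VField.inChart_self, CoField.inChart_self, add_comm]
  · filter_upwards [extChartAt_target_mem_nhds (I := 𝓘(ℝ, E)) x] with e he
    exact ξ.inChart_apply_inChart X he

lemma mdifferentiableAt_contraction {ξ : CoField E M} {X : VField E M} (hξ : ξ.Smooth)
    (hX : X.Smooth) (x : M) : MDifferentiableAt 𝓘(ℝ, E) 𝓘(ℝ, ℝ) (fun y => ξ y (X y)) x := by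
  have h1 := (hξ.contDiffAt_inChart (mem_extChartAt_target x)).differentiableAt (by simp)
  have h2 := (hX.contDiffAt_inChart (mem_extChartAt_target x)).differentiableAt (by simp)
  refine MDifferentiableAt.congr_of_eventuallyEq
    (f := fun y => ξ.inChart x (extChartAt 𝓘(ℝ, E) x y) (X.inChart x (extChartAt 𝓘(ℝ, E) x y)))
    ?_ ?_
  · exact MDifferentiableAt.comp x (h1.clm_apply h2).mdifferentiableAt
      ((contMDiffAt_extChartAt (n := ∞)).mdifferentiableAt (by simp))
  · filter_upwards [extChartAt_source_mem_nhds (I := 𝓘(ℝ, E)) x] with y hy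
    have h3 := ξ.inChart_apply_inChart X ((extChartAt 𝓘(ℝ, E) x).map_source hy)
    rwa [(extChartAt 𝓘(ℝ, E) x).left_inv hy] at h3

/-- The Lie derivative of a `1`-form at the centre of a chart: in `ι_X dξ + d(ξ(X))` the terms
with the derivative of `ξ` in the direction `v` cancel. -/
lemma lieDeriv_eq {ξ : CoField E M} {X : VField E M} (hξ : ξ.Smooth) (hX : X.Smooth) (x : M)
    (v : E) : CoField.val (lieDeriv X ξ) x v =
      fderiv ℝ (ξ.inChart x) (extChartAt 𝓘(ℝ, E) x x) (X.val x) v +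
        ξ.val x (fderiv ℝ (X.inChart x) (extChartAt 𝓘(ℝ, E) x x) v) := by
  have h1 : CoField.val (lieDeriv X ξ) x v =
      ξ.toDForm.d.val x ![X.val x, v] + CoField.val (dfun fun y => ξ y (X y)) x v :=
    congrArg (· + CoField.val (dfun fun y => ξ y (X y)) x v) (iota₂_apply (X x) v (ξ.toDForm.d x))
  rw [h1, CoField.d_apply hξ, contraction_eq hξ hX]
  ring

/-- The covector part of the twisted Courant bracket at the centre of a chart. -/
lemma courant_snd {H : DForm E M 3} {A B : GField E M} (hA : A.Smooth) (hB : B.Smooth) (x : M)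
    (v : E) : (courant H A B).cov.val x v =
      fderiv ℝ (B.cov.inChart x) (extChartAt 𝓘(ℝ, E) x x) (A.vec.val x) v
      + B.cov.val x (fderiv ℝ (A.vec.inChart x) (extChartAt 𝓘(ℝ, E) x x) v)
      - (fderiv ℝ (A.cov.inChart x) (extChartAt 𝓘(ℝ, E) x x) (B.vec.val x) v
        + A.cov.val x (fderiv ℝ (B.vec.inChart x) (extChartAt 𝓘(ℝ, E) x x) v))
      - (1 / 2 : ℝ) * (fderiv ℝ (B.cov.inChart x) (extChartAt 𝓘(ℝ, E) x x) v (A.vec.val x)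
        + B.cov.val x (fderiv ℝ (A.vec.inChart x) (extChartAt 𝓘(ℝ, E) x x) v)
        - (fderiv ℝ (A.cov.inChart x) (extChartAt 𝓘(ℝ, E) x x) v (B.vec.val x)
          + A.cov.val x (fderiv ℝ (B.vec.inChart x) (extChartAt 𝓘(ℝ, E) x x) v)))
      + H.val x ![A.vec.val x, B.vec.val x, v] := by
  have h0 : CoField.val (dfun fun y => (B y).2 (A y).1 - (A y).2 (B y).1) x v =
      CoField.val (dfun fun y => (B y).2 (A y).1) x v -
        CoField.val (dfun fun y => (A y).2 (B y).1) x v := by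
    have h1 := (mdifferentiableAt_contraction hB.2 hA.1 x).hasMFDerivAt.sub
      (mdifferentiableAt_contraction hA.2 hB.1 x).hasMFDerivAt
    exact congrArg (fun L : E →L[ℝ] ℝ => L v) h1.mfderiv
  have h1 : (courant H A B).cov.val x v =
      CoField.val (lieDeriv A.vec B.cov) x v - CoField.val (lieDeriv B.vec A.cov) x v
      - (1 / 2 : ℝ) * CoField.val (dfun fun y => (B y).2 (A y).1 - (A y).2 (B y).1) x v
      + H.val x ![A.vec.val x, B.vec.val x, v] :=
    congrArg (fun r : ℝ => CoField.val (lieDeriv A.vec B.cov) x v -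
      CoField.val (lieDeriv B.vec A.cov) x v
      - (1 / 2 : ℝ) * CoField.val (dfun fun y => (B y).2 (A y).1 - (A y).2 (B y).1) x v + r)
      (iota₃_apply (A x).1 (B x).1 v (H x))
  rw [h1, h0, ← lieDeriv_eq (X := A.vec) (ξ := B.cov) hB.2 hA.1,
    ← lieDeriv_eq (X := B.vec) (ξ := A.cov) hA.2 hB.1,
    ← contraction_eq (X := A.vec) (ξ := B.cov) hB.2 hA.1,
    ← contraction_eq (X := B.vec) (ξ := A.cov) hA.2 hB.1]
  rfl

lemma courant_fst {H : DForm E M 3} (A B : GField E M) (x : M) :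
    (courant H A B).vec.val x =
      fderiv ℝ (B.vec.inChart x) (extChartAt 𝓘(ℝ, E) x x) (A.vec.val x) -
        fderiv ℝ (A.vec.inChart x) (extChartAt 𝓘(ℝ, E) x x) (B.vec.val x) :=
  mlieBracket_eq _ _ x

/-! ### Bundle endomorphisms of the generalized tangent bundle in charts -/

/-- The coordinates of a generalized tangent vector at the point with coordinates `e`. -/
def gtanToChart (c : M) (e : E) : (E × (E →L[ℝ] ℝ)) →L[ℝ] (E × (E →L[ℝ] ℝ)) :=
  (dchart E c ((extChartAt 𝓘(ℝ, E) c).symm e)).prodMap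
    (ContinuousLinearMap.precomp ℝ (dchartSymm c e))

/-- The generalized tangent vector with given coordinates. -/
def gtanOfChart (c : M) (e : E) : (E × (E →L[ℝ] ℝ)) →L[ℝ] (E × (E →L[ℝ] ℝ)) :=
  (dchartSymm c e).prodMap
    (ContinuousLinearMap.precomp ℝ (dchart E c ((extChartAt 𝓘(ℝ, E) c).symm e)))

lemma gtanOfChart_gtanToChart {c : M} {e : E} (he : e ∈ (extChartAt 𝓘(ℝ, E) c).target)
    (u : E × (E →L[ℝ] ℝ)) : gtanOfChart c e (gtanToChart c e u) = u := by
  refine Prod.ext (dchartSymm_dchart he _) ?_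
  ext v
  exact congrArg u.2 (dchartSymm_dchart he v)

lemma gtanToChart_gtanOfChart {c : M} {e : E} (he : e ∈ (extChartAt 𝓘(ℝ, E) c).target)
    (u : E × (E →L[ℝ] ℝ)) : gtanToChart c e (gtanOfChart c e u) = u := by
  refine Prod.ext (dchart_dchartSymm he _) ?_
  ext v
  exact congrArg u.2 (dchart_dchartSymm he v)

/-- The value of `J` at `x`, as an endomorphism of a fixed vector space. -/
def GenAlmostComplex.val (J : GenAlmostComplex E M) (x : M) :
    (E × (E →L[ℝ] ℝ)) →L[ℝ] (E × (E →L[ℝ] ℝ)) := J.toFun x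

/-- The endomorphism `J` read in the preferred chart at `c`. -/
def GenAlmostComplex.inChart (J : GenAlmostComplex E M) (c : M) (e : E) :
    (E × (E →L[ℝ] ℝ)) →L[ℝ] (E × (E →L[ℝ] ℝ)) :=
  gtanToChart c e ∘L J.val ((extChartAt 𝓘(ℝ, E) c).symm e) ∘L gtanOfChart c e

lemma GenAlmostComplex.contDiffAt_inChart (J : GenAlmostComplex E M) (c : M) :
    ContDiffAt ℝ ∞ (J.inChart c) (extChartAt 𝓘(ℝ, E) c c) := by
  have h1 := (contMDiffAt_section c).1 (J.smooth c)
  have h2 := contMDiffAt_comp_extChartAt_symm (E := E) (f := fun x =>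
    (trivializationAt ((E × (E →L[ℝ] ℝ)) →L[ℝ] (E × (E →L[ℝ] ℝ)))
      (fun x : M => GTan E x →L[ℝ] GTan E x) c ⟨x, J.toFun x⟩).2) (mem_extChartAt_target c)
    (by rw [extChartAt_to_inv]; exact h1)
  refine (h2).congr_of_eventuallyEq ?_
  filter_upwards [extChartAt_target_mem_nhds (I := 𝓘(ℝ, E)) c] with e he
  have hs := (extChartAt 𝓘(ℝ, E) c).map_target he
  have hb : (extChartAt 𝓘(ℝ, E) c).symm e ∈
      (trivializationAt E (TangentSpace (M := M) 𝓘(ℝ, E)) c).baseSet := by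
    rw [extChartAt_source] at hs
    simpa using hs
  have hb' : (extChartAt 𝓘(ℝ, E) c).symm e ∈
      (trivializationAt (E × (E →L[ℝ] ℝ)) (fun x : M => GTan E x) c).baseSet := by
    rw [extChartAt_source] at hs
    simpa using hs
  have hT : ∀ w : GTan E ((extChartAt 𝓘(ℝ, E) c).symm e),
      (trivializationAt (E × (E →L[ℝ] ℝ)) (fun x : M => GTan E x) c).continuousLinearMapAt ℝ
        ((extChartAt 𝓘(ℝ, E) c).symm e) w = gtanToChart c e w := by
    intro w
    classical
    rw [Trivialization.continuousLinearMapAt_apply, Trivialization.linearMapAt_apply, if_pos hb']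
    refine Prod.ext ?_ ?_
    · have h3 := VField.inChart_eq (E := E) (M := M) (Function.update 0 _ w.1) he
      rw [VField.inChart, Function.update_self] at h3
      exact h3.symm
    · have h3 := CoField.inChart_eq (E := E) (M := M) (Function.update 0 _ w.2) he
      rw [CoField.inChart, Function.update_self] at h3
      exact h3.symm
  have hS : ∀ u : E × (E →L[ℝ] ℝ),
      (trivializationAt (E × (E →L[ℝ] ℝ)) (fun x : M => GTan E x) c).symmL ℝ
        ((extChartAt 𝓘(ℝ, E) c).symm e) u = gtanOfChart c e u := by
    intro u
    have h3 := Trivialization.symmL_continuousLinearMapAt (R := ℝ)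
      (trivializationAt (E × (E →L[ℝ] ℝ)) (fun x : M => GTan E x) c) hb' (gtanOfChart c e u)
    have h4 := (hT (gtanOfChart c e u)).trans (gtanToChart_gtanOfChart he u)
    exact (congrArg _ h4.symm).trans h3
  refine ContinuousLinearMap.ext fun u => ?_
  simp only [hom_trivializationAt_apply, ContinuousLinearMap.inCoordinates]
  refine Eq.trans ?_ (hT _).symm
  exact congrArg (fun w => gtanToChart c e (J.val ((extChartAt 𝓘(ℝ, E) c).symm e) w)) (hS u).symm

end Fields

/-! ### Smoothness of sections built from `J`, `H` and functions -/

section Sections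

variable {E : Type*} [NormedAddCommGroup E] [NormedSpace ℝ E]
  {M : Type*} [TopologicalSpace M] [ChartedSpace E M]

/-- A section of the generalized tangent bundle read in the preferred chart at `c`. -/
def GField.inChart (A : GField E M) (c : M) (e : E) : E × (E →L[ℝ] ℝ) :=
  (A.vec.inChart c e, A.cov.inChart c e)

/-- The value of a section at `x`, as a vector of a fixed vector space. -/
def GField.val (A : GField E M) (x : M) : E × (E →L[ℝ] ℝ) := A x

variable [IsManifold 𝓘(ℝ, E) ∞ M]

/-- The section `J A`. -/
def GenAlmostComplex.map (J : GenAlmostComplex E M) (A : GField E M) : GField E M :=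
  fun x => J.toFun x (A x)

lemma GField.inChart_self (A : GField E M) (c : M) :
    A.inChart c (extChartAt 𝓘(ℝ, E) c c) = A.val c :=
  Prod.ext (A.vec.inChart_self c) (A.cov.inChart_self c)

lemma GField.Smooth.contDiffAt_inChart {A : GField E M} (hA : A.Smooth) {c : M} {e : E}
    (he : e ∈ (extChartAt 𝓘(ℝ, E) c).target) : ContDiffAt ℝ ∞ (A.inChart c) e :=
  ((A.smooth_iff.1 hA).1.contDiffAt_inChart he).prodMk
    ((A.smooth_iff.1 hA).2.contDiffAt_inChart he)

lemma GField.smooth_of_inChart {A : GField E M}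
    (h : ∀ c : M, ContDiffAt ℝ ∞ (A.inChart c) (extChartAt 𝓘(ℝ, E) c c)) : A.Smooth :=
  A.smooth_iff.2 ⟨VField.smooth_of_inChart fun c => (h c).fst,
    CoField.smooth_of_inChart fun c => (h c).snd⟩

lemma GenAlmostComplex.inChart_map (J : GenAlmostComplex E M) (A : GField E M) {c : M} {e : E}
    (he : e ∈ (extChartAt 𝓘(ℝ, E) c).target) :
    (J.map A).inChart c e = J.inChart c e (A.inChart c e) :=
  congrArg (fun u => gtanToChart c e (J.val ((extChartAt 𝓘(ℝ, E) c).symm e) u))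
    (gtanOfChart_gtanToChart he (A.val ((extChartAt 𝓘(ℝ, E) c).symm e))).symm

lemma GenAlmostComplex.map_smooth (J : GenAlmostComplex E M) {A : GField E M} (hA : A.Smooth) :
    (J.map A).Smooth := by
  refine GField.smooth_of_inChart fun c => ?_
  refine ((J.contDiffAt_inChart c).clm_apply
    (hA.contDiffAt_inChart (mem_extChartAt_target c))).congr_of_eventuallyEq ?_
  filter_upwards [extChartAt_target_mem_nhds (I := 𝓘(ℝ, E)) c] with e he
  exact J.inChart_map A he

lemma inChart_dfun {f : M → ℝ} (hf : ContMDiff 𝓘(ℝ, E) 𝓘(ℝ, ℝ) ∞ f) {c : M} {e : E}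
    (he : e ∈ (extChartAt 𝓘(ℝ, E) c).target) : CoField.inChart (dfun f) c e =
      fderiv ℝ (fun e => f ((extChartAt 𝓘(ℝ, E) c).symm e)) e := by
  have h1 := (hf ((extChartAt 𝓘(ℝ, E) c).symm e)).mdifferentiableAt (by simp) |>.hasMFDerivAt
  have h2 := (contMDiffAt_extChartAt_symm he).mdifferentiableAt (by simp) |>.hasMFDerivAt
  have h : HasMFDerivAt 𝓘(ℝ, E) 𝓘(ℝ, ℝ) (fun e => f ((extChartAt 𝓘(ℝ, E) c).symm e)) e
      (CoField.inChart (dfun f : CoField E M) c e : E →L[ℝ] ℝ) := HasMFDerivAt.comp e h1 h2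
  have h' : HasFDerivAt (fun e => f ((extChartAt 𝓘(ℝ, E) c).symm e))
      (CoField.inChart (dfun f : CoField E M) c e) e := hasMFDerivAt_iff_hasFDerivAt.1 h
  exact h'.fderiv.symm

lemma contDiffAt_comp_extChartAt_symm {f : M → ℝ} (hf : ContMDiff 𝓘(ℝ, E) 𝓘(ℝ, ℝ) ∞ f) {c : M}
    {e : E} (he : e ∈ (extChartAt 𝓘(ℝ, E) c).target) :
    ContDiffAt ℝ ∞ (fun e => f ((extChartAt 𝓘(ℝ, E) c).symm e)) e :=
  contMDiffAt_comp_extChartAt_symm he (hf _)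

lemma dfun_smooth {f : M → ℝ} (hf : ContMDiff 𝓘(ℝ, E) 𝓘(ℝ, ℝ) ∞ f) :
    CoField.Smooth (dfun f : CoField E M) := by
  refine CoField.smooth_of_inChart fun c => ?_
  refine ((contDiffAt_comp_extChartAt_symm hf (mem_extChartAt_target c)).fderiv_right
    (m := ∞) (by simp)).congr_of_eventuallyEq ?_
  filter_upwards [extChartAt_target_mem_nhds (I := 𝓘(ℝ, E)) c] with e he
  exact inChart_dfun hf he

lemma VField.smooth_zero : VField.Smooth (0 : VField E M) := by
  refine VField.smooth_of_inChart fun c => ?_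
  have h : VField.inChart (0 : VField E M) c = fun _ => 0 := by
    funext e; exact map_zero (dchart E c ((extChartAt 𝓘(ℝ, E) c).symm e))
  rw [h]
  exact contDiffAt_const

/-- The exact section `df` of the generalized tangent bundle. -/
def dGField (f : M → ℝ) : GField E M := fun x => (0, dfun f x)

lemma dGField_smooth {f : M → ℝ} (hf : ContMDiff 𝓘(ℝ, E) 𝓘(ℝ, ℝ) ∞ f) :
    (dGField f : GField E M).Smooth :=
  (GField.smooth_iff _).2 ⟨VField.smooth_zero, dfun_smooth hf⟩

lemma GenAlmostComplex.hamField_eq (J : GenAlmostComplex E M) (f : M → ℝ) :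
    J.hamField f = J.map (dGField f) := rfl

lemma GenAlmostComplex.hamField_smooth (J : GenAlmostComplex E M) {f : M → ℝ}
    (hf : ContMDiff 𝓘(ℝ, E) 𝓘(ℝ, ℝ) ∞ f) : (J.hamField f).Smooth :=
  J.map_smooth (dGField_smooth hf)

lemma DForm.inChart_interior (X : VField E M) (w : DForm E M 3) {c : M} {e : E}
    (he : e ∈ (extChartAt 𝓘(ℝ, E) c).target) :
    (DForm.interior X w).inChart c e =
      ContinuousAlternatingMap.curryLeft (w.inChart c e) (X.inChart c e) := by
  have h := ContinuousAlternatingMap.curryLeft_compContinuousLinearMap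
    (w.val ((extChartAt 𝓘(ℝ, E) c).symm e)) (dchartSymm c e) (X.inChart c e)
  refine Eq.trans ?_ h.symm
  exact congrArg (fun v => (ContinuousAlternatingMap.curryLeft
    (w.val ((extChartAt 𝓘(ℝ, E) c).symm e)) v).compContinuousLinearMap (dchartSymm c e))
    (dchartSymm_dchart he _).symm

lemma DForm.Smooth.interior {w : DForm E M 3} (hw : w.Smooth) {X : VField E M} (hX : X.Smooth) :
    (DForm.interior X w).Smooth := by
  refine DForm.smooth_of_inChart fun c => ?_
  have h0 : ContDiff ℝ ∞ (fun a : E [⋀^Fin 3]→L[ℝ] ℝ =>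
      ContinuousAlternatingMap.curryLeftLI (𝕜 := ℝ) (E := E) (F := ℝ) (n := 2) a) :=
    LinearIsometry.contDiff _
  have h1 := h0.contDiffAt.comp _ (hw.contDiffAt_inChart (mem_extChartAt_target c))
  refine (h1.clm_apply (hX.contDiffAt_inChart (mem_extChartAt_target c))).congr_of_eventuallyEq ?_
  filter_upwards [extChartAt_target_mem_nhds (I := 𝓘(ℝ, E)) c] with e he
  exact DForm.inChart_interior X w he

lemma DForm.Smooth.d {n : ℕ} {w : DForm E M n} (hw : w.Smooth) : w.d.Smooth := by
  refine DForm.smooth_of_inChart fun c => ?_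
  have h1 := (hw.contDiffAt_inChart (mem_extChartAt_target c)).fderiv_right (m := ∞) (by simp)
  have h2 := (ContinuousAlternatingMap.alternatizeUncurryFinCLM ℝ E ℝ (n := n)).contDiff
    (n := ∞) |>.contDiffAt.comp _ h1
  refine h2.congr_of_eventuallyEq ?_
  filter_upwards [extChartAt_target_mem_nhds (I := 𝓘(ℝ, E)) c] with e he
  exact DForm.inChart_d hw he

lemma DForm.Smooth.sub {n : ℕ} {v w : DForm E M n} (hv : v.Smooth) (hw : w.Smooth) :
    (v - w).Smooth := sub_eq_add_neg v w ▸ hv.add hw.neg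

lemma DForm.d_add {n : ℕ} {v w : DForm E M n} (hv : v.Smooth) (hw : w.Smooth) :
    (v + w).d = v.d + w.d := by
  funext x
  have h := extDeriv_add
    ((hv.contDiffAt_inChart (mem_extChartAt_target x)).differentiableAt (by simp))
    ((hw.contDiffAt_inChart (mem_extChartAt_target x)).differentiableAt (by simp))
  have h1 : (v + w).inChart x = v.inChart x + w.inChart x := rfl
  refine (DForm.d_eq _ x).trans ?_
  rw [h1, h, ← DForm.d_eq, ← DForm.d_eq]
  rfl

lemma DForm.d_neg {n : ℕ} (w : DForm E M n) : (-w).d = -w.d := by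
  funext x
  have h1 : (-w).inChart x = (-1 : ℝ) • w.inChart x := by
    funext e
    exact (neg_one_smul ℝ (w.inChart x e)).symm
  refine (DForm.d_eq _ x).trans ?_
  rw [h1, extDeriv_smul, ← DForm.d_eq]
  exact neg_one_smul ℝ (w.d.val x)

lemma DForm.d_sub {n : ℕ} {v w : DForm E M n} (hv : v.Smooth) (hw : w.Smooth) :
    (v - w).d = v.d - w.d := by
  rw [sub_eq_add_neg, DForm.d_add hv hw.neg, DForm.d_neg, sub_eq_add_neg]

lemma DForm.d_d {n : ℕ} {w : DForm E M n} (hw : w.Smooth) : w.d.d = 0 := by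
  funext x
  have h : w.d.inChart x =ᶠ[nhds (extChartAt 𝓘(ℝ, E) x x)] extDeriv (w.inChart x) := by
    filter_upwards [extChartAt_target_mem_nhds (I := 𝓘(ℝ, E)) x] with e he
    exact DForm.inChart_d hw he
  refine (DForm.d_eq _ x).trans ?_
  rw [h.extDeriv_eq]
  exact extDeriv_extDeriv_apply ((hw.contDiffAt_inChart (mem_extChartAt_target x)).of_le
    two_le_infty) (by simp)

lemma d_dfun {f : M → ℝ} (hf : ContMDiff 𝓘(ℝ, E) 𝓘(ℝ, ℝ) ∞ f) :
    (CoField.toDForm (dfun f : CoField E M)).d = 0 := by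
  funext x
  have hz := mem_extChartAt_target (I := 𝓘(ℝ, E)) x
  have h : CoField.inChart (dfun f) x =ᶠ[nhds (extChartAt 𝓘(ℝ, E) x x)]
      fderiv ℝ (fun e => f ((extChartAt 𝓘(ℝ, E) x).symm e)) := by
    filter_upwards [extChartAt_target_mem_nhds (I := 𝓘(ℝ, E)) x] with e he
    exact inChart_dfun hf he
  have hs := ((contDiffAt_comp_extChartAt_symm hf hz).of_le two_le_infty).isSymmSndFDerivAt
    (by simp)
  refine ContinuousAlternatingMap.ext (M := E) fun m => ?_
  have hm : m = ![m 0, m 1] := by ext i; fin_cases i <;> rfl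
  rw [hm]
  refine (CoField.d_apply (dfun_smooth hf) x (m 0) (m 1)).trans ?_
  rw [h.fderiv_eq, hs.eq, sub_self]
  rfl

/-- Every vector of a smooth vector bundle is the value of a global smooth section. -/
lemma exists_smooth_section [FiniteDimensional ℝ E] [T2Space M] {F : Type*} [NormedAddCommGroup F]
    [NormedSpace ℝ F] {V : M → Type*} [TopologicalSpace (TotalSpace F V)]
    [∀ x, AddCommGroup (V x)] [∀ x, TopologicalSpace (V x)] [∀ x, Module ℝ (V x)]
    [FiberBundle F V] [VectorBundle ℝ F V] [ContMDiffVectorBundle ∞ F V 𝓘(ℝ, E)] (x : M)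
    (v : V x) : ∃ s : (x : M) → V x,
      ContMDiff 𝓘(ℝ, E) (𝓘(ℝ, E).prod 𝓘(ℝ, F)) ∞ (fun x => TotalSpace.mk' F x (s x)) ∧
        s x = v := by
  obtain ⟨U, hU, hs⟩ := FiberBundle.exists_contMDiffOn_extend (k := ∞) 𝓘(ℝ, E) F v
  obtain ⟨ψ, -, hψ⟩ := (SmoothBumpFunction.nhds_basis_tsupport (I := 𝓘(ℝ, E)) x).mem_iff.1
    (interior_mem_nhds.2 hU)
  refine ⟨fun y => ψ y • FiberBundle.extend F v y, ?_, ?_⟩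
  · exact ContMDiffOn.smul_section_of_tsupport ψ.contMDiff.contMDiffOn isOpen_interior hψ
      (hs.mono interior_subset)
  · simp

/-- Every generalized tangent vector is the value of a global smooth section. -/
lemma exists_smooth_gfield [FiniteDimensional ℝ E] [T2Space M] (x : M) (u : E × (E →L[ℝ] ℝ)) :
    ∃ A : GField E M, A.Smooth ∧ A.val x = u := by
  obtain ⟨X, hX, hX'⟩ := exists_smooth_section (E := E) (F := E)
    (V := fun x : M => TangentSpace 𝓘(ℝ, E) x) x u.1
  obtain ⟨ξ, hξ, hξ'⟩ :=
    exists_smooth_section (E := E) (F := E →L[ℝ] ℝ)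
    (V := fun x : M => TangentSpace 𝓘(ℝ, E) x →L[ℝ] ℝ) x u.2
  exact ⟨fun x => (X x, ξ x), ⟨hX, hξ⟩, Prod.ext hX' hξ'⟩

end Sections

/-! ### Cartan's formula -/

section Flow

variable {E : Type*} [NormedAddCommGroup E] [NormedSpace ℝ E]
  {M : Type*} [TopologicalSpace M] [ChartedSpace E M]

/-- The interior product of a vector field with a `2`-form, a covector field. -/
def DForm.interiorTwo (X : VField E M) (w : DForm E M 2) : CoField E M := fun x => iota₂ (X x) (w x)

variable [IsManifold 𝓘(ℝ, E) ∞ M]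

lemma VField.inChart_extChartAt (X : VField E M) {c x : M}
    (hx : x ∈ (extChartAt 𝓘(ℝ, E) c).source) :
    X.inChart c (extChartAt 𝓘(ℝ, E) c x) = dchart E c x (X.val x) := by
  have h1 : ∀ q : M, q = x → dchart E c q (X.val q) = dchart E c x (X.val x) := by
    rintro q rfl; rfl
  exact h1 _ ((extChartAt 𝓘(ℝ, E) c).left_inv hx)

lemma DForm.inChart_interiorTwo (X : VField E M) (w : DForm E M 2) {c : M} {e : E}
    (he : e ∈ (extChartAt 𝓘(ℝ, E) c).target) :
    (DForm.interiorTwo X w).inChart c e =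
      (w.inChart c e).toContinuousLinearMap ![X.inChart c e, 0] 1 := by
  refine ContinuousLinearMap.ext fun v => ?_
  rw [iotaE_apply]
  refine (iota₂_apply (X ((extChartAt 𝓘(ℝ, E) c).symm e)) (dchartSymm c e v)
    (w ((extChartAt 𝓘(ℝ, E) c).symm e))).trans ?_
  refine Eq.trans ?_ (compCLM_two (w.val ((extChartAt 𝓘(ℝ, E) c).symm e)) (dchartSymm c e)
    (X.inChart c e) v).symm
  exact congrArg (fun y => w.val ((extChartAt 𝓘(ℝ, E) c).symm e) ![y, dchartSymm c e v])
    (dchartSymm_dchart he _).symm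

lemma DForm.Smooth.interiorTwo {w : DForm E M 2} (hw : w.Smooth) {X : VField E M}
    (hX : X.Smooth) : (DForm.interiorTwo X w).Smooth := by
  refine CoField.smooth_of_inChart fun c => ?_
  refine ((contDiff_iotaE (E := E)).contDiffAt.comp _
    ((hw.contDiffAt_inChart (mem_extChartAt_target c)).prodMk
      (hX.contDiffAt_inChart (mem_extChartAt_target c)))).congr_of_eventuallyEq ?_
  filter_upwards [extChartAt_target_mem_nhds (I := 𝓘(ℝ, E)) c] with e he
  exact DForm.inChart_interiorTwo X w he

/-- Leibniz rule for the interior product of a vector field with a form of the model space. -/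
lemma fderiv_curryLeft {n : ℕ} {a : E → E [⋀^Fin (n + 1)]→L[ℝ] ℝ} {X : E → E} {z : E}
    (ha : DifferentiableAt ℝ a z) (hX : DifferentiableAt ℝ X z) (u : E) :
    DifferentiableAt ℝ (fun e => ContinuousAlternatingMap.curryLeft (a e) (X e)) z ∧
    fderiv ℝ (fun e => ContinuousAlternatingMap.curryLeft (a e) (X e)) z u =
      ContinuousAlternatingMap.curryLeft (fderiv ℝ a z u) (X z) +
        ContinuousAlternatingMap.curryLeft (a z) (fderiv ℝ X z u) := by
  let T : (E [⋀^Fin (n + 1)]→L[ℝ] ℝ) →L[ℝ] (E →L[ℝ] E [⋀^Fin n]→L[ℝ] ℝ) :=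
    (ContinuousAlternatingMap.curryLeftLI (𝕜 := ℝ) (E := E) (F := ℝ)
      (n := n)).toContinuousLinearMap
  have h1 : HasFDerivAt (fun e => T (a e)) (T ∘L fderiv ℝ a z) z :=
    HasFDerivAt.comp (g := fun b => T b) z (ContinuousLinearMap.hasFDerivAt (𝕜 := ℝ)
      (F := E →L[ℝ] E [⋀^Fin n]→L[ℝ] ℝ) T) ha.hasFDerivAt
  have h2 := h1.clm_apply hX.hasFDerivAt
  refine ⟨h2.differentiableAt, ?_⟩
  refine (congrArg (fun L => L u) h2.fderiv).trans ?_
  exact add_comm _ _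

lemma DForm.fderiv_inChart_interiorTwo {X : VField E M} {w : DForm E M 2} (hw : w.Smooth)
    (hX : X.Smooth) {c : M} {e : E} (he : e ∈ (extChartAt 𝓘(ℝ, E) c).target) (u v : E) :
    fderiv ℝ ((DForm.interiorTwo X w).inChart c) e u v =
      fderiv ℝ (w.inChart c) e u ![X.inChart c e, v] +
        w.inChart c e ![fderiv ℝ (X.inChart c) e u, v] := by
  have hw' := (hw.contDiffAt_inChart he).differentiableAt (by simp)
  have hX' := (hX.contDiffAt_inChart he).differentiableAt (by simp)
  obtain ⟨h1, h2⟩ := fderiv_curryLeft hw' hX' u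
  have h3 := fderiv_form_apply h1 ![v] u
  have h4 : (fun e => (DForm.interiorTwo X w).inChart c e v) =ᶠ[nhds e]
      fun e => ContinuousAlternatingMap.curryLeft (w.inChart c e) (X.inChart c e) ![v] := by
    filter_upwards [extChartAt_target_mem_nhds_of_mem he] with e he
    rw [DForm.inChart_interiorTwo X w he, iotaE_apply]
    rfl
  have h5 : fderiv ℝ (fun e => (DForm.interiorTwo X w).inChart c e v) e u =
      fderiv ℝ ((DForm.interiorTwo X w).inChart c) e u v := by
    have h6 := (((hw.interiorTwo hX).contDiffAt_inChart he).differentiableAt (by simp))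
    exact congrArg (fun L : E →L[ℝ] ℝ => L u)
      (((ContinuousLinearMap.apply ℝ ℝ v).hasFDerivAt.comp e h6.hasFDerivAt).fderiv)
  rw [← h5, h4.fderiv_eq, h3, h2]
  rfl

/-- Cartan's formula for the Lie derivative of a `2`-form, at the centre of a chart. -/
lemma cartan_two {X : VField E M} {w : DForm E M 2} (hw : w.Smooth) (hX : X.Smooth) (y : M)
    (u v : E) :
    (DForm.interiorTwo X w).toDForm.d.val y ![u, v] + w.d.val y ![X.val y, u, v] =
      fderiv ℝ (w.inChart y) (extChartAt 𝓘(ℝ, E) y y) (X.val y) ![u, v]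
      + w.val y ![fderiv ℝ (X.inChart y) (extChartAt 𝓘(ℝ, E) y y) u, v]
      + w.val y ![u, fderiv ℝ (X.inChart y) (extChartAt 𝓘(ℝ, E) y y) v] := by
  have hz := mem_extChartAt_target (I := 𝓘(ℝ, E)) y
  have e0 : w.inChart y (extChartAt 𝓘(ℝ, E) y y) = w.val y := w.inChart_self y
  have e1 : w.d.val y ![X.val y, u, v] = _ :=
    (congrArg (fun a : E [⋀^Fin 3]→L[ℝ] ℝ => a ![X.val y, u, v]) (w.d_eq y)).trans
      (extDeriv_two_apply ((hw.contDiffAt_inChart hz).differentiableAt (by simp)) _ _ _)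
  rw [e1, CoField.d_apply (hw.interiorTwo hX), DForm.fderiv_inChart_interiorTwo hw hX hz,
    DForm.fderiv_inChart_interiorTwo hw hX hz, e0, VField.inChart_self,
    map_swap_two (w.val y) u (fderiv ℝ (X.inChart y) (extChartAt 𝓘(ℝ, E) y y) v)]
  ring

/-- Cartan's formula for the Lie derivative of a `3`-form, at the centre of a chart. -/
lemma cartan_three {X : VField E M} {w : DForm E M 3} (hw : w.Smooth) (hX : X.Smooth) (y : M)
    (u v t : E) :
    (DForm.interior X w).d.val y ![u, v, t] + w.d.val y ![X.val y, u, v, t] =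
      fderiv ℝ (w.inChart y) (extChartAt 𝓘(ℝ, E) y y) (X.val y) ![u, v, t]
      + w.val y ![fderiv ℝ (X.inChart y) (extChartAt 𝓘(ℝ, E) y y) u, v, t]
      + w.val y ![u, fderiv ℝ (X.inChart y) (extChartAt 𝓘(ℝ, E) y y) v, t]
      + w.val y ![u, v, fderiv ℝ (X.inChart y) (extChartAt 𝓘(ℝ, E) y y) t] := by
  have hz := mem_extChartAt_target (I := 𝓘(ℝ, E)) y
  have e0 : w.inChart y (extChartAt 𝓘(ℝ, E) y y) = w.val y := w.inChart_self y
  have e1 : w.d.val y ![X.val y, u, v, t] = _ :=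
    (congrArg (fun a : E [⋀^Fin 4]→L[ℝ] ℝ => a ![X.val y, u, v, t]) (w.d_eq y)).trans
      (extDeriv_three_apply ((hw.contDiffAt_inChart hz).differentiableAt (by simp)) _ _ _ _)
  have e3 : (DForm.interior X w).d.val y ![u, v, t] = _ :=
    (congrArg (fun a : E [⋀^Fin 3]→L[ℝ] ℝ => a ![u, v, t]) ((DForm.interior X w).d_eq y)).trans
      (extDeriv_two_apply (((hw.interior hX).contDiffAt_inChart hz).differentiableAt (by simp))
        _ _ _)
  have e4 : ∀ a b c : E, fderiv ℝ ((DForm.interior X w).inChart y) (extChartAt 𝓘(ℝ, E) y y) a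
      ![b, c] = fderiv ℝ (w.inChart y) (extChartAt 𝓘(ℝ, E) y y) a ![X.val y, b, c] +
        w.val y ![fderiv ℝ (X.inChart y) (extChartAt 𝓘(ℝ, E) y y) a, b, c] := by
    intro a b c
    have h : (DForm.interior X w).inChart y =ᶠ[nhds (extChartAt 𝓘(ℝ, E) y y)]
        fun e => ContinuousAlternatingMap.curryLeft (w.inChart y e) (X.inChart y e) := by
      filter_upwards [extChartAt_target_mem_nhds (I := 𝓘(ℝ, E)) y] with e he
      exact DForm.inChart_interior X w he
    rw [h.fderiv_eq, (fderiv_curryLeft ((hw.contDiffAt_inChart hz).differentiableAt (by simp))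
      ((hX.contDiffAt_inChart hz).differentiableAt (by simp)) a).2, e0, VField.inChart_self]
    rfl
  have e2 : ∀ a b c : E, w.val y ![a, b, c] = - w.val y ![b, a, c] := by
    intro a b c
    have h := (w.val y).toAlternatingMap.map_swap ![b, a, c] (i := 0) (j := 1) (by decide)
    have h' : (![b, a, c] ∘ Equiv.swap (0 : Fin 3) 1) = ![a, b, c] := by
      ext i; fin_cases i <;> rfl
    rw [h'] at h
    exact h
  have e5 : ∀ a b c : E, w.val y ![a, b, c] = - w.val y ![a, c, b] := by
    intro a b c
    have h := (w.val y).toAlternatingMap.map_swap ![a, c, b] (i := 1) (j := 2) (by decide)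
    have h' : (![a, c, b] ∘ Equiv.swap (1 : Fin 3) 2) = ![a, b, c] := by
      ext i; fin_cases i <;> rfl
    rw [h'] at h
    exact h
  rw [e1, e3, e4, e4, e4, e2 u (fderiv ℝ (X.inChart y) (extChartAt 𝓘(ℝ, E) y y) v) t,
    e5 u v (fderiv ℝ (X.inChart y) (extChartAt 𝓘(ℝ, E) y y) t),
    e2 u (fderiv ℝ (X.inChart y) (extChartAt 𝓘(ℝ, E) y y) t) v]
  ring

end Flow

/-! ### Pullbacks of moving forms along a flow -/

section FlowDeriv

variable {E : Type*} [NormedAddCommGroup E] [NormedSpace ℝ E]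
  {M : Type*} [TopologicalSpace M] [ChartedSpace E M]

/-- A smooth family of maps `f_t` with `d/dt f_t = X_t ∘ f_t`. -/
structure IsFlow (f : ℝ → M → M) (X : ℝ → VField E M) : Prop where
  smooth : ContMDiff (𝓘(ℝ, ℝ).prod 𝓘(ℝ, E)) 𝓘(ℝ, E) ∞ (fun p : ℝ × M => f p.1 p.2)
  deriv : ∀ (t : ℝ) (x : M), HasMFDerivAt 𝓘(ℝ, ℝ) 𝓘(ℝ, E) (fun s : ℝ => f s x) t
    ((1 : ℝ →L[ℝ] ℝ).smulRight (X t (f t x)))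

/-- `w'` is the time derivative at `t` of the family of forms `w_s`. -/
def DForm.HasTimeDerivAt {n : ℕ} (w : ℝ → DForm E M n) (w' : DForm E M n) (t : ℝ) : Prop :=
  ∀ (x : M) (m : Fin n → E), HasDerivAt (fun s => (w s).val x m) (w'.val x m) t

variable [IsManifold 𝓘(ℝ, E) ∞ M] {f : ℝ → M → M} {X : ℝ → VField E M}

lemma IsFlow.contMDiff (hf : IsFlow f X) (t : ℝ) : ContMDiff 𝓘(ℝ, E) 𝓘(ℝ, E) ∞ (f t) :=
  hf.smooth.comp (contMDiff_const.prodMk contMDiff_id)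

lemma IsFlow.eventually_mem_source (hf : IsFlow f X) {t : ℝ} {c' x : M}
    (hx : f t x ∈ (extChartAt 𝓘(ℝ, E) c').source) :
    ∀ᶠ s in nhds t, f s x ∈ (extChartAt 𝓘(ℝ, E) c').source := by
  have h : Continuous (fun s : ℝ => f s x) :=
    hf.smooth.continuous.comp (continuous_id.prodMk continuous_const)
  exact h.continuousAt.preimage_mem_nhds ((isOpen_extChartAt_source c').mem_nhds hx)

/-- The flow equation read in charts. -/
lemma IsFlow.hasDerivAt_mapInChart (hf : IsFlow f X) {t : ℝ} {c c' : M} {e : E}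
    (he' : f t ((extChartAt 𝓘(ℝ, E) c).symm e) ∈ (extChartAt 𝓘(ℝ, E) c').source) :
    HasDerivAt (fun s => mapInChart (f s) c c' e) ((X t).inChart c' (mapInChart (f t) c c' e)) t := by
  have h1 := (contMDiffAt_extChartAt' (I := 𝓘(ℝ, E)) (n := ∞)
    (by rwa [extChartAt_source] at he')).mdifferentiableAt (by simp) |>.hasMFDerivAt
  have h2 := hf.deriv t ((extChartAt 𝓘(ℝ, E) c).symm e)
  have h3 : HasMFDerivAt 𝓘(ℝ, ℝ) 𝓘(ℝ, E) (fun s => mapInChart (f s) c c' e) t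
      ((dchart E c' (f t ((extChartAt 𝓘(ℝ, E) c).symm e))).comp
        ((1 : ℝ →L[ℝ] ℝ).smulRight ((X t).val (f t ((extChartAt 𝓘(ℝ, E) c).symm e)))) :
          ℝ →L[ℝ] E) :=
    HasMFDerivAt.comp t h1 h2
  have h4 : HasFDerivAt (fun s => mapInChart (f s) c c' e)
      ((dchart E c' (f t ((extChartAt 𝓘(ℝ, E) c).symm e))).comp
        ((1 : ℝ →L[ℝ] ℝ).smulRight ((X t).val (f t ((extChartAt 𝓘(ℝ, E) c).symm e)))) :
          ℝ →L[ℝ] E) t := by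
    exact hasMFDerivAt_iff_hasFDerivAt.1 h3
  refine h4.hasDerivAt.congr_deriv ?_
  rw [mapInChart, VField.inChart_extChartAt _ he']
  simp

lemma IsFlow.contDiffAt_mapInChart (hf : IsFlow f X) (t : ℝ) {c c' : M} {e : E}
    (he : e ∈ (extChartAt 𝓘(ℝ, E) c).target)
    (he' : f t ((extChartAt 𝓘(ℝ, E) c).symm e) ∈ (extChartAt 𝓘(ℝ, E) c').source) :
    ContDiffAt ℝ ∞ (fun p : ℝ × E => mapInChart (f p.1) c c' p.2) (t, e) :=
  contDiffAt_mapInChart_family hf.smooth t he he'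

/-- The variational equation: the time derivative of the differential of the flow. -/
lemma IsFlow.hasDerivAt_fderiv_mapInChart (hf : IsFlow f X) {t : ℝ} (hX : (X t).Smooth)
    {c c' : M} {e : E} (he : e ∈ (extChartAt 𝓘(ℝ, E) c).target)
    (he' : f t ((extChartAt 𝓘(ℝ, E) c).symm e) ∈ (extChartAt 𝓘(ℝ, E) c').source) :
    HasDerivAt (fun s => fderiv ℝ (mapInChart (f s) c c') e)
      (fderiv ℝ ((X t).inChart c') (mapInChart (f t) c c' e) ∘L
        fderiv ℝ (mapInChart (f t) c c') e) t := by
  have h1 := hasDerivAt_fderiv_of_contDiffAt (hf.contDiffAt_mapInChart t he he')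
  have h2 : (fun e => _root_.deriv (fun s => mapInChart (f s) c c' e) t) =ᶠ[nhds e]
      (X t).inChart c' ∘ mapInChart (f t) c c' := by
    filter_upwards [eventually_mem_charts (hf.contMDiff t) he he'] with e he
    exact (hf.hasDerivAt_mapInChart he.2).deriv
  refine h1.congr_deriv ?_
  refine h2.fderiv_eq.trans ?_
  exact fderiv_comp e ((hX.contDiffAt_inChart
    ((extChartAt 𝓘(ℝ, E) c').map_source he')).differentiableAt (by simp))
    ((GenGeom.contDiffAt_mapInChart (hf.contMDiff t) he he').differentiableAt (by simp))

/-- The derivative of the value of a form on each tuple of vectors determines the derivative of the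
form itself, since the family is known to be smooth. -/
lemma DForm.HasTimeDerivAt.deriv_inChart {n : ℕ} {w : ℝ → DForm E M n} {w' : DForm E M n} {t : ℝ}
    (hw : DForm.SmoothFamily w) (hw' : DForm.HasTimeDerivAt w w' t) {c : M} {e : E}
    (he : e ∈ (extChartAt 𝓘(ℝ, E) c).target) :
    HasDerivAt (fun s => (w s).inChart c e) (w'.inChart c e) t := by
  have h1 : DifferentiableAt ℝ (fun s => (w s).inChart c e) t :=
    ((hw.contDiffAt_inChart t he).comp t (contDiffAt_id.prodMk contDiffAt_const)).differentiableAt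
      (by simp)
  refine h1.hasDerivAt.congr_deriv ?_
  refine ContinuousAlternatingMap.ext fun m => ?_
  have h2 := (ContinuousAlternatingMap.apply ℝ E ℝ m).hasFDerivAt.comp_hasDerivAt t h1.hasDerivAt
  exact h2.unique (hw' ((extChartAt 𝓘(ℝ, E) c).symm e) (fun i => dchartSymm c e (m i)))

/-- The exterior derivative commutes with time derivatives. -/
lemma DForm.HasTimeDerivAt.d {n : ℕ} {w : ℝ → DForm E M n} {w' : DForm E M n} {t : ℝ}
    (hw : DForm.SmoothFamily w) (hw' : DForm.HasTimeDerivAt w w' t) :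
    DForm.HasTimeDerivAt (fun s => (w s).d) w'.d t := by
  intro x m
  have hz := mem_extChartAt_target (I := 𝓘(ℝ, E)) x
  have h1 := hasDerivAt_fderiv_of_contDiffAt (hw.contDiffAt_inChart t hz)
  have h2 : (fun e => deriv (fun s => (w s).inChart x e) t) =ᶠ[nhds (extChartAt 𝓘(ℝ, E) x x)]
      w'.inChart x := by
    filter_upwards [extChartAt_target_mem_nhds (I := 𝓘(ℝ, E)) x] with e he
    exact (hw'.deriv_inChart hw he).deriv
  have h3 := h1.congr_deriv h2.fderiv_eq
  have h4 := (ContinuousAlternatingMap.alternatizeUncurryFinCLM ℝ E ℝ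
    (n := n)).hasFDerivAt.comp_hasDerivAt t h3
  have h5 := (ContinuousAlternatingMap.apply ℝ E ℝ m).hasFDerivAt.comp_hasDerivAt t h4
  have e1 : ∀ v : DForm E M n, v.d.val x m = extDeriv (v.inChart x) (extChartAt 𝓘(ℝ, E) x x) m :=
    fun v => congrArg (fun a : E [⋀^Fin (n + 1)]→L[ℝ] ℝ => a m) (v.d_eq x)
  simp only [e1]
  exact h5

/-- The time derivative of a moving form along a trajectory of the flow. -/
lemma IsFlow.hasDerivAt_inChart (hf : IsFlow f X) {n : ℕ} {w : ℝ → DForm E M n}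
    {w' : DForm E M n} {t : ℝ} (hw : DForm.SmoothFamily w) (hw' : DForm.HasTimeDerivAt w w' t)
    {c c' : M} {e : E}
    (he' : f t ((extChartAt 𝓘(ℝ, E) c).symm e) ∈ (extChartAt 𝓘(ℝ, E) c').source) :
    HasDerivAt (fun s => (w s).inChart c' (mapInChart (f s) c c' e))
      (w'.inChart c' (mapInChart (f t) c c' e) + fderiv ℝ ((w t).inChart c')
        (mapInChart (f t) c c' e) ((X t).inChart c' (mapInChart (f t) c c' e))) t := by
  have ht : mapInChart (f t) c c' e ∈ (extChartAt 𝓘(ℝ, E) c').target :=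
    (extChartAt 𝓘(ℝ, E) c').map_source he'
  set y := mapInChart (f t) c c' e with hy
  have hW := (hw.contDiffAt_inChart t ht).differentiableAt (by simp)
  have h1 := HasFDerivAt.comp_hasDerivAt t (l := fun p : ℝ × E => (w p.1).inChart c' p.2)
    (f := fun s => (s, mapInChart (f s) c c' e)) hW.hasFDerivAt
    ((hasDerivAt_id t).prodMk (hf.hasDerivAt_mapInChart he'))
  have h2 := HasFDerivAt.comp_hasDerivAt t (l := fun p : ℝ × E => (w p.1).inChart c' p.2)
    (f := fun s => (s, y)) hW.hasFDerivAt ((hasDerivAt_id t).prodMk (hasDerivAt_const t y))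
  have h3 := HasFDerivAt.comp y (g := fun p : ℝ × E => (w p.1).inChart c' p.2)
    (f := fun e => (t, e)) hW.hasFDerivAt (hasFDerivAt_prodMk_right t y)
  refine h1.congr_deriv ?_
  have e1 : fderiv ℝ (fun p : ℝ × E => (w p.1).inChart c' p.2) (t, y) ((1 : ℝ), (0 : E)) =
      w'.inChart c' y := h2.unique (hw'.deriv_inChart hw ht)
  have e2 : fderiv ℝ ((w t).inChart c') y = _ := h3.fderiv
  rw [← e1, e2, ContinuousLinearMap.comp_apply, ← map_add]
  simp
  rfl

/-- The pullback of a form along the flow is computed in fixed charts at `x` and `f_t x` for times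
close to `t`. -/
lemma IsFlow.pullback_val (hf : IsFlow f X) {n : ℕ} (w : ℝ → DForm E M n) (t : ℝ) (x : M) :
    ∀ᶠ s in nhds t, ((w s).pullback (f s)).val x =
      ((w s).inChart (f t x) (mapInChart (f s) x (f t x)
        (extChartAt 𝓘(ℝ, E) x x))).compContinuousLinearMap
          (fderiv ℝ (mapInChart (f s) x (f t x)) (extChartAt 𝓘(ℝ, E) x x)) := by
  filter_upwards [hf.eventually_mem_source (mem_extChartAt_source (I := 𝓘(ℝ, E)) (f t x))] with s hs
  rw [← DForm.inChart_pullback (w s) (hf.contMDiff s) (mem_extChartAt_target x)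
    (by rwa [extChartAt_to_inv])]
  exact (DForm.inChart_self _ x).symm

lemma mapInChart_self (g : M → M) (x : M) :
    mapInChart g x (g x) (extChartAt 𝓘(ℝ, E) x x) = extChartAt 𝓘(ℝ, E) (g x) (g x) := by
  rw [mapInChart, extChartAt_to_inv]

/-- The time derivative of the pullback of a moving `2`-form along a flow. -/
lemma IsFlow.hasDerivAt_pullback_two (hf : IsFlow f X) {w : ℝ → DForm E M 2} {w' : DForm E M 2}
    {t : ℝ} (hX : (X t).Smooth) (hw : DForm.SmoothFamily w) (hwt : (w t).Smooth)
    (hw' : DForm.HasTimeDerivAt w w' t) (x : M) (u v : E) :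
    HasDerivAt (fun s => ((w s).pullback (f s)).val x ![u, v])
      (w'.val (f t x) ![dmap E (f t) x u, dmap E (f t) x v] +
        ((DForm.interiorTwo (X t) (w t)).toDForm.d.val (f t x)
          ![dmap E (f t) x u, dmap E (f t) x v] +
        (w t).d.val (f t x) ![(X t).val (f t x), dmap E (f t) x u, dmap E (f t) x v])) t := by
  have hz := mem_extChartAt_target (I := 𝓘(ℝ, E)) x
  have hs : f t ((extChartAt 𝓘(ℝ, E) x).symm (extChartAt 𝓘(ℝ, E) x x)) ∈
      (extChartAt 𝓘(ℝ, E) (f t x)).source := by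
    rw [extChartAt_to_inv]; exact mem_extChartAt_source _
  have h1 := hasDerivAt_compCLM_two (hf.hasDerivAt_inChart hw hw' hs)
    (hf.hasDerivAt_fderiv_mapInChart hX hz hs) u v
  have e0 : (w t).inChart (f t x) (extChartAt 𝓘(ℝ, E) (f t x) (f t x)) = (w t).val (f t x) :=
    (w t).inChart_self _
  have e1 : w'.inChart (f t x) (extChartAt 𝓘(ℝ, E) (f t x) (f t x)) = w'.val (f t x) :=
    w'.inChart_self _
  rw [mapInChart_self, fderiv_mapInChart_self (hf.contMDiff t), e0, e1, VField.inChart_self] at h1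
  rw [cartan_two hwt hX]
  refine (h1.congr_of_eventuallyEq ?_).congr_deriv ?_
  · filter_upwards [hf.pullback_val w t x] with s hs
    rw [hs]
  · simp only [ContinuousAlternatingMap.add_apply, ContinuousLinearMap.comp_apply]
    ring

/-- The time derivative of the pullback of a `3`-form along a flow. -/
lemma IsFlow.hasDerivAt_pullback_three (hf : IsFlow f X) {w : DForm E M 3}
    {t : ℝ} (hX : (X t).Smooth) (hw : w.Smooth) (x : M) (u v r : E) :
    HasDerivAt (fun s => (w.pullback (f s)).val x ![u, v, r])
      ((DForm.interior (X t) w).d.val (f t x)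
          ![dmap E (f t) x u, dmap E (f t) x v, dmap E (f t) x r] +
        w.d.val (f t x)
          ![(X t).val (f t x), dmap E (f t) x u, dmap E (f t) x v, dmap E (f t) x r]) t := by
  have hz := mem_extChartAt_target (I := 𝓘(ℝ, E)) x
  have hs : f t ((extChartAt 𝓘(ℝ, E) x).symm (extChartAt 𝓘(ℝ, E) x x)) ∈
      (extChartAt 𝓘(ℝ, E) (f t x)).source := by
    rw [extChartAt_to_inv]; exact mem_extChartAt_source _
  have hw' : DForm.HasTimeDerivAt (fun _ => w) 0 t := fun x m => hasDerivAt_const t _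
  have h1 := hasDerivAt_compCLM_three (hf.hasDerivAt_inChart hw.smoothFamily hw' hs)
    (hf.hasDerivAt_fderiv_mapInChart hX hz hs) u v r
  have e0 : w.inChart (f t x) (extChartAt 𝓘(ℝ, E) (f t x) (f t x)) = w.val (f t x) :=
    w.inChart_self _
  have e1 : (0 : DForm E M 3).inChart (f t x) (extChartAt 𝓘(ℝ, E) (f t x) (f t x)) = 0 :=
    (0 : DForm E M 3).inChart_self _
  rw [mapInChart_self, fderiv_mapInChart_self (hf.contMDiff t), e0, e1, VField.inChart_self,
    zero_add] at h1
  rw [cartan_three hw hX]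
  refine (h1.congr_of_eventuallyEq ?_).congr_deriv ?_
  · filter_upwards [hf.pullback_val (fun _ => w) t x] with s hs
    rw [hs]
  · simp only [ContinuousLinearMap.comp_apply]

end FlowDeriv

/-! ### The twisting form along a path of generalized symmetries -/

section Twist

variable {E : Type*} [NormedAddCommGroup E] [NormedSpace ℝ E]
  {M : Type*} [TopologicalSpace M] [ChartedSpace E M] [IsManifold 𝓘(ℝ, E) ∞ M]

lemma GenSym.IsGeneratedBy.isFlow {g : ℝ → GenSym E M} {a : ℝ → VField E M × DForm E M 2}
    (hg : GenSym.IsGeneratedBy g a) : IsFlow (fun t => (g t).diffeo) (fun t => (a t).1) :=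
  ⟨hg.smooth_diffeo, hg.deriv_diffeo⟩

lemma GenSym.IsGeneratedBy.hasTimeDerivAt {g : ℝ → GenSym E M}
    {a : ℝ → VField E M × DForm E M 2} (hg : GenSym.IsGeneratedBy g a) (t : ℝ) :
    DForm.HasTimeDerivAt (fun s => (g s).bField) ((a t).2.pullback (g t).diffeo) t := by
  intro x m
  have hm : m = ![m 0, m 1] := by ext i; fin_cases i <;> rfl
  rw [hm]
  exact hg.deriv_bField t x (m 0) (m 1)

lemma GenSym.IsGeneratedBy.bField_zero {g : ℝ → GenSym E M}
    {a : ℝ → VField E M × DForm E M 2} (hg : GenSym.IsGeneratedBy g a) : (g 0).bField = 0 := by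
  rw [hg.start]; rfl

lemma GenSym.IsGeneratedBy.diffeo_zero {g : ℝ → GenSym E M}
    {a : ℝ → VField E M × DForm E M 2} (hg : GenSym.IsGeneratedBy g a) :
    ((g 0).diffeo : M → M) = id := by
  rw [hg.start]; rfl

lemma DForm.d_zero {n : ℕ} : (0 : DForm E M n).d = 0 := by
  have h := DForm.d_sub (DForm.smooth_zero (E := E) (M := M) n) (DForm.smooth_zero n)
  rwa [sub_self, sub_self] at h

/-- If `A_t + ι_{X_t} H` is closed for all `t`, then `λ_t^* H + d α_t = H` along a path
generated by `(X_t, A_t)`: by Cartan's formula and `dH = 0`, the left side has time derivative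
`λ_t^* d(ι_{X_t} H + A_t) = 0`. -/
lemma GenSym.IsGeneratedBy.pullback_add_d {g : ℝ → GenSym E M}
    {a : ℝ → VField E M × DForm E M 2} (hg : GenSym.IsGeneratedBy g a) {H : DForm E M 3}
    (hH : H.Smooth) (hdH : H.d = 0) (hX : ∀ t, VField.Smooth (a t).1)
    (hA : ∀ t, (a t).2.Smooth) (hd : ∀ t, (a t).2.d = -(DForm.interior (a t).1 H).d) (t : ℝ) :
    H.pullback (g t).diffeo + (g t).bField.d = H := by
  have key : ∀ (x : M) (u v w : E) (t : ℝ), HasDerivAt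
      (fun s => (H.pullback (g s).diffeo).val x ![u, v, w] + (g s).bField.d.val x ![u, v, w])
      0 t := by
    intro x u v w t
    have h1 := hg.isFlow.hasDerivAt_pullback_three (hX t) hH x u v w
    have h2 := (hg.hasTimeDerivAt t).d hg.smooth_bField x ![u, v, w]
    refine (h1.add h2).congr_deriv ?_
    rw [DForm.d_pullback (hA t) (g t).diffeo.contMDiff, hd, hdH]
    have h3 : ((-(DForm.interior (a t).1 H).d).pullback (g t).diffeo).val x ![u, v, w] =
        -((DForm.interior (a t).1 H).d.val ((g t).diffeo x)
          ![dmap E (g t).diffeo x u, dmap E (g t).diffeo x v, dmap E (g t).diffeo x w]) :=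
      congrArg Neg.neg (compCLM_three ((DForm.interior (a t).1 H).d.val ((g t).diffeo x))
        (dmap E (g t).diffeo x) u v w)
    rw [h3]
    have h4 : ∀ m : Fin 4 → E, (0 : DForm E M 4).val ((g t).diffeo x) m = 0 := fun _ => rfl
    rw [h4]
    ring
  funext x
  refine ContinuousAlternatingMap.ext (M := E) fun m => ?_
  have hm : m = ![m 0, m 1, m 2] := by ext i; fin_cases i <;> rfl
  rw [hm]
  have h1 := is_const_of_deriv_eq_zero
    (fun t => (key x (m 0) (m 1) (m 2) t).differentiableAt)
    (fun t => (key x (m 0) (m 1) (m 2) t).deriv) t 0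
  refine h1.trans ?_
  have h2 : H.pullback (g 0).diffeo + (g 0).bField.d = H := by
    rw [hg.bField_zero, hg.diffeo_zero, DForm.pullback_id, DForm.d_zero, add_zero]
  exact congrArg (fun w : DForm E M 3 => w.val x ![m 0, m 1, m 2]) h2

/-! ### The Hamiltonian infinitesimal symmetries -/

variable {H : DForm E M 3} {J : GenAlmostComplex E M}

lemma hamInfinitesimal_fst (H : DForm E M 3) (J : GenAlmostComplex E M) (f : M → ℝ) :
    (hamInfinitesimal H J f).1 = (J.hamField f).vec := rfl

lemma hamInfinitesimal_snd (H : DForm E M 3) (J : GenAlmostComplex E M) (f : M → ℝ) :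
    (hamInfinitesimal H J f).2 =
      (J.hamField f).cov.toDForm.d - DForm.interior (J.hamField f).vec H := rfl

lemma hamInfinitesimal_fst_smooth {f : M → ℝ} (hf : ContMDiff 𝓘(ℝ, E) 𝓘(ℝ, ℝ) ∞ f) :
    VField.Smooth (hamInfinitesimal H J f).1 :=
  (J.hamField_smooth hf).1

lemma hamInfinitesimal_snd_smooth (hH : H.Smooth) {f : M → ℝ}
    (hf : ContMDiff 𝓘(ℝ, E) 𝓘(ℝ, ℝ) ∞ f) : (hamInfinitesimal H J f).2.Smooth :=
  (CoField.Smooth.toDForm (J.hamField_smooth hf).2).d.sub (hH.interior (J.hamField_smooth hf).1)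

/-- The form part `dξ_f - ι_{X_f} H` plus `ι_{X_f} H` is closed. -/
lemma d_hamInfinitesimal_snd (hH : H.Smooth) {f : M → ℝ} (hf : ContMDiff 𝓘(ℝ, E) 𝓘(ℝ, ℝ) ∞ f) :
    (hamInfinitesimal H J f).2.d = -(DForm.interior (hamInfinitesimal H J f).1 H).d := by
  have h1 : (J.hamField f).cov.Smooth := (J.hamField_smooth hf).2
  have h2 : (J.hamField f).vec.Smooth := (J.hamField_smooth hf).1
  rw [hamInfinitesimal_snd, hamInfinitesimal_fst,
    DForm.d_sub h1.toDForm.d (hH.interior h2), DForm.d_d h1.toDForm, zero_sub]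

lemma contMDiff_of_family {F : ℝ → M → ℝ}
    (hF : ContMDiff (𝓘(ℝ, ℝ).prod 𝓘(ℝ, E)) 𝓘(ℝ, ℝ) ∞ (fun p : ℝ × M => F p.1 p.2)) (t : ℝ) :
    ContMDiff 𝓘(ℝ, E) 𝓘(ℝ, ℝ) ∞ (F t) :=
  hF.comp (contMDiff_const.prodMk contMDiff_id)

/-- The twisting identity `λ_t^* H + dα_t = H` along a Hamiltonian path. -/
lemma IsHamPath.pullback_add_d {F : ℝ → M → ℝ} {g : ℝ → GenSym E M} (hg : IsHamPath H J F g)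
    (hH : H.Smooth) (hdH : H.d = 0) (t : ℝ) : H.pullback (g t).diffeo + (g t).bField.d = H :=
  hg.2.pullback_add_d hH hdH (fun t => hamInfinitesimal_fst_smooth (contMDiff_of_family hg.1 t))
    (fun t => hamInfinitesimal_snd_smooth hH (contMDiff_of_family hg.1 t))
    (fun t => d_hamInfinitesimal_snd hH (contMDiff_of_family hg.1 t)) t

end Twist

/-! ### Symmetries preserving the twisted Courant bracket -/

section Bracket

variable {E : Type*} [NormedAddCommGroup E] [NormedSpace ℝ E]
  {M : Type*} [TopologicalSpace M] [ChartedSpace E M]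

/-- The derivative of a push-forward of vector fields of the model space. -/
lemma fderiv_pushforward {ℓ X X' : E → E} {z : E} (hℓ : ContDiffAt ℝ ∞ ℓ z)
    (hX : DifferentiableAt ℝ X z) (hX' : DifferentiableAt ℝ X' (ℓ z))
    (h : ∀ᶠ e in nhds z, X' (ℓ e) = fderiv ℝ ℓ e (X e)) (w : E) :
    fderiv ℝ X' (ℓ z) (fderiv ℝ ℓ z w) =
      fderiv ℝ (fderiv ℝ ℓ) z w (X z) + fderiv ℝ ℓ z (fderiv ℝ X z w) := by
  have h1 := (hX'.hasFDerivAt.comp z (hℓ.differentiableAt (by simp)).hasFDerivAt).fderiv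
  have h2 := (((hℓ.fderiv_right (m := ∞) (by simp)).differentiableAt
    (by simp)).hasFDerivAt.clm_apply hX.hasFDerivAt).fderiv
  have h3 : X' ∘ ℓ =ᶠ[nhds z] fun e => fderiv ℝ ℓ e (X e) := h
  have h4 := congrArg (fun L : E →L[ℝ] E => L w) (h1.symm.trans (h3.fderiv_eq.trans h2))
  refine h4.trans ?_
  exact add_comm _ _

/-- The derivative of a push-forward of covector fields of the model space, twisted by a
`2`-form. -/
lemma fderiv_pushforward_cov {ℓ X : E → E} {ξ ξ' : E → E →L[ℝ] ℝ} {α : E → E [⋀^Fin 2]→L[ℝ] ℝ}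
    {z : E} (hℓ : ContDiffAt ℝ ∞ ℓ z) (hX : DifferentiableAt ℝ X z)
    (hξ : DifferentiableAt ℝ ξ z) (hα : DifferentiableAt ℝ α z)
    (hξ' : DifferentiableAt ℝ ξ' (ℓ z))
    (h : ∀ᶠ e in nhds z, ∀ v, ξ' (ℓ e) (fderiv ℝ ℓ e v) = ξ e v + α e ![X e, v]) (w v : E) :
    fderiv ℝ ξ' (ℓ z) (fderiv ℝ ℓ z w) (fderiv ℝ ℓ z v) + ξ' (ℓ z) (fderiv ℝ (fderiv ℝ ℓ) z w v) =
      fderiv ℝ ξ z w v + (fderiv ℝ α z w ![X z, v] + α z ![fderiv ℝ X z w, v]) := by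
  have h0 := ((hℓ.fderiv_right (m := ∞) (by simp)).differentiableAt (by simp)).hasFDerivAt
  have h1 := ((hξ'.hasFDerivAt.comp z (hℓ.differentiableAt (by simp)).hasFDerivAt).clm_apply
    (h0.clm_apply (hasFDerivAt_const v z))).fderiv
  obtain ⟨h5, h6⟩ := fderiv_curryLeft hα hX w
  have h7 := ((ContinuousAlternatingMap.apply ℝ E ℝ ![v]).hasFDerivAt.comp z h5.hasFDerivAt)
  have h2 := ((hξ.hasFDerivAt.clm_apply (hasFDerivAt_const v z)).add h7).fderiv
  have h3 : (fun e => (ξ' ∘ ℓ) e (fderiv ℝ ℓ e v)) =ᶠ[nhds z]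
      fun e => ξ e v + ContinuousAlternatingMap.curryLeft (α e) (X e) ![v] := by
    filter_upwards [h] with e he
    exact he v
  have h4 := congrArg (fun L : E →L[ℝ] ℝ => L w) (h1.symm.trans (h3.fderiv_eq.trans h2))
  have h8 : fderiv ℝ (fun e => ContinuousAlternatingMap.curryLeft (α e) (X e)) z w ![v] =
      fderiv ℝ α z w ![X z, v] + α z ![fderiv ℝ X z w, v] := by
    rw [h6]; rfl
  rw [← h8]
  simp at h4
  rw [add_comm] at h4
  exact h4

variable [IsManifold 𝓘(ℝ, E) ∞ M]

lemma dmap_symm_dmap (f : M ≃ₘ^∞⟮𝓘(ℝ, E), 𝓘(ℝ, E)⟯ M) (x : M) :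
    dmap E f.symm (f x) ∘L dmap E f x = ContinuousLinearMap.id ℝ E :=
  mfderiv_comp_eq_id f.symm.contMDiff f.contMDiff f.symm_apply_apply x

lemma dmap_dmap_symm (f : M ≃ₘ^∞⟮𝓘(ℝ, E), 𝓘(ℝ, E)⟯ M) (x : M) :
    dmap E f x ∘L dmap E f.symm (f x) = ContinuousLinearMap.id ℝ E := by
  have h := mfderiv_comp_eq_id (E := E) f.contMDiff f.symm.contMDiff f.apply_symm_apply (f x)
  have h1 : ∀ q, q = x → dmap E f q ∘L dmap E f.symm (f x) = ContinuousLinearMap.id ℝ E →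
      dmap E f x ∘L dmap E f.symm (f x) = ContinuousLinearMap.id ℝ E := by
    rintro q rfl h; exact h
  exact h1 _ (f.symm_apply_apply x) h

/-- The action of `(λ, α)` from the fibre at `x` to the fibre at `λ x`, in a fixed vector
space. -/
def GenSym.actAt (g : GenSym E M) (x : M) (u : E × (E →L[ℝ] ℝ)) : E × (E →L[ℝ] ℝ) :=
  (dmap E g.diffeo x u.1,
    (u.2 + (g.bField.val x).toContinuousLinearMap ![u.1, 0] 1).comp
      (dmap E g.diffeo.symm (g.diffeo x)))

lemma GenSym.actAt_snd_apply (g : GenSym E M) (x : M) (u : E × (E →L[ℝ] ℝ)) (v : E) :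
    (g.actAt x u).2 (dmap E g.diffeo x v) = u.2 v + g.bField.val x ![u.1, v] := by
  have h : dmap E g.diffeo.symm (g.diffeo x) (dmap E g.diffeo x v) = v :=
    congrArg (fun L : E →L[ℝ] E => L v) (dmap_symm_dmap g.diffeo x)
  rw [GenSym.actAt, ContinuousLinearMap.comp_apply, h, add_apply, iotaE_apply]

lemma GenSym.act_eq_actAt (g : GenSym E M) (x : M) (u : E × (E →L[ℝ] ℝ)) :
    g.act (g.diffeo x) (u : GTan E (g.diffeo.symm (g.diffeo x))) = g.actAt x u := by
  have h0 : g.bField.val (g.diffeo.symm (g.diffeo x)) = g.bField.val x := by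
    rw [g.diffeo.symm_apply_apply]
  have h1 : (dmap E g.diffeo.symm (g.diffeo x)).inverse u.1 = dmap E g.diffeo x u.1 :=
    ((isInvertible_mfderiv_symm g.diffeo (g.diffeo x)).inverse_apply_eq).2
      (congrArg (fun L : E →L[ℝ] E => L u.1) (dmap_symm_dmap g.diffeo x)).symm
  refine Prod.ext h1 ?_
  exact congrArg (fun a : E [⋀^Fin 2]→L[ℝ] ℝ => (u.2 + a.toContinuousLinearMap ![u.1, 0] 1).comp
    (dmap E g.diffeo.symm (g.diffeo x))) h0

lemma GenSym.push_val (g : GenSym E M) (A : GField E M) (x : M) :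
    (g.push A).val (g.diffeo x) = g.actAt x (A.val x) := by
  have h0 : A.val (g.diffeo.symm (g.diffeo x)) = A.val x := by rw [g.diffeo.symm_apply_apply]
  have h1 := g.act_eq_actAt x (A.val (g.diffeo.symm (g.diffeo x)))
  rw [h0] at h1
  refine Eq.trans ?_ h1
  exact congrArg (fun u => g.act (g.diffeo x) u) h0

lemma CoField.inChart_extChartAt (ξ : CoField E M) {c x : M}
    (hx : x ∈ (extChartAt 𝓘(ℝ, E) c).source) :
    ξ.inChart c (extChartAt 𝓘(ℝ, E) c x) =
      (ξ.val x).comp (dchartSymm c (extChartAt 𝓘(ℝ, E) c x)) := by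
  have h1 : ∀ q : M, q = x → (ξ.val q).comp (dchartSymm c (extChartAt 𝓘(ℝ, E) c x)) =
      (ξ.val x).comp (dchartSymm c (extChartAt 𝓘(ℝ, E) c x)) := by
    rintro q rfl; rfl
  exact h1 _ ((extChartAt 𝓘(ℝ, E) c).left_inv hx)

/-- In charts, the vector part of `(λ, α) ∘ A` is the push-forward of the vector part of `A`. -/
lemma GenSym.inChart_push_vec (g : GenSym E M) (A : GField E M) {c c' : M} {e : E}
    (he : e ∈ (extChartAt 𝓘(ℝ, E) c).target)
    (he' : g.diffeo ((extChartAt 𝓘(ℝ, E) c).symm e) ∈ (extChartAt 𝓘(ℝ, E) c').source) :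
    (g.push A).vec.inChart c' (mapInChart g.diffeo c c' e) =
      fderiv ℝ (mapInChart g.diffeo c c') e (A.vec.inChart c e) := by
  have h1 : (g.push A).vec.val (g.diffeo ((extChartAt 𝓘(ℝ, E) c).symm e)) =
      dmap E g.diffeo ((extChartAt 𝓘(ℝ, E) c).symm e)
        (A.vec.val ((extChartAt 𝓘(ℝ, E) c).symm e)) :=
    congrArg Prod.fst (g.push_val A ((extChartAt 𝓘(ℝ, E) c).symm e))
  rw [fderiv_mapInChart g.diffeo.contMDiff he he', mapInChart, VField.inChart_extChartAt _ he', h1]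
  exact congrArg (fun v => dchart E c' (g.diffeo ((extChartAt 𝓘(ℝ, E) c).symm e))
    (dmap E g.diffeo ((extChartAt 𝓘(ℝ, E) c).symm e) v)) (dchartSymm_dchart he _).symm

/-- In charts, pulling the covector part of `(λ, α) ∘ (X + ξ)` back along `λ` gives `ξ + ι_X α`. -/
lemma GenSym.inChart_push_cov (g : GenSym E M) (A : GField E M) {c c' : M} {e : E}
    (he : e ∈ (extChartAt 𝓘(ℝ, E) c).target)
    (he' : g.diffeo ((extChartAt 𝓘(ℝ, E) c).symm e) ∈ (extChartAt 𝓘(ℝ, E) c').source) (v : E) :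
    (g.push A).cov.inChart c' (mapInChart g.diffeo c c' e)
        (fderiv ℝ (mapInChart g.diffeo c c') e v) =
      A.cov.inChart c e v + g.bField.inChart c e ![A.vec.inChart c e, v] := by
  set p := (extChartAt 𝓘(ℝ, E) c).symm e with hp
  have h1 : (g.push A).cov.val (g.diffeo p) (dmap E g.diffeo p (dchartSymm c e v)) =
      A.cov.val p (dchartSymm c e v) + g.bField.val p ![A.vec.val p, dchartSymm c e v] :=
    (congrArg (fun u : E × (E →L[ℝ] ℝ) => u.2 (dmap E g.diffeo p (dchartSymm c e v)))
      (g.push_val A p)).trans (g.actAt_snd_apply p (A.val p) _)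
  have h2 : g.bField.inChart c e ![A.vec.inChart c e, v] =
      g.bField.val p ![A.vec.val p, dchartSymm c e v] :=
    (compCLM_two (g.bField.val p) (dchartSymm c e) (A.vec.inChart c e) v).trans
      (congrArg (fun y => g.bField.val p ![y, dchartSymm c e v]) (dchartSymm_dchart he _))
  rw [h2, fderiv_mapInChart g.diffeo.contMDiff he he', mapInChart, CoField.inChart_extChartAt _ he']
  refine Eq.trans ?_ h1
  exact congrArg ((g.push A).cov.val (g.diffeo p)) (dchartSymm_dchart' he' _)

lemma DForm.Smooth.d_apply_two {w : DForm E M 2} (hw : w.Smooth) (x : M) (a b c : E) :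
    w.d.val x ![a, b, c] =
      fderiv ℝ (w.inChart x) (extChartAt 𝓘(ℝ, E) x x) a ![b, c]
      - fderiv ℝ (w.inChart x) (extChartAt 𝓘(ℝ, E) x x) b ![a, c]
      + fderiv ℝ (w.inChart x) (extChartAt 𝓘(ℝ, E) x x) c ![a, b] :=
  (congrArg (fun a' : E [⋀^Fin 3]→L[ℝ] ℝ => a' ![a, b, c]) (w.d_eq x)).trans
    (extDeriv_two_apply ((hw.contDiffAt_inChart (mem_extChartAt_target x)).differentiableAt
      (by simp)) _ _ _)

/-- The derivative of `(λ, α) ∘ A` at the centre of a chart, in terms of that of `A`, the second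
derivative of `λ` in charts and the derivative of `α`. -/
lemma GenSym.fderiv_inChart_push (g : GenSym E M) [FiniteDimensional ℝ E] {A : GField E M}
    (hA : A.Smooth) (x : M) (w v : E) :
    fderiv ℝ ((g.push A).vec.inChart (g.diffeo x)) (extChartAt 𝓘(ℝ, E) (g.diffeo x) (g.diffeo x))
        (dmap E g.diffeo x w) =
      fderiv ℝ (fderiv ℝ (mapInChart g.diffeo x (g.diffeo x))) (extChartAt 𝓘(ℝ, E) x x) w
        (A.vec.val x) + dmap E g.diffeo x
          (fderiv ℝ (A.vec.inChart x) (extChartAt 𝓘(ℝ, E) x x) w) ∧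
    fderiv ℝ ((g.push A).cov.inChart (g.diffeo x)) (extChartAt 𝓘(ℝ, E) (g.diffeo x) (g.diffeo x))
        (dmap E g.diffeo x w) (dmap E g.diffeo x v) + (g.push A).cov.val (g.diffeo x)
          (fderiv ℝ (fderiv ℝ (mapInChart g.diffeo x (g.diffeo x))) (extChartAt 𝓘(ℝ, E) x x) w v) =
      fderiv ℝ (A.cov.inChart x) (extChartAt 𝓘(ℝ, E) x x) w v +
        (fderiv ℝ (g.bField.inChart x) (extChartAt 𝓘(ℝ, E) x x) w ![A.vec.val x, v] +
          g.bField.val x ![fderiv ℝ (A.vec.inChart x) (extChartAt 𝓘(ℝ, E) x x) w, v]) := by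
  have hz := mem_extChartAt_target (I := 𝓘(ℝ, E)) x
  have hs : g.diffeo ((extChartAt 𝓘(ℝ, E) x).symm (extChartAt 𝓘(ℝ, E) x x)) ∈
      (extChartAt 𝓘(ℝ, E) (g.diffeo x)).source := by
    rw [extChartAt_to_inv]; exact mem_extChartAt_source _
  have hg : ContMDiff 𝓘(ℝ, E) 𝓘(ℝ, E) ∞ (g.diffeo : M → M) := g.diffeo.contMDiff
  have hy := mem_extChartAt_target (I := 𝓘(ℝ, E)) (g.diffeo x)
  have hA1 : A.vec.Smooth := hA.1
  have hA2 : A.cov.Smooth := hA.2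
  have hP1 : (g.push A).vec.Smooth := (g.push_smooth hA).1
  have hP2 : (g.push A).cov.Smooth := (g.push_smooth hA).2
  have hl := contDiffAt_mapInChart hg hz hs
  have e1 := mapInChart_self (E := E) g.diffeo x
  have e2 := fderiv_mapInChart_self hg x
  have dX := (hA1.contDiffAt_inChart hz).differentiableAt (n := ∞) (by simp)
  have dξ := (hA2.contDiffAt_inChart hz).differentiableAt (n := ∞) (by simp)
  have dα := (g.smooth.contDiffAt_inChart hz).differentiableAt (n := ∞) (by simp)
  have dX' := (hP1.contDiffAt_inChart hy).differentiableAt (n := ∞) (by simp)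
  have dξ' := (hP2.contDiffAt_inChart hy).differentiableAt (n := ∞) (by simp)
  have e3 : g.bField.inChart x (extChartAt 𝓘(ℝ, E) x x) = g.bField.val x := g.bField.inChart_self x
  rw [← e1] at dX' dξ'
  have hev := eventually_mem_charts hg hz hs
  constructor
  · have h := fderiv_pushforward hl dX dX'
      (hev.mono fun e he => g.inChart_push_vec A he.1 he.2) w
    rwa [e1, e2, VField.inChart_self] at h
  · have h := fderiv_pushforward_cov hl dX dξ dα dξ'
      (hev.mono fun e he => g.inChart_push_cov A he.1 he.2) w v
    rwa [e1, e2, VField.inChart_self, CoField.inChart_self, e3] at h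

/-- A generalized symmetry `(λ, α)` with `λ^* H + dα = H` preserves the `H`-twisted Courant
bracket. -/
lemma GenSym.preservesBracket_of_pullback_add_d [FiniteDimensional ℝ E] {H : DForm E M 3}
    {g : GenSym E M} (h : H.pullback g.diffeo + g.bField.d = H) : g.PreservesBracket H := by
  intro A B hA hB
  funext y
  obtain ⟨x, rfl⟩ := g.diffeo.surjective y
  have hgA := g.push_smooth hA
  have hgB := g.push_smooth hB
  have hA1 : (g.push A).vec.val (g.diffeo x) = dmap E g.diffeo x (A.vec.val x) :=
    congrArg Prod.fst (g.push_val A x)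
  have hB1 : (g.push B).vec.val (g.diffeo x) = dmap E g.diffeo x (B.vec.val x) :=
    congrArg Prod.fst (g.push_val B x)
  have hA2 : ∀ v, (g.push A).cov.val (g.diffeo x) (dmap E g.diffeo x v) =
      A.cov.val x v + g.bField.val x ![A.vec.val x, v] := fun v =>
    (congrArg (fun u : E × (E →L[ℝ] ℝ) => u.2 (dmap E g.diffeo x v))
      (g.push_val A x)).trans (g.actAt_snd_apply x (A.val x) v)
  have hB2 : ∀ v, (g.push B).cov.val (g.diffeo x) (dmap E g.diffeo x v) =
      B.cov.val x v + g.bField.val x ![B.vec.val x, v] := fun v =>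
    (congrArg (fun u : E × (E →L[ℝ] ℝ) => u.2 (dmap E g.diffeo x v))
      (g.push_val B x)).trans (g.actAt_snd_apply x (B.val x) v)
  have dA := g.fderiv_inChart_push hA x
  have dB := g.fderiv_inChart_push hB x
  have hsymm : ∀ u v : E, fderiv ℝ (fderiv ℝ (mapInChart g.diffeo x (g.diffeo x)))
      (extChartAt 𝓘(ℝ, E) x x) u v = fderiv ℝ (fderiv ℝ (mapInChart g.diffeo x (g.diffeo x)))
      (extChartAt 𝓘(ℝ, E) x x) v u := by
    have hl := contDiffAt_mapInChart (E := E) (M := M) (c' := g.diffeo x) g.diffeo.contMDiff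
      (mem_extChartAt_target x)
      (by rw [extChartAt_to_inv]; exact mem_extChartAt_source _)
    exact fun u v => ((hl.of_le two_le_infty).isSymmSndFDerivAt (by simp)).eq u v
  have hH : ∀ u v w : E, H.val (g.diffeo x) ![dmap E g.diffeo x u, dmap E g.diffeo x v,
      dmap E g.diffeo x w] = H.val x ![u, v, w] - g.bField.d.val x ![u, v, w] := by
    intro u v w
    have h1 := congrArg (fun a : DForm E M 3 => a.val x ![u, v, w]) h
    have h2 := compCLM_three (H.val (g.diffeo x)) (dmap E g.diffeo x) u v w
    have h3 : (H.val (g.diffeo x)).compContinuousLinearMap (dmap E g.diffeo x) ![u, v, w] +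
      g.bField.d.val x ![u, v, w] = H.val x ![u, v, w] := h1
    rw [h2] at h3
    linarith
  -- on vector parts the second derivatives of `λ` cancel by symmetry
  have hfst : (courant H (g.push A) (g.push B)).vec.val (g.diffeo x) =
      dmap E g.diffeo x ((courant H A B).vec.val x) := by
    rw [courant_fst, courant_fst, hA1, hB1, (dB _ 0).1, (dA _ 0).1, hsymm (B.vec.val x), map_sub]
    abel
  refine (g.push_val (courant H A B) x).trans (Prod.ext hfst.symm ?_)
  refine ContinuousLinearMap.ext (M₁ := E) fun v' => ?_
  obtain ⟨v, rfl⟩ : ∃ v, v' = dmap E g.diffeo x v := ⟨dmap E g.diffeo.symm (g.diffeo x) v',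
    (congrArg (fun L : E →L[ℝ] E => L v') (dmap_dmap_symm g.diffeo x)).symm⟩
  refine (g.actAt_snd_apply x ((courant H A B).val x) v).trans ?_
  change (courant H A B).cov.val x v + g.bField.val x ![(courant H A B).vec.val x, v] =
    (courant H (g.push A) (g.push B)).cov.val (g.diffeo x) (dmap E g.diffeo x v)
  rw [courant_snd hA hB, courant_snd hgA hgB, courant_fst, hA1, hB1, hH, g.smooth.d_apply_two,
    (dA _ 0).1, (dB _ 0).1, map_sub_two, map_add, map_add, hA2, hB2]
  -- on covector parts the derivatives of `α` add up to `dα`, which is absorbed by `λ^* H = H - dα`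
  have k1 := (dB (A.vec.val x) v).2
  have k2 := (dA (B.vec.val x) v).2
  have k3 := (dB v (A.vec.val x)).2
  have k4 := (dA v (B.vec.val x)).2
  rw [hsymm (A.vec.val x) v] at k1
  rw [hsymm (B.vec.val x) v] at k2
  have s1 := map_swap_two (g.bField.val x) (B.vec.val x)
    (fderiv ℝ (A.vec.inChart x) (extChartAt 𝓘(ℝ, E) x x) v)
  have s2 := map_swap_two (g.bField.val x) (A.vec.val x)
    (fderiv ℝ (B.vec.inChart x) (extChartAt 𝓘(ℝ, E) x x) v)
  have s3 := map_swap_two (fderiv ℝ (g.bField.inChart x) (extChartAt 𝓘(ℝ, E) x x) v)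
    (B.vec.val x) (A.vec.val x)
  linarith

end Bracket

/-! ### The Dorfman bracket -/

section Dorfman

variable {E : Type*} [NormedAddCommGroup E] [NormedSpace ℝ E]

/-- The natural pairing on `E × E^*`. -/
def pairE (u v : E × (E →L[ℝ] ℝ)) : ℝ := (1 / 2 : ℝ) * (v.2 u.1 + u.2 v.1)

/-- The zeroth order part of the Lie derivative of generalized vectors along an infinitesimal
symmetry `(X, a)`, where `T` is the derivative of `X` in a chart: `L_X = D_X - (this)`. -/
def infAct (T : E →L[ℝ] E) (a : E [⋀^Fin 2]→L[ℝ] ℝ) (u : E × (E →L[ℝ] ℝ)) :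
    E × (E →L[ℝ] ℝ) := (T u.1, a.toContinuousLinearMap ![u.1, 0] 1 - u.2.comp T)

/-- The zeroth order part of an infinitesimal symmetry is skew for the pairing. -/
lemma pairE_infAct (T : E →L[ℝ] E) (a : E [⋀^Fin 2]→L[ℝ] ℝ) (u v : E × (E →L[ℝ] ℝ)) :
    pairE (infAct T a u) v + pairE u (infAct T a v) = 0 := by
  simp only [pairE, infAct, sub_apply, ContinuousLinearMap.comp_apply, iotaE_apply]
  rw [map_swap_two a u.1 v.1]
  ring

/-- The natural pairing is nondegenerate. -/
lemma eq_of_pairE_eq {u u' : E × (E →L[ℝ] ℝ)} (h : ∀ v, pairE u v = pairE u' v) : u = u' := by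
  refine Prod.ext ?_ (ContinuousLinearMap.ext fun v => ?_)
  · refine (SeparatingDual.eq_iff_forall_dual_eq (R := ℝ)).2 fun η => ?_
    have := h (0, η)
    simpa [pairE] using this
  · have := h (v, 0)
    simpa [pairE] using this

lemma hasDerivAt_pairE {u v : ℝ → E × (E →L[ℝ] ℝ)} {u' v' : E × (E →L[ℝ] ℝ)} {t : ℝ}
    (hu : HasDerivAt u u' t) (hv : HasDerivAt v v' t) :
    HasDerivAt (fun s => pairE (u s) (v s)) (pairE u' (v t) + pairE (u t) v') t := by
  have hu1 : HasDerivAt (fun s => (u s).1) u'.1 t :=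
    (ContinuousLinearMap.fst ℝ E (E →L[ℝ] ℝ)).hasFDerivAt.comp_hasDerivAt t hu
  have hu2 : HasDerivAt (fun s => (u s).2) u'.2 t :=
    (ContinuousLinearMap.snd ℝ E (E →L[ℝ] ℝ)).hasFDerivAt.comp_hasDerivAt t hu
  have hv1 : HasDerivAt (fun s => (v s).1) v'.1 t :=
    (ContinuousLinearMap.fst ℝ E (E →L[ℝ] ℝ)).hasFDerivAt.comp_hasDerivAt t hv
  have hv2 : HasDerivAt (fun s => (v s).2) v'.2 t :=
    (ContinuousLinearMap.snd ℝ E (E →L[ℝ] ℝ)).hasFDerivAt.comp_hasDerivAt t hv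
  have h := ((hv2.clm_apply hu1).add (hu2.clm_apply hv1)).const_mul (1 / 2 : ℝ)
  refine h.congr_deriv ?_
  simp only [pairE]
  ring

variable {M : Type*} [TopologicalSpace M] [ChartedSpace E M] [IsManifold 𝓘(ℝ, E) ∞ M]

lemma GField.Smooth.fderiv_inChart {A : GField E M} (hA : A.Smooth) {c : M} {e : E}
    (he : e ∈ (extChartAt 𝓘(ℝ, E) c).target) (v : E) : fderiv ℝ (A.inChart c) e v =
      (fderiv ℝ (A.vec.inChart c) e v, fderiv ℝ (A.cov.inChart c) e v) := by
  have h1 : A.vec.Smooth := hA.1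
  have h2 : A.cov.Smooth := hA.2
  exact congrArg (fun L : E →L[ℝ] E × (E →L[ℝ] ℝ) => L v)
    (((h1.contDiffAt_inChart he).differentiableAt (by simp)).fderiv_prodMk
      ((h2.contDiffAt_inChart he).differentiableAt (by simp)))

lemma dfun_pairing {A B : GField E M} (hA : A.Smooth) (hB : B.Smooth) (x : M) (v : E) :
    CoField.val (dfun fun y => pairing (A y) (B y)) x v = (1 / 2 : ℝ) *
      (fderiv ℝ (B.cov.inChart x) (extChartAt 𝓘(ℝ, E) x x) v (A.vec.val x)
        + B.cov.val x (fderiv ℝ (A.vec.inChart x) (extChartAt 𝓘(ℝ, E) x x) v)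
        + (fderiv ℝ (A.cov.inChart x) (extChartAt 𝓘(ℝ, E) x x) v (B.vec.val x)
          + A.cov.val x (fderiv ℝ (B.vec.inChart x) (extChartAt 𝓘(ℝ, E) x x) v))) := by
  have hz := mem_extChartAt_target (I := 𝓘(ℝ, E)) x
  have hA1 : A.vec.Smooth := hA.1
  have hA2 : A.cov.Smooth := hA.2
  have hB1 : B.vec.Smooth := hB.1
  have hB2 : B.cov.Smooth := hB.2
  have h1 := ((hA1.contDiffAt_inChart hz).differentiableAt (by simp)).hasFDerivAt
  have h2 := ((hA2.contDiffAt_inChart hz).differentiableAt (by simp)).hasFDerivAt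
  have h3 := ((hB1.contDiffAt_inChart hz).differentiableAt (by simp)).hasFDerivAt
  have h4 := ((hB2.contDiffAt_inChart hz).differentiableAt (by simp)).hasFDerivAt
  have h5 := ((h4.clm_apply h1).add (h2.clm_apply h3)).const_mul (1 / 2 : ℝ)
  rw [dfun_eq h5.differentiableAt, h5.fderiv]
  · simp only [VField.inChart_self, CoField.inChart_self, smul_apply, add_apply,
      ContinuousLinearMap.comp_apply, ContinuousLinearMap.flip_apply, smul_eq_mul]
    ring
  · filter_upwards [extChartAt_target_mem_nhds (I := 𝓘(ℝ, E)) x] with e he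
    exact congrArg₂ (fun a b : ℝ => (1 / 2 : ℝ) * (a + b)) (B.cov.inChart_apply_inChart A.vec he)
      (A.cov.inChart_apply_inChart B.vec he)

/-- The twisted Dorfman bracket `[A, B]_H + d⟨A, B⟩` at the centre of a chart: the derivative of
`B` along the vector part of `A`, corrected by a term of order zero in `B`. -/
def dorfman (H : DForm E M 3) (A B : GField E M) (x : M) : E × (E →L[ℝ] ℝ) :=
  fderiv ℝ (B.inChart x) (extChartAt 𝓘(ℝ, E) x x) (A.vec.val x) -
    infAct (fderiv ℝ (A.vec.inChart x) (extChartAt 𝓘(ℝ, E) x x))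
      (DForm.val (A.cov.toDForm.d - DForm.interior A.vec H) x) (B.val x)

/-- The Courant bracket is the Dorfman bracket up to the exact term `d⟨A, B⟩`. -/
lemma courant_eq_dorfman {H : DForm E M 3} {A B : GField E M} (hA : A.Smooth) (hB : B.Smooth)
    (x : M) : (courant H A B).val x =
      dorfman H A B x - (0, CoField.val (dfun fun y => pairing (A y) (B y)) x) := by
  have hz := mem_extChartAt_target (I := 𝓘(ℝ, E)) x
  have hA2 : A.cov.Smooth := hA.2
  rw [dorfman, hB.fderiv_inChart hz]
  refine Prod.ext ?_ (ContinuousLinearMap.ext fun v => ?_)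
  · refine (courant_fst A B x).trans ?_
    simp only [Prod.fst_sub, infAct, sub_zero]
    rfl
  · refine (courant_snd hA hB x v).trans ?_
    have h1 : DForm.val (A.cov.toDForm.d - DForm.interior A.vec H) x ![B.vec.val x, v] =
        A.cov.toDForm.d.val x ![B.vec.val x, v] - H.val x ![A.vec.val x, B.vec.val x, v] := rfl
    simp only [Prod.snd_sub, infAct, sub_apply, ContinuousLinearMap.comp_apply, iotaE_apply]
    rw [dfun_pairing hA hB]
    change _ = fderiv ℝ (B.cov.inChart x) (extChartAt 𝓘(ℝ, E) x x) (A.vec.val x) v -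
      (DForm.val (A.cov.toDForm.d - DForm.interior A.vec H) x ![B.vec.val x, v] -
        B.cov.val x (fderiv ℝ (A.vec.inChart x) (extChartAt 𝓘(ℝ, E) x x) v)) - _
    rw [h1, CoField.d_apply hA2]
    ring

/-- Exact sections act trivially under the Dorfman bracket. -/
lemma dorfman_dGField (H : DForm E M 3) {f : M → ℝ} (hf : ContMDiff 𝓘(ℝ, E) 𝓘(ℝ, ℝ) ∞ f)
    (B : GField E M) (x : M) : dorfman H (dGField f) B x = 0 := by
  have h1 : (dGField f : GField E M).vec.inChart x = fun _ => 0 := by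
    funext e; exact map_zero (dchart E x ((extChartAt 𝓘(ℝ, E) x).symm e))
  have h2 : (dGField f : GField E M).vec.val x = 0 := rfl
  have h3 : DForm.val ((dGField f : GField E M).cov.toDForm.d -
      DForm.interior (dGField f : GField E M).vec H) x = 0 := by
    have h4 : (dGField f : GField E M).cov.toDForm.d = 0 := d_dfun hf
    rw [h4]
    have h5 : DForm.val (DForm.interior (dGField f : GField E M).vec H) x = 0 :=
      map_zero (ContinuousAlternatingMap.curryLeft (H.val x))
    exact (congrArg (fun a : E [⋀^Fin 2]→L[ℝ] ℝ => 0 - a) h5).trans (sub_zero _)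
  rw [dorfman, h1, h2, h3, map_zero, zero_sub, infAct]
  simp
  ext v
  exact iotaE_apply (0 : E [⋀^Fin 2]→L[ℝ] ℝ) _ _

lemma dfun_neg (f : M → ℝ) : CoField.val (E := E) (dfun fun y => -f y) = -CoField.val (dfun f) :=
  funext fun x => mfderiv_neg (I := 𝓘(ℝ, E)) (f := f) (x := x)

end Dorfman

/-! ### Integrability and Hamiltonian fields -/

section Integrability

variable {E : Type*} [NormedAddCommGroup E] [NormedSpace ℝ E]
  {M : Type*} [TopologicalSpace M] [ChartedSpace E M] [IsManifold 𝓘(ℝ, E) ∞ M]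
  {H : DForm E M 3} {J : GenAlmostComplex E M}

lemma GenAlmostComplex.inChart_self (J : GenAlmostComplex E M) (c : M) :
    J.inChart c (extChartAt 𝓘(ℝ, E) c c) = J.val c := by
  have hq : ∀ q : M, q = c → J.val q = J.val c ∧ dchart E c q = ContinuousLinearMap.id ℝ E := by
    rintro q rfl; exact ⟨rfl, dchart_self q⟩
  obtain ⟨h1, h2⟩ := hq _ (extChartAt_to_inv (I := 𝓘(ℝ, E)) c)
  refine ContinuousLinearMap.ext fun u => ?_
  have h3 : gtanOfChart c (extChartAt 𝓘(ℝ, E) c c) u = u := by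
    rw [gtanOfChart, h2, dchartSymm_self]; rfl
  have h4 : ∀ u, gtanToChart c (extChartAt 𝓘(ℝ, E) c c) u = u := by
    intro u
    rw [gtanToChart, h2, dchartSymm_self]; rfl
  rw [GenAlmostComplex.inChart, ContinuousLinearMap.comp_apply, ContinuousLinearMap.comp_apply, h4,
    h3, h1]

/-- Integrability of `J`, tested on the sections `J(df) + i df` and `J B + i B`: the Dorfman
bracket with the Hamiltonian field `J(df)` commutes with `J`. -/
lemma GenAlmostComplex.Integrable.dorfman_hamField (hJ : J.Integrable H) {f : M → ℝ}
    (hf : ContMDiff 𝓘(ℝ, E) 𝓘(ℝ, ℝ) ∞ f) {B : GField E M} (hB : B.Smooth) (x : M) :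
    J.val x (dorfman H (J.hamField f) B x) = dorfman H (J.hamField f) (J.map B) x := by
  have hA : (dGField f : GField E M).Smooth := dGField_smooth hf
  have hX := J.hamField_smooth hf
  have hJB := J.map_smooth hB
  -- imaginary parts: `J ([J df, B] + [df, J B]) = [J df, J B] - [df, B]`
  have hS : J.IsEigen ⟨J.hamField f, dGField f⟩ := fun x => ⟨J.sq x _, rfl⟩
  have hT : J.IsEigen ⟨J.map B, B⟩ := fun x => ⟨J.sq x _, rfl⟩
  have h := (hJ _ _ ⟨hX, hA⟩ ⟨hJB, hB⟩ hS hT x).2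
  have h1 : J.val x ((courant H (J.hamField f) B).val x + (courant H (dGField f) (J.map B)).val x) =
      (courant H (J.hamField f) (J.map B)).val x - (courant H (dGField f) B).val x := h
  rw [courant_eq_dorfman hX hB, courant_eq_dorfman hA hJB, courant_eq_dorfman hX hJB,
    courant_eq_dorfman hA hB, dorfman_dGField H hf, dorfman_dGField H hf] at h1
  -- by orthogonality of `J` the exact terms cancel
  have e1 : (fun y => pairing (J.hamField f y) (J.map B y)) =
      fun y => pairing (dGField f y) (B y) := funext fun y => J.orthogonal y _ _
  have e2 : (fun y => pairing (dGField f y) (J.map B y)) =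
      fun y => -pairing (J.hamField f y) (B y) := by
    funext y
    have h2 := J.orthogonal y (dGField f y) (J.map B y)
    rw [← h2]
    have h3 : J.toFun y (J.map B y) = -B y := J.sq y (B y)
    rw [h3]
    change (1 / 2 : ℝ) * ((-(B y).2) (J.hamField f y).1 + (J.hamField f y).2 (-(B y).1)) = _
    rw [neg_apply, map_neg]
    simp only [pairing]
    ring
  rw [e1, e2, dfun_neg] at h1
  have e3 : dorfman H (J.hamField f) B x -
      ((0 : E), CoField.val (dfun fun y => pairing (J.hamField f y) (B y)) x) +
      (0 - ((0 : E), (-CoField.val (dfun fun y => pairing (J.hamField f y) (B y))) x)) =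
      dorfman H (J.hamField f) B x := by
    rw [Pi.neg_apply]
    refine Prod.ext (by simp) (by simp)
  have e4 : dorfman H (J.hamField f) (J.map B) x -
      ((0 : E), CoField.val (dfun fun y => pairing (dGField f y) (B y)) x) -
      (0 - ((0 : E), CoField.val (dfun fun y => pairing (dGField f y) (B y)) x)) =
      dorfman H (J.hamField f) (J.map B) x := by
    abel
  rw [e3, e4] at h1
  exact h1

/-- In a chart, the derivative of `J` along a Hamiltonian field is its commutator with the zeroth
order part of the corresponding infinitesimal symmetry. -/
lemma GenAlmostComplex.Integrable.fderiv_inChart [FiniteDimensional ℝ E] [T2Space M]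
    (hJ : J.Integrable H) {f : M → ℝ} (hf : ContMDiff 𝓘(ℝ, E) 𝓘(ℝ, ℝ) ∞ f) (x : M)
    (u : E × (E →L[ℝ] ℝ)) :
    fderiv ℝ (J.inChart x) (extChartAt 𝓘(ℝ, E) x x) ((J.hamField f).vec.val x) u =
      infAct (fderiv ℝ ((J.hamField f).vec.inChart x) (extChartAt 𝓘(ℝ, E) x x))
        (DForm.val (hamInfinitesimal H J f).2 x) (J.val x u) -
      J.val x (infAct (fderiv ℝ ((J.hamField f).vec.inChart x) (extChartAt 𝓘(ℝ, E) x x))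
        (DForm.val (hamInfinitesimal H J f).2 x) u) := by
  -- expand the Dorfman brackets in `J [J df, B] = [J df, J B]` for a section `B` through `u`
  obtain ⟨B, hB, rfl⟩ := exists_smooth_gfield x u
  have hz := mem_extChartAt_target (I := 𝓘(ℝ, E)) x
  have h1 := hJ.dorfman_hamField hf hB x
  have h2 := ((J.contDiffAt_inChart x).differentiableAt (by simp)).hasFDerivAt.clm_apply
    ((hB.contDiffAt_inChart hz).differentiableAt (by simp)).hasFDerivAt
  have h3 : (J.map B).inChart x =ᶠ[nhds (extChartAt 𝓘(ℝ, E) x x)]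
      fun e => J.inChart x e (B.inChart x e) := by
    filter_upwards [extChartAt_target_mem_nhds (I := 𝓘(ℝ, E)) x] with e he
    exact J.inChart_map B he
  have h4 : (J.map B).val x = J.val x (B.val x) := rfl
  rw [dorfman, dorfman, h3.fderiv_eq, h2.fderiv, h4, map_sub, add_apply,
    ContinuousLinearMap.comp_apply, ContinuousLinearMap.flip_apply, J.inChart_self,
    GField.inChart_self] at h1
  rw [hamInfinitesimal_snd]
  have h5 : ∀ a b c d : E × (E →L[ℝ] ℝ), a - b = a + c - d → c = d - b := by
    intro a b c d h
    have : c = (a + c - d) - a + d := by abel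
    rw [this, ← h]
    abel
  exact h5 _ _ _ _ h1

end Integrability

/-! ### Hamiltonian paths preserve the structure -/

section Structure

variable {E : Type*} [NormedAddCommGroup E] [NormedSpace ℝ E]

/-- The derivative of the inverse `P` of a family `D` with `D' = T D` is `-P T`. -/
lemma hasDerivAt_inverse_of_eventually [CompleteSpace E] {D P : ℝ → E →L[ℝ] E} {T : E →L[ℝ] E}
    {t : ℝ} (hD : HasDerivAt D (T ∘L D t) t)
    (hPD : ∀ᶠ s in nhds t, P s ∘L D s = ContinuousLinearMap.id ℝ E)
    (hDP : ∀ᶠ s in nhds t, D s ∘L P s = ContinuousLinearMap.id ℝ E) :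
    HasDerivAt P (-(P t ∘L T)) t := by
  have hinv : ∀ᶠ s in nhds t, P s = (D s).inverse := by
    filter_upwards [hPD, hDP] with s h1 h2
    exact (ContinuousLinearMap.inverse_equiv (ContinuousLinearEquiv.equivOfInverse (D s) (P s)
      (fun x => congrArg (fun L : E →L[ℝ] E => L x) h1)
      (fun x => congrArg (fun L : E →L[ℝ] E => L x) h2))).symm
  let e : E ≃L[ℝ] E := ContinuousLinearEquiv.equivOfInverse (D t) (P t)
      (fun x => congrArg (fun L : E →L[ℝ] E => L x) hPD.self_of_nhds)
      (fun x => congrArg (fun L : E →L[ℝ] E => L x) hDP.self_of_nhds)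
  have h1 : DifferentiableAt ℝ (ContinuousLinearMap.inverse : (E →L[ℝ] E) → E →L[ℝ] E) (D t) :=
    (contDiffAt_map_inverse (n := 1) e).differentiableAt (by simp)
  have h2 : DifferentiableAt ℝ P t :=
    (h1.comp t hD.differentiableAt).congr_of_eventuallyEq hinv
  -- differentiate `P ∘ D = id` and solve for the derivative of `P`
  have h3 := h2.hasDerivAt.clm_comp hD
  have h4 : HasDerivAt (fun s => P s ∘L D s) 0 t :=
    (hasDerivAt_const t (ContinuousLinearMap.id ℝ E)).congr_of_eventuallyEq hPD
  have h5 := h3.unique h4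
  refine h2.hasDerivAt.congr_deriv (ContinuousLinearMap.ext fun v => ?_)
  have h6 : deriv P t (D t (P t v)) + P t (T (D t (P t v))) = 0 :=
    congrArg (fun L : E →L[ℝ] E => L (P t v)) h5
  have h7 : D t (P t v) = v := congrArg (fun L : E →L[ℝ] E => L v) hDP.self_of_nhds
  rw [h7] at h6
  exact eq_neg_of_add_eq_zero_left h6

/-- The action of a `B`-field `a` and an invertible map `D` with inverse `P`. -/
def actModel (D P : E →L[ℝ] E) (a : E [⋀^Fin 2]→L[ℝ] ℝ) (u : E × (E →L[ℝ] ℝ)) :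
    E × (E →L[ℝ] ℝ) := (D u.1, (u.2 + a.toContinuousLinearMap ![u.1, 0] 1).comp P)

/-- If `D' = T D` and `a' = D^* b`, then the action of `(D, a)` evolves by the zeroth order part
`infAct T b`. -/
lemma hasDerivAt_actModel {D P : ℝ → E →L[ℝ] E} {a : ℝ → E [⋀^Fin 2]→L[ℝ] ℝ}
    {T : E →L[ℝ] E} {b : E [⋀^Fin 2]→L[ℝ] ℝ} {t : ℝ} (hD : HasDerivAt D (T ∘L D t) t)
    (hP : HasDerivAt P (-(P t ∘L T)) t) (hDP : D t ∘L P t = ContinuousLinearMap.id ℝ E)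
    (ha : HasDerivAt a (b.compContinuousLinearMap (D t)) t) (u : E × (E →L[ℝ] ℝ)) :
    HasDerivAt (fun s => actModel (D s) (P s) (a s) u)
      (infAct T b (actModel (D t) (P t) (a t) u)) t := by
  have h1 : HasDerivAt (fun s => D s u.1) (T (D t u.1)) t :=
    (ContinuousLinearMap.apply ℝ E u.1).hasFDerivAt.comp_hasDerivAt t hD
  have h2 : HasDerivAt (fun s => (a s).toContinuousLinearMap ![u.1, 0] 1)
      ((b.compContinuousLinearMap (D t)).toContinuousLinearMap ![u.1, 0] 1) t := by
    have h := (contDiff_iotaE (E := E)).differentiable (by simp) (a t, u.1)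
    have h' := (h.hasFDerivAt.comp_hasDerivAt t (ha.prodMk (hasDerivAt_const t u.1)))
    have h3 : DifferentiableAt ℝ (fun s => (a s).toContinuousLinearMap ![u.1, 0] 1) t :=
      h'.differentiableAt
    refine h3.hasDerivAt.congr_deriv (ContinuousLinearMap.ext fun v => ?_)
    have h4 := (ContinuousLinearMap.apply ℝ ℝ v).hasFDerivAt.comp_hasDerivAt t h3.hasDerivAt
    have h5 := (ContinuousAlternatingMap.apply ℝ E ℝ ![u.1, v]).hasFDerivAt.comp_hasDerivAt t ha
    have h6 : HasDerivAt (fun s => (a s).toContinuousLinearMap ![u.1, 0] 1 v)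
        ((b.compContinuousLinearMap (D t)) ![u.1, v]) t := by
      simp only [iotaE_apply]
      exact h5
    rw [iotaE_apply]
    exact h4.unique h6
  have h3 := ((hasDerivAt_const t u.2).add h2).clm_comp hP
  refine (h1.prodMk h3).congr_deriv (Prod.ext rfl (ContinuousLinearMap.ext fun v => ?_))
  have h7 : D t (P t v) = v := congrArg (fun L : E →L[ℝ] E => L v) hDP
  simp only [infAct, actModel, add_apply, sub_apply, ContinuousLinearMap.comp_apply, iotaE_apply,
    compCLM_two, neg_apply, map_neg, zero_add, h7]
  have h8 : (a t) (Function.update ![u.1, 0] 1 (P t (T v))) = a t ![u.1, P t (T v)] :=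
    iotaE_apply (a t) u.1 (P t (T v))
  simp [h8]
  ring

variable {M : Type*} [TopologicalSpace M] [ChartedSpace E M] [IsManifold 𝓘(ℝ, E) ∞ M]

lemma pairE_actAt (g : GenSym E M) (x : M) (u v : E × (E →L[ℝ] ℝ)) :
    pairE (g.actAt x u) (g.actAt x v) = pairE u v := by
  have h1 := g.actAt_snd_apply x u v.1
  have h2 := g.actAt_snd_apply x v u.1
  have h3 := map_swap_two (g.bField.val x) u.1 v.1
  have h4 : (g.actAt x u).1 = dmap E g.diffeo x u.1 := rfl
  have h5 : (g.actAt x v).1 = dmap E g.diffeo x v.1 := rfl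
  rw [pairE, pairE, h4, h5, h1, h2, h3]
  ring

lemma actAt_surjective (g : GenSym E M) (x : M) : Function.Surjective (g.actAt x) := by
  intro w
  have hP : ∀ v, dmap E g.diffeo x (dmap E g.diffeo.symm (g.diffeo x) v) = v := fun v =>
    congrArg (fun L : E →L[ℝ] E => L v) (dmap_dmap_symm g.diffeo x)
  refine ⟨(dmap E g.diffeo.symm (g.diffeo x) w.1, w.2.comp (dmap E g.diffeo x) -
    (g.bField.val x).toContinuousLinearMap ![dmap E g.diffeo.symm (g.diffeo x) w.1, 0] 1),
    Prod.ext (hP w.1) (ContinuousLinearMap.ext fun v => ?_)⟩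
  rw [GenSym.actAt, sub_add_cancel, ContinuousLinearMap.comp_apply, ContinuousLinearMap.comp_apply,
    hP]

/-- It suffices to check the compatibility with `J` in terms of the pairing. -/
lemma GenSym.preservesStructure_of_pairE {g : GenSym E M} {J : GenAlmostComplex E M}
    (h : ∀ (x : M) (u v : E × (E →L[ℝ] ℝ)),
      pairE (J.val (g.diffeo x) (g.actAt x u)) (g.actAt x v) = pairE (J.val x u) v) :
    g.PreservesStructure J := by
  intro y u
  obtain ⟨x, rfl⟩ := g.diffeo.surjective y
  have h0 : J.val (g.diffeo.symm (g.diffeo x)) = J.val x := by rw [g.diffeo.symm_apply_apply]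
  have h1 : ∀ u : E × (E →L[ℝ] ℝ), g.actAt x (J.val x u) = J.val (g.diffeo x) (g.actAt x u) := by
    intro u
    refine eq_of_pairE_eq fun w => ?_
    obtain ⟨v, rfl⟩ := actAt_surjective g x w
    rw [pairE_actAt, h]
  have h2 := g.act_eq_actAt x u
  have h3 := g.act_eq_actAt x (J.val (g.diffeo.symm (g.diffeo x)) u)
  exact h3.trans ((congrArg (fun K : (E × (E →L[ℝ] ℝ)) →L[ℝ] (E × (E →L[ℝ] ℝ)) =>
    g.actAt x (K u)) h0).trans ((h1 u).trans (congrArg (J.val (g.diffeo x)) h2.symm)))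

lemma pairE_gtanToChart {c : M} {e : E} (he : e ∈ (extChartAt 𝓘(ℝ, E) c).target)
    (u v : E × (E →L[ℝ] ℝ)) : pairE (gtanToChart c e u) (gtanToChart c e v) = pairE u v := by
  have h : ∀ (η : E →L[ℝ] ℝ) (w : E), η (dchartSymm c e
      (dchart E c ((extChartAt 𝓘(ℝ, E) c).symm e) w)) = η w := fun η w =>
    congrArg η (dchartSymm_dchart he w)
  exact congrArg₂ (fun a b : ℝ => (1 / 2 : ℝ) * (a + b)) (h v.2 u.1) (h u.2 v.1)

/-- The transport of generalized vectors along a path of symmetries, in the chart at `c`. -/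
lemma gtanToChart_actAt (g : GenSym E M) {x c : M}
    (hx : g.diffeo x ∈ (extChartAt 𝓘(ℝ, E) c).source) (u : E × (E →L[ℝ] ℝ)) :
    gtanToChart c (extChartAt 𝓘(ℝ, E) c (g.diffeo x)) (g.actAt x u) =
      actModel (fderiv ℝ (mapInChart g.diffeo x c) (extChartAt 𝓘(ℝ, E) x x))
        (dmap E g.diffeo.symm (g.diffeo x) ∘L dchartSymm c (extChartAt 𝓘(ℝ, E) c (g.diffeo x)))
        (g.bField.val x) u := by
  have hs : g.diffeo ((extChartAt 𝓘(ℝ, E) x).symm (extChartAt 𝓘(ℝ, E) x x)) ∈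
      (extChartAt 𝓘(ℝ, E) c).source := by rwa [extChartAt_to_inv]
  have h1 := fderiv_mapInChart g.diffeo.contMDiff (mem_extChartAt_target x) hs
  rw [dchartSymm_self, extChartAt_to_inv] at h1
  rw [h1]
  refine Prod.ext ?_ rfl
  have h2 : ∀ q, q = g.diffeo x → dchart E c q (dmap E g.diffeo x u.1) =
      dchart E c (g.diffeo x) (dmap E g.diffeo x u.1) := by
    rintro q rfl; rfl
  exact h2 _ ((extChartAt 𝓘(ℝ, E) c).left_inv hx)

lemma GenAlmostComplex.inChart_extChartAt (J : GenAlmostComplex E M) {c x : M}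
    (hx : x ∈ (extChartAt 𝓘(ℝ, E) c).source) (u : E × (E →L[ℝ] ℝ)) :
    J.inChart c (extChartAt 𝓘(ℝ, E) c x) (gtanToChart c (extChartAt 𝓘(ℝ, E) c x) u) =
      gtanToChart c (extChartAt 𝓘(ℝ, E) c x) (J.val x u) := by
  have h1 : J.val ((extChartAt 𝓘(ℝ, E) c).symm (extChartAt 𝓘(ℝ, E) c x)) = J.val x := by
    rw [(extChartAt 𝓘(ℝ, E) c).left_inv hx]
  rw [GenAlmostComplex.inChart, ContinuousLinearMap.comp_apply, ContinuousLinearMap.comp_apply, h1,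
    gtanOfChart_gtanToChart ((extChartAt 𝓘(ℝ, E) c).map_source hx)]

set_option synthInstance.maxHeartbeats 100000 in
/-- The derivative along a Hamiltonian path of the endomorphism `J` transported back to the
initial point vanishes. -/
lemma IsHamPath.hasDerivAt_pairE [FiniteDimensional ℝ E] [T2Space M] {H : DForm E M 3}
    {J : GenAlmostComplex E M} (hJ : J.Integrable H) {F : ℝ → M → ℝ}
    {g : ℝ → GenSym E M} (hg : IsHamPath H J F g) (x : M) (u v : E × (E →L[ℝ] ℝ)) (t : ℝ) :
    HasDerivAt (fun s => pairE (J.val ((g s).diffeo x) ((g s).actAt x u)) ((g s).actAt x v))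
      0 t := by
  have : CompleteSpace E := FiniteDimensional.complete ℝ E
  have hF := contMDiff_of_family hg.1 t
  have hflow := hg.2.isFlow
  set c := (g t).diffeo x with hc
  set z := extChartAt 𝓘(ℝ, E) x x with hz0
  set y := extChartAt 𝓘(ℝ, E) c c with hy0
  have hz : z ∈ (extChartAt 𝓘(ℝ, E) x).target := mem_extChartAt_target x
  have hs : (g t).diffeo ((extChartAt 𝓘(ℝ, E) x).symm z) ∈ (extChartAt 𝓘(ℝ, E) c).source := by
    rw [hz0, extChartAt_to_inv]; exact mem_extChartAt_source _
  have hsrc := hflow.eventually_mem_source (mem_extChartAt_source (I := 𝓘(ℝ, E)) c)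
  have hl : mapInChart (g t).diffeo x c z = y := mapInChart_self (g t).diffeo x
  let X : VField E M := (hamInfinitesimal H J (F t)).1
  let T : E →L[ℝ] E := fderiv ℝ (X.inChart c) y
  let D : ℝ → E →L[ℝ] E := fun s => fderiv ℝ (mapInChart (g s).diffeo x c) z
  let P : ℝ → E →L[ℝ] E := fun s => dmap E (g s).diffeo.symm ((g s).diffeo x) ∘L
    dchartSymm c (extChartAt 𝓘(ℝ, E) c ((g s).diffeo x))
  have hXs : X.Smooth := hamInfinitesimal_fst_smooth hF
  have hD : HasDerivAt D (T ∘L D t) t := by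
    have h := hflow.hasDerivAt_fderiv_mapInChart (t := t) hXs hz hs
    rwa [hl] at h
  have hDs : ∀ᶠ s in nhds t, D s = dchart E c ((g s).diffeo x) ∘L dmap E (g s).diffeo x := by
    filter_upwards [hsrc] with s hs'
    have h1 := fderiv_mapInChart (g s).diffeo.contMDiff hz (c' := c)
      (by rw [hz0, extChartAt_to_inv]; exact hs')
    rw [hz0, dchartSymm_self, extChartAt_to_inv] at h1
    exact h1
  have hPD : ∀ᶠ s in nhds t, P s ∘L D s = ContinuousLinearMap.id ℝ E := by
    filter_upwards [hsrc, hDs] with s hs' hs''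
    rw [hs'']
    refine ContinuousLinearMap.ext fun w => ?_
    have h1 := dchartSymm_dchart' hs' (dmap E (g s).diffeo x w)
    refine (congrArg (dmap E (g s).diffeo.symm ((g s).diffeo x)) h1).trans ?_
    exact congrArg (fun L : E →L[ℝ] E => L w) (dmap_symm_dmap (g s).diffeo x)
  have hDP : ∀ᶠ s in nhds t, D s ∘L P s = ContinuousLinearMap.id ℝ E := by
    filter_upwards [hsrc, hDs] with s hs' hs''
    rw [hs'']
    refine ContinuousLinearMap.ext fun w => ?_
    have h1 := congrArg (fun L : E →L[ℝ] E => L (dchartSymm c (extChartAt 𝓘(ℝ, E) c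
      ((g s).diffeo x)) w)) (dmap_dmap_symm (g s).diffeo x)
    refine (congrArg (dchart E c ((g s).diffeo x)) h1).trans ?_
    exact dchart_dchartSymm' hs' w
  have hP := hasDerivAt_inverse_of_eventually hD hPD hDP
  have hDt : D t = dmap E (g t).diffeo x := fderiv_mapInChart_self (g t).diffeo.contMDiff x
  have ha : HasDerivAt (fun s => (g s).bField.val x)
      ((DForm.val (hamInfinitesimal H J (F t)).2 c).compContinuousLinearMap (D t)) t := by
    have h1 := (hg.2.hasTimeDerivAt t).deriv_inChart hg.2.smooth_bField
      (mem_extChartAt_target (I := 𝓘(ℝ, E)) x)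
    have h2 : ∀ w : DForm E M 2, w.inChart x (extChartAt 𝓘(ℝ, E) x x) = w.val x :=
      fun w => w.inChart_self x
    simp only [h2] at h1
    rw [hDt]
    exact h1
  -- near time `t` the path is read in the fixed charts at `x` and at `c = λ_t x`
  have hΨ := hasDerivAt_actModel hD hP hDP.self_of_nhds ha
  have hJ' : HasDerivAt (fun s => J.inChart c (mapInChart (g s).diffeo x c z))
      (fderiv ℝ (J.inChart c) y (X.val c)) t := by
    have h1 := hflow.hasDerivAt_mapInChart hs
    have h2 := ((J.contDiffAt_inChart c).differentiableAt (by simp)).hasFDerivAt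
    have e1 : X.inChart c y = X.val c := X.inChart_self c
    rw [← hy0, ← hl] at h2
    have h3 := h2.comp_hasDerivAt t h1
    have e2 : VField.inChart (hamInfinitesimal H J (F t)).1 c
      (mapInChart (g t).diffeo x c z) = X.val c := (congrArg (X.inChart c) hl).trans e1
    rw [e2, hl] at h3
    exact h3
  have hmain := GenGeom.hasDerivAt_pairE (hJ'.clm_apply (hΨ u)) (hΨ v)
  refine (hmain.congr_of_eventuallyEq ?_).congr_deriv ?_
  · filter_upwards [hsrc] with s hs'
    have e1 : mapInChart (g s).diffeo x c z = extChartAt 𝓘(ℝ, E) c ((g s).diffeo x) := by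
      rw [mapInChart, hz0, extChartAt_to_inv]
    rw [← gtanToChart_actAt (g s) hs' u, ← gtanToChart_actAt (g s) hs' v, e1,
      J.inChart_extChartAt hs', pairE_gtanToChart ((extChartAt 𝓘(ℝ, E) c).map_source hs')]
  · have h1 := hJ.fderiv_inChart hF c (actModel (D t) (P t) ((g t).bField.val x) u)
    have h2 := pairE_infAct T (DForm.val (hamInfinitesimal H J (F t)).2 c)
      (J.val c (actModel (D t) (P t) ((g t).bField.val x) u))
      (actModel (D t) (P t) ((g t).bField.val x) v)
    have h3 : fderiv ℝ (J.inChart c) y (X.val c)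
        (actModel (D t) (P t) ((g t).bField.val x) u) =
      infAct T (DForm.val (hamInfinitesimal H J (F t)).2 c)
        (J.val c (actModel (D t) (P t) ((g t).bField.val x) u)) -
      J.val c (infAct T (DForm.val (hamInfinitesimal H J (F t)).2 c)
        (actModel (D t) (P t) ((g t).bField.val x) u)) := h1
    rw [h3, hl, hy0, J.inChart_self, sub_add_cancel]
    exact h2

/-- Hamiltonian paths preserve `J`. -/
lemma IsHamPath.preservesStructure [FiniteDimensional ℝ E] [T2Space M] {H : DForm E M 3}
    {J : GenAlmostComplex E M} (hJ : J.Integrable H) {F : ℝ → M → ℝ}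
    {g : ℝ → GenSym E M} (hg : IsHamPath H J F g) (t : ℝ) : (g t).PreservesStructure J := by
  refine GenSym.preservesStructure_of_pairE fun x u v => ?_
  have h := is_const_of_deriv_eq_zero
    (fun t => (hg.hasDerivAt_pairE hJ x u v t).differentiableAt)
    (fun t => (hg.hasDerivAt_pairE hJ x u v t).deriv) t 0
  refine h.trans ?_
  have h1 : ∀ u, (1 : GenSym E M).actAt x u = u := by
    intro u
    have h2 := (1 : GenSym E M).act_eq_actAt x u
    exact h2.symm.trans (GenSym.act_one x u)
  rw [hg.2.start, h1, h1]
  rfl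

end Structure

/-! ### Smoothness of the inverses of a smooth family of diffeomorphisms -/

section Inverse

variable {E : Type*} [NormedAddCommGroup E] [NormedSpace ℝ E]

/-- The inverse function theorem with a parameter. -/
lemma exists_contDiffAt_rightInverse [CompleteSpace E] {ℓ : ℝ × E → E} {t : ℝ} {z : E}
    (hℓ : ContDiffAt ℝ ∞ ℓ (t, z)) (D : E ≃L[ℝ] E)
    (hD : HasFDerivAt (fun e => ℓ (t, e)) (D : E →L[ℝ] E) z) :
    ∃ N : ℝ × E → E, ContDiffAt ℝ ∞ N (t, ℓ (t, z)) ∧ N (t, ℓ (t, z)) = z ∧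
      ∀ᶠ q in nhds (t, ℓ (t, z)), ℓ (q.1, N q) = q.2 := by
  let A : ℝ × E →L[ℝ] E := fderiv ℝ ℓ (t, z)
  have hA : HasFDerivAt ℓ A (t, z) := (hℓ.differentiableAt (by simp)).hasFDerivAt
  have hAD : ∀ v, A (0, v) = D v := fun v => congrArg (fun L : E →L[ℝ] E => L v)
    ((hA.comp z (hasFDerivAt_prodMk_right t z)).unique hD)
  have hA' : ∀ p : ℝ × E, A p = A (p.1, 0) + D p.2 := fun p => by
    rw [← hAD, ← map_add]; simp
  let B : ℝ × E →L[ℝ] ℝ × E := (ContinuousLinearMap.fst ℝ ℝ E).prod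
    ((D.symm : E →L[ℝ] E) ∘L (ContinuousLinearMap.snd ℝ ℝ E -
      A ∘L ContinuousLinearMap.inl ℝ ℝ E ∘L ContinuousLinearMap.fst ℝ ℝ E))
  let L : (ℝ × E) ≃L[ℝ] (ℝ × E) := ContinuousLinearEquiv.equivOfInverse
    ((ContinuousLinearMap.fst ℝ ℝ E).prod A) B
    (fun p => Prod.ext rfl (by
      change D.symm (A p - A (p.1, 0)) = p.2
      rw [hA' p, add_sub_cancel_left, D.symm_apply_apply]))
    (fun p => Prod.ext rfl (by
      change A (p.1, D.symm (p.2 - A (p.1, 0))) = p.2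
      rw [hA', D.apply_symm_apply, add_sub_cancel]))
  have hΨ : ContDiffAt ℝ ∞ (fun p : ℝ × E => (p.1, ℓ p)) (t, z) := contDiffAt_fst.prodMk hℓ
  have hΨ' : HasFDerivAt (fun p : ℝ × E => (p.1, ℓ p)) (L : ℝ × E →L[ℝ] ℝ × E) (t, z) :=
    hasFDerivAt_fst.prodMk hA
  have hn : (∞ : ℕ∞ω) ≠ 0 := by simp
  refine ⟨fun q => (hΨ.localInverse hΨ' hn q).2, (hΨ.to_localInverse hΨ' hn).snd,
    congrArg Prod.snd (hΨ.localInverse_apply_image hΨ' hn), ?_⟩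
  filter_upwards [(hΨ.hasStrictFDerivAt' hΨ' hn).eventually_right_inverse] with q hq
  have hq : ((hΨ.localInverse hΨ' hn q).1, ℓ (hΨ.localInverse hΨ' hn q)) = q := hq
  have h1 : (hΨ.localInverse hΨ' hn q).1 = q.1 := (Prod.ext_iff.1 hq).1
  have h2 : ℓ (hΨ.localInverse hΨ' hn q) = q.2 := (Prod.ext_iff.1 hq).2
  rw [← h1]
  exact h2

variable {M : Type*} [TopologicalSpace M] [ChartedSpace E M] [IsManifold 𝓘(ℝ, E) ∞ M]

/-- The inverses of a smooth family of diffeomorphisms form a smooth family. -/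
lemma contMDiff_symm_family [FiniteDimensional ℝ E] {f : ℝ → M ≃ₘ^∞⟮𝓘(ℝ, E), 𝓘(ℝ, E)⟯ M}
    (hf : ContMDiff (𝓘(ℝ, ℝ).prod 𝓘(ℝ, E)) 𝓘(ℝ, E) ∞ (fun p : ℝ × M => f p.1 p.2)) :
    ContMDiff (𝓘(ℝ, ℝ).prod 𝓘(ℝ, E)) 𝓘(ℝ, E) ∞ (fun p : ℝ × M => (f p.1).symm p.2) := by
  have : CompleteSpace E := FiniteDimensional.complete ℝ E
  rintro ⟨t, y⟩
  obtain ⟨x, rfl⟩ := (f t).surjective y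
  set c := f t x with hc
  set z := extChartAt 𝓘(ℝ, E) x x with hz0
  have hz : z ∈ (extChartAt 𝓘(ℝ, E) x).target := mem_extChartAt_target x
  have hs : f t ((extChartAt 𝓘(ℝ, E) x).symm z) ∈ (extChartAt 𝓘(ℝ, E) c).source := by
    rw [hz0, extChartAt_to_inv]; exact mem_extChartAt_source _
  have hft : ContMDiff 𝓘(ℝ, E) 𝓘(ℝ, E) ∞ (f t : M → M) := (f t).contMDiff
  have hℓ := contDiffAt_mapInChart_family (f := fun t => (f t : M → M)) hf t hz hs
  have hl : mapInChart (f t) x c z = extChartAt 𝓘(ℝ, E) c c := mapInChart_self (f t) x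
  let D : E ≃L[ℝ] E := ContinuousLinearEquiv.equivOfInverse (dmap E (f t) x)
    (dmap E (f t).symm (f t x))
    (fun v => congrArg (fun L : E →L[ℝ] E => L v) (dmap_symm_dmap (f t) x))
    (fun v => congrArg (fun L : E →L[ℝ] E => L v) (dmap_dmap_symm (f t) x))
  have hD : HasFDerivAt (mapInChart (f t) x c) (D : E →L[ℝ] E) z := by
    have h := ((contDiffAt_mapInChart hft hz hs).differentiableAt (by simp)).hasFDerivAt
    have h' : fderiv ℝ (mapInChart (f t) x c) z = D := fderiv_mapInChart_self hft x
    rwa [h'] at h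
  obtain ⟨N, hN, hN0, hN1⟩ := exists_contDiffAt_rightInverse
    (ℓ := fun p : ℝ × E => mapInChart (f p.1) x c p.2) hℓ D hD
  dsimp only at hN hN0 hN1
  rw [hl] at hN hN0 hN1
  let κ : ℝ × M → ℝ × E := fun p => (p.1, extChartAt 𝓘(ℝ, E) c p.2)
  have hκ : ContMDiffAt (𝓘(ℝ, ℝ).prod 𝓘(ℝ, E)) (𝓘(ℝ, ℝ).prod 𝓘(ℝ, E)) ∞ κ (t, c) :=
    contMDiffAt_fst.prodMk (ContMDiffAt.comp (t, c) contMDiffAt_extChartAt contMDiffAt_snd)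
  have h1 : ContMDiffAt (𝓘(ℝ, ℝ).prod 𝓘(ℝ, E)) 𝓘(ℝ, E) ∞ (fun p => N (κ p)) (t, c) :=
    ContMDiffAt.comp (t, c) (contMDiffAt_prod_iff_contDiffAt.2 hN) hκ
  have hNz : N (κ (t, c)) = z := hN0
  have h2 : ContMDiffAt (𝓘(ℝ, ℝ).prod 𝓘(ℝ, E)) 𝓘(ℝ, E) ∞
      (fun p => (extChartAt 𝓘(ℝ, E) x).symm (N (κ p))) (t, c) :=
    ContMDiffAt.comp (t, c) (by rw [hNz]; exact contMDiffAt_extChartAt_symm hz) h1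
  refine h2.congr_of_eventuallyEq ?_
  -- near `(t, c)`, the local right inverse `N` computes the inverse diffeomorphism
  have e1 : ∀ᶠ p in nhds (t, c), mapInChart (f p.1) x c (N (κ p)) = extChartAt 𝓘(ℝ, E) c p.2 :=
    hκ.continuousAt.eventually hN1
  have e2 : ∀ᶠ p : ℝ × M in nhds (t, c), p.2 ∈ (extChartAt 𝓘(ℝ, E) c).source :=
    (continuousAt_snd (p := (t, c))).preimage_mem_nhds (extChartAt_source_mem_nhds c)
  have e3 : ∀ᶠ p : ℝ × M in nhds (t, c), f p.1 ((extChartAt 𝓘(ℝ, E) x).symm (N (κ p))) ∈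
      (extChartAt 𝓘(ℝ, E) c).source := by
    have h3 : ContinuousAt (fun p : ℝ × M => f p.1 ((extChartAt 𝓘(ℝ, E) x).symm (N (κ p))))
        (t, c) :=
      ContinuousAt.comp (g := fun p : ℝ × M => f p.1 p.2)
        (f := fun p : ℝ × M => (p.1, (extChartAt 𝓘(ℝ, E) x).symm (N (κ p))))
        hf.continuous.continuousAt (continuousAt_fst.prodMk h2.continuousAt)
    refine h3.preimage_mem_nhds ((isOpen_extChartAt_source (I := 𝓘(ℝ, E)) c).mem_nhds ?_)
    rw [hNz]
    exact hs
  filter_upwards [e1, e2, e3] with p hp1 hp2 hp3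
  have h4 := (extChartAt 𝓘(ℝ, E) c).injOn hp3 hp2 hp1
  rw [← h4]
  exact (f p.1).symm_apply_apply _

end Inverse

/-! ### Additivity and equivariance of Hamiltonian fields -/

section Composition

variable {E : Type*} [NormedAddCommGroup E] [NormedSpace ℝ E]
  {M : Type*} [TopologicalSpace M] [ChartedSpace E M] [IsManifold 𝓘(ℝ, E) ∞ M]
  {H : DForm E M 3} {J : GenAlmostComplex E M}

lemma dfun_add {f g : M → ℝ} (hf : ContMDiff 𝓘(ℝ, E) 𝓘(ℝ, ℝ) ∞ f)
    (hg : ContMDiff 𝓘(ℝ, E) 𝓘(ℝ, ℝ) ∞ g) :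
    (dfun (fun x => f x + g x) : CoField E M) = dfun f + dfun g :=
  funext fun x => ((hf.mdifferentiableAt (by simp)).hasMFDerivAt.add
    (hg.mdifferentiableAt (by simp)).hasMFDerivAt).mfderiv

lemma dGField_add {f g : M → ℝ} (hf : ContMDiff 𝓘(ℝ, E) 𝓘(ℝ, ℝ) ∞ f)
    (hg : ContMDiff 𝓘(ℝ, E) 𝓘(ℝ, ℝ) ∞ g) :
    (dGField (fun x => f x + g x) : GField E M) = dGField f + dGField g := by
  funext x
  exact Prod.ext (add_zero (0 : E)).symm (congrFun (dfun_add hf hg) x)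

lemma GenAlmostComplex.hamField_add {f g : M → ℝ} (hf : ContMDiff 𝓘(ℝ, E) 𝓘(ℝ, ℝ) ∞ f)
    (hg : ContMDiff 𝓘(ℝ, E) 𝓘(ℝ, ℝ) ∞ g) :
    J.hamField (fun x => f x + g x) = J.hamField f + J.hamField g := by
  rw [J.hamField_eq, dGField_add hf hg]
  funext x
  exact map_add (J.toFun x) (dGField f x) (dGField g x)

lemma hamInfinitesimal_add_fst {f g : M → ℝ} (hf : ContMDiff 𝓘(ℝ, E) 𝓘(ℝ, ℝ) ∞ f)
    (hg : ContMDiff 𝓘(ℝ, E) 𝓘(ℝ, ℝ) ∞ g) : (hamInfinitesimal H J (fun x => f x + g x)).1 =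
      (hamInfinitesimal H J f).1 + (hamInfinitesimal H J g).1 := by
  rw [hamInfinitesimal_fst, J.hamField_add hf hg]
  rfl

lemma hamInfinitesimal_add_snd {f g : M → ℝ} (hf : ContMDiff 𝓘(ℝ, E) 𝓘(ℝ, ℝ) ∞ f)
    (hg : ContMDiff 𝓘(ℝ, E) 𝓘(ℝ, ℝ) ∞ g) : (hamInfinitesimal H J (fun x => f x + g x)).2 =
      (hamInfinitesimal H J f).2 + (hamInfinitesimal H J g).2 := by
  have h1 : (J.hamField f).cov.Smooth := (J.hamField_smooth hf).2
  have h2 : (J.hamField g).cov.Smooth := (J.hamField_smooth hg).2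
  have h3 : (J.hamField f + J.hamField g).cov.toDForm =
      (J.hamField f).cov.toDForm + (J.hamField g).cov.toDForm := by
    funext x
    refine ContinuousAlternatingMap.ext (M := E) fun m => ?_
    rfl
  have h4 : DForm.interior (J.hamField f + J.hamField g).vec H =
      DForm.interior (J.hamField f).vec H + DForm.interior (J.hamField g).vec H :=
    funext fun x => map_add (ContinuousAlternatingMap.curryLeft (H.val x)) _ _
  rw [hamInfinitesimal_snd, J.hamField_add hf hg, h3, DForm.d_add h1.toDForm h2.toDForm, h4,
    hamInfinitesimal_snd, hamInfinitesimal_snd]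
  abel

lemma GenSym.push_dGField (g : GenSym E M) {f : M → ℝ} (hf : ContMDiff 𝓘(ℝ, E) 𝓘(ℝ, ℝ) ∞ f) :
    g.push (dGField f) = dGField (fun y => f (g.diffeo.symm y)) := by
  funext y
  have h1 := HasMFDerivAt.comp y ((hf (g.diffeo.symm y)).mdifferentiableAt (by simp)).hasMFDerivAt
    ((g.diffeo.symm.contMDiff y).mdifferentiableAt (by simp)).hasMFDerivAt
  refine Prod.ext (map_zero _) ?_
  refine Eq.trans ?_ h1.mfderiv.symm
  refine ContinuousLinearMap.ext (M₁ := E) fun v => ?_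
  have h2 : ∀ w : E, iota₂ (0 : TanSp E (g.diffeo.symm y)) (g.bField (g.diffeo.symm y)) w = 0 :=
    fun w => (iotaE_apply (g.bField.val (g.diffeo.symm y)) 0 w).trans
      ((g.bField.val (g.diffeo.symm y)).map_coord_zero 0 rfl)
  have h3 : CoField.val (dfun f) (g.diffeo.symm y) (dmap E g.diffeo.symm y v) +
      iota₂ (0 : TanSp E (g.diffeo.symm y)) (g.bField (g.diffeo.symm y))
        (dmap E g.diffeo.symm y v) =
      CoField.val (dfun f) (g.diffeo.symm y) (dmap E g.diffeo.symm y v) := by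
    rw [h2, add_zero]
  exact h3

/-- The Hamiltonian field of `f ∘ λ⁻¹` is the push-forward of that of `f` by `(λ, α)`. -/
lemma GenSym.PreservesStructure.hamField_comp_symm {g : GenSym E M} (hg : g.PreservesStructure J)
    {f : M → ℝ} (hf : ContMDiff 𝓘(ℝ, E) 𝓘(ℝ, ℝ) ∞ f) :
    J.hamField (fun y => f (g.diffeo.symm y)) = g.push (J.hamField f) := by
  have h := (GenSym.preservesStructure_iff J g).1 hg (dGField f)
  rw [g.push_dGField hf] at h
  exact h.symm

lemma DForm.add_val {n : ℕ} (v w : DForm E M n) (x : M) : (v + w).val x = v.val x + w.val x := rfl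

lemma DForm.sub_val {n : ℕ} (v w : DForm E M n) (x : M) : (v - w).val x = v.val x - w.val x := rfl

lemma DForm.interior_val (X : VField E M) (w : DForm E M 3) (x : M) (u v : E) :
    (DForm.interior X w).val x ![u, v] = w.val x ![X.val x, u, v] := rfl

/-- Pulling back by `λ` the form part of the infinitesimal symmetry of `f ∘ λ⁻¹` gives that of
`f`, corrected by the Lie derivative of `α` along `X_f`. -/
lemma GenSym.pullback_hamInfinitesimal_comp_symm {g : GenSym E M} (hg : g.PreservesStructure J)
    (hgH : H.pullback g.diffeo + g.bField.d = H) {f : M → ℝ}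
    (hf : ContMDiff 𝓘(ℝ, E) 𝓘(ℝ, ℝ) ∞ f) (x : M) (u v : E) :
    ((hamInfinitesimal H J (fun y => f (g.diffeo.symm y))).2.pullback g.diffeo).val x ![u, v] =
      (hamInfinitesimal H J f).2.val x ![u, v] +
      ((DForm.interiorTwo (hamInfinitesimal H J f).1 g.bField).toDForm.d.val x ![u, v] +
        g.bField.d.val x ![(hamInfinitesimal H J f).1.val x, u, v]) := by
  have hf' : ContMDiff 𝓘(ℝ, E) 𝓘(ℝ, ℝ) ∞ (fun y => f (g.diffeo.symm y)) :=
    hf.comp g.diffeo.symm.contMDiff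
  have hX : (J.hamField f).vec.Smooth := (J.hamField_smooth hf).1
  have hξ : (J.hamField f).cov.Smooth := (J.hamField_smooth hf).2
  have hξ' : (J.hamField (fun y => f (g.diffeo.symm y))).cov.Smooth := (J.hamField_smooth hf').2
  have hpush := hg.hamField_comp_symm hf
  rw [hamInfinitesimal_snd, hamInfinitesimal_snd, hamInfinitesimal_fst]
  have e1 : (J.hamField (fun y => f (g.diffeo.symm y))).cov.toDForm.pullback g.diffeo =
      (J.hamField f).cov.toDForm +
        (DForm.interiorTwo (J.hamField f).vec g.bField).toDForm := by
    rw [hpush]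
    funext x
    refine ContinuousAlternatingMap.ext (M := E) fun m => ?_
    have h1 : (g.push (J.hamField f)).cov.val (g.diffeo x) (dmap E g.diffeo x (m 0)) =
        (J.hamField f).cov.val x (m 0) + g.bField.val x ![(J.hamField f).vec.val x, m 0] :=
      (congrArg (fun u : E × (E →L[ℝ] ℝ) => u.2 (dmap E g.diffeo x (m 0)))
        (g.push_val (J.hamField f) x)).trans (g.actAt_snd_apply x _ _)
    exact h1.trans (congrArg (fun r : ℝ => (J.hamField f).cov.val x (m 0) + r)
      (iotaE_apply (g.bField.val x) ((J.hamField f).vec.val x) (m 0)).symm)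
  have e2 : (J.hamField (fun y => f (g.diffeo.symm y))).vec.val (g.diffeo x) =
      dmap E g.diffeo x ((J.hamField f).vec.val x) := by
    rw [hpush]
    exact congrArg Prod.fst (g.push_val (J.hamField f) x)
  have e3 : ((DForm.interior (J.hamField (fun y => f (g.diffeo.symm y))).vec H).pullback
      g.diffeo).val x ![u, v] = H.val x ![(J.hamField f).vec.val x, u, v] -
        g.bField.d.val x ![(J.hamField f).vec.val x, u, v] := by
    have h1 := compCLM_two (DForm.val (DForm.interior
      (J.hamField (fun y => f (g.diffeo.symm y))).vec H) (g.diffeo x)) (dmap E g.diffeo x) u v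
    refine h1.trans ?_
    rw [DForm.interior_val, e2]
    have h2 := congrArg (fun a : DForm E M 3 => a.val x ![(J.hamField f).vec.val x, u, v]) hgH
    have h3 := compCLM_three (H.val (g.diffeo x)) (dmap E g.diffeo x) ((J.hamField f).vec.val x) u v
    have h4 : (H.val (g.diffeo x)).compContinuousLinearMap (dmap E g.diffeo x)
      ![(J.hamField f).vec.val x, u, v] + g.bField.d.val x ![(J.hamField f).vec.val x, u, v] =
      H.val x ![(J.hamField f).vec.val x, u, v] := h2
    rw [h3] at h4
    linarith
  have e4 : ((J.hamField (fun y => f (g.diffeo.symm y))).cov.toDForm.d.pullback g.diffeo) =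
      (J.hamField f).cov.toDForm.d +
        (DForm.interiorTwo (J.hamField f).vec g.bField).toDForm.d := by
    rw [← DForm.d_pullback hξ'.toDForm g.diffeo.contMDiff, e1,
      DForm.d_add hξ.toDForm (g.smooth.interiorTwo hX).toDForm]
  have e5 : ((DForm.d (CoField.toDForm (J.hamField (fun y => f (g.diffeo.symm y))).cov) -
      DForm.interior (J.hamField (fun y => f (g.diffeo.symm y))).vec H).pullback g.diffeo) =
      (J.hamField (fun y => f (g.diffeo.symm y))).cov.toDForm.d.pullback g.diffeo -
      (DForm.interior (J.hamField (fun y => f (g.diffeo.symm y))).vec H).pullback g.diffeo := rfl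
  rw [e5, e4, DForm.sub_val, DForm.sub_val, DForm.add_val]
  have e6 : ∀ a b : E [⋀^Fin 2]→L[ℝ] ℝ, (a - b) ![u, v] = a ![u, v] - b ![u, v] := fun _ _ => rfl
  have e7 : ∀ a b : E [⋀^Fin 2]→L[ℝ] ℝ, (a + b) ![u, v] = a ![u, v] + b ![u, v] := fun _ _ => rfl
  rw [e6, e6, e7, e3, DForm.interior_val]
  ring

end Composition

/-! ### Products of Hamiltonian paths -/

section PathProduct

variable {E : Type*} [NormedAddCommGroup E] [NormedSpace ℝ E]
  {M : Type*} [TopologicalSpace M] [ChartedSpace E M]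

/-- The velocity of a composition of flows. -/
lemma IsFlow.hasMFDerivAt_comp [IsManifold 𝓘(ℝ, E) ∞ M] {f h : ℝ → M → M} {X Y : ℝ → VField E M}
    (hf : IsFlow f X) (hh : IsFlow h Y) (t : ℝ) (x : M) :
    HasMFDerivAt 𝓘(ℝ, ℝ) 𝓘(ℝ, E) (fun s => f s (h s x)) t
      ((1 : ℝ →L[ℝ] ℝ).smulRight ((X t).val (f t (h t x)) +
        dmap E (f t) (h t x) ((Y t).val (h t x))) : ℝ →L[ℝ] E) := by
  have hd := (hf.smooth (t, h t x)).mdifferentiableAt (by simp)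
  obtain ⟨A, hA⟩ : ∃ A : ℝ × E →L[ℝ] E, HasMFDerivAt (𝓘(ℝ, ℝ).prod 𝓘(ℝ, E)) 𝓘(ℝ, E)
      (fun p : ℝ × M => f p.1 p.2) (t, h t x) A := ⟨_, hd.hasMFDerivAt⟩
  have h1 : HasMFDerivAt 𝓘(ℝ, ℝ) 𝓘(ℝ, E) (fun s => f s (h s x)) t
      (A ∘L (ContinuousLinearMap.id ℝ ℝ).prod ((1 : ℝ →L[ℝ] ℝ).smulRight ((Y t).val (h t x)))) :=
    HasMFDerivAt.comp t (g := fun p : ℝ × M => f p.1 p.2) (f := fun s => (s, h s x)) hA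
      ((hasMFDerivAt_id (I := 𝓘(ℝ, ℝ)) t).prodMk (hh.deriv t x))
  have h2 : HasMFDerivAt 𝓘(ℝ, ℝ) 𝓘(ℝ, E) (fun s => f s (h t x)) t
      (A ∘L (ContinuousLinearMap.id ℝ ℝ).prod (0 : ℝ →L[ℝ] E)) :=
    HasMFDerivAt.comp t (g := fun p : ℝ × M => f p.1 p.2) (f := fun s => (s, h t x)) hA
      ((hasMFDerivAt_id (I := 𝓘(ℝ, ℝ)) t).prodMk (hasMFDerivAt_const (h t x) t))
  have h3 : HasMFDerivAt 𝓘(ℝ, E) 𝓘(ℝ, E) (f t) (h t x)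
      (A ∘L (0 : E →L[ℝ] ℝ).prod (ContinuousLinearMap.id ℝ E)) :=
    HasMFDerivAt.comp (h t x) (g := fun p : ℝ × M => f p.1 p.2) (f := fun y => (t, y)) hA
      ((hasMFDerivAt_const t (h t x)).prodMk (hasMFDerivAt_id (I := 𝓘(ℝ, E)) (h t x)))
  have e2 : (A ∘L (ContinuousLinearMap.id ℝ ℝ).prod (0 : ℝ →L[ℝ] E)) =
      (1 : ℝ →L[ℝ] ℝ).smulRight ((X t).val (f t (h t x))) :=
    hasMFDerivAt_unique h2 (hf.deriv t (h t x))
  have e3 : dmap E (f t) (h t x) = A ∘L (0 : E →L[ℝ] ℝ).prod (ContinuousLinearMap.id ℝ E) :=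
    h3.mfderiv
  have e4 : A (1, 0) = (X t).val (f t (h t x)) := by
    have := congrArg (fun L : ℝ →L[ℝ] E => L 1) e2
    simpa using this
  have e5 : (A ∘L (ContinuousLinearMap.id ℝ ℝ).prod
      ((1 : ℝ →L[ℝ] ℝ).smulRight ((Y t).val (h t x)))) =
      ((1 : ℝ →L[ℝ] ℝ).smulRight ((X t).val (f t (h t x)) +
        dmap E (f t) (h t x) ((Y t).val (h t x))) : ℝ →L[ℝ] E) := by
    refine ContinuousLinearMap.ext_ring ?_
    rw [e3, ← e4]
    simp only [ContinuousLinearMap.comp_apply, ContinuousLinearMap.prod_apply,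
      ContinuousLinearMap.smulRight_apply, ContinuousLinearMap.id_apply, zero_apply,
      one_apply_eq_self, one_smul]
    rw [← map_add]
    simp
  exact (congrArg (fun L : ℝ →L[ℝ] E =>
    HasMFDerivAt 𝓘(ℝ, ℝ) 𝓘(ℝ, E) (fun s => f s (h s x)) t L) e5).mp h1

variable [IsManifold 𝓘(ℝ, E) ∞ M] {H : DForm E M 3} {J : GenAlmostComplex E M}

lemma DForm.SmoothFamily.add {n : ℕ} {v w : ℝ → DForm E M n} (hv : DForm.SmoothFamily v)
    (hw : DForm.SmoothFamily w) : DForm.SmoothFamily (fun t => v t + w t) :=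
  DForm.smoothFamily_of_inChart fun t c => (hv.contDiffAt_inChart t (mem_extChartAt_target c)).add
    (hw.contDiffAt_inChart t (mem_extChartAt_target c))

/-- The composite of Hamiltonian paths is a Hamiltonian path. -/
lemma IsHamPath.mul [FiniteDimensional ℝ E] [T2Space M] (hH : H.Smooth) (hdH : H.d = 0)
    (hJ : J.Integrable H) {F G : ℝ → M → ℝ} {g h : ℝ → GenSym E M} (hF : IsHamPath H J F g)
    (hG : IsHamPath H J G h) :
    IsHamPath H J (fun t x => F t x + G t ((g t).diffeo.symm x)) (fun t => g t * h t) := by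
  have hG' : ContMDiff (𝓘(ℝ, ℝ).prod 𝓘(ℝ, E)) 𝓘(ℝ, ℝ) ∞
      (fun p : ℝ × M => G p.1 ((g p.1).diffeo.symm p.2)) :=
    ContMDiff.comp (g := fun p : ℝ × M => G p.1 p.2)
      (f := fun p : ℝ × M => (p.1, (g p.1).diffeo.symm p.2)) hG.1
      (contMDiff_fst.prodMk (contMDiff_symm_family (f := fun t => (g t).diffeo) hF.2.smooth_diffeo))
  have hFt := contMDiff_of_family hF.1
  have hGt := contMDiff_of_family hG.1
  have hGt' : ∀ t, ContMDiff 𝓘(ℝ, E) 𝓘(ℝ, ℝ) ∞ (fun x => G t ((g t).diffeo.symm x)) :=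
    fun t => contMDiff_of_family (F := fun t x => G t ((g t).diffeo.symm x)) hG' t
  have hflow := hF.2.isFlow
  have hflow' := hG.2.isFlow
  have hpres := hF.preservesStructure hJ
  refine ⟨hF.1.add hG', ?_, ?_, ?_, ?_, ?_⟩
  · exact ContMDiff.comp (g := fun p : ℝ × M => (g p.1).diffeo p.2)
      (f := fun p : ℝ × M => (p.1, (h p.1).diffeo p.2)) hF.2.smooth_diffeo
      (contMDiff_fst.prodMk hG.2.smooth_diffeo)
  · exact (hF.2.smooth_bField.pullback hG.2.smooth_diffeo).add hG.2.smooth_bField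
  · rw [hF.2.start, hG.2.start, one_mul]
  · intro t x
    have h1 := hflow.hasMFDerivAt_comp hflow' t x
    have e1 : (J.hamField (fun y => G t ((g t).diffeo.symm y))).vec.val
        ((g t).diffeo ((h t).diffeo x)) = dmap E (g t).diffeo ((h t).diffeo x)
          ((J.hamField (G t)).vec.val ((h t).diffeo x)) := by
      rw [(hpres t).hamField_comp_symm (hGt t)]
      exact congrArg Prod.fst ((g t).push_val (J.hamField (G t)) ((h t).diffeo x))
    have e2 : VField.val (hamInfinitesimal H J (fun x => F t x + G t ((g t).diffeo.symm x))).1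
        ((g t).diffeo ((h t).diffeo x)) =
        (J.hamField (F t)).vec.val ((g t).diffeo ((h t).diffeo x)) +
          dmap E (g t).diffeo ((h t).diffeo x) ((J.hamField (G t)).vec.val ((h t).diffeo x)) := by
      rw [hamInfinitesimal_add_fst (hFt t) (hGt' t), ← e1]
      rfl
    exact (congrArg (fun v : E => HasMFDerivAt 𝓘(ℝ, ℝ) 𝓘(ℝ, E)
      (fun s => (g s).diffeo ((h s).diffeo x)) t ((1 : ℝ →L[ℝ] ℝ).smulRight v : ℝ →L[ℝ] E)) e2).mpr
      h1
  · intro t x u v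
    have h1 := hflow'.hasDerivAt_pullback_two (t := t)
      (hamInfinitesimal_fst_smooth (H := H) (J := J) (hGt t)) hF.2.smooth_bField (g t).smooth
      (hF.2.hasTimeDerivAt t) x u v
    have h2 := hG.2.deriv_bField t x u v
    have h3 := h1.add h2
    have e1 := GenSym.pullback_hamInfinitesimal_comp_symm (H := H) (hpres t)
      (hF.pullback_add_d hH hdH t) (hGt t) ((h t).diffeo x) (dmap E (h t).diffeo x u)
      (dmap E (h t).diffeo x v)
    have e2 : ((hamInfinitesimal H J (fun x => F t x + G t ((g t).diffeo.symm x))).2.pullback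
        (g t * h t).diffeo) = ((hamInfinitesimal H J (F t)).2.pullback
          (g t).diffeo).pullback (h t).diffeo +
        ((hamInfinitesimal H J (fun x => G t ((g t).diffeo.symm x))).2.pullback
          (g t).diffeo).pullback (h t).diffeo := by
      have e3 : ((g t * h t).diffeo : M → M) = (g t).diffeo ∘ (h t).diffeo := rfl
      rw [hamInfinitesimal_add_snd (hFt t) (hGt' t), e3,
        DForm.pullback_comp _ (g t).diffeo.contMDiff (h t).diffeo.contMDiff, DForm.pullback_add,
        DForm.pullback_add]
    refine h3.congr_deriv ?_
    have e4 : ∀ w : DForm E M 2, (w.pullback (h t).diffeo).val x ![u, v] =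
        w.val ((h t).diffeo x) ![dmap E (h t).diffeo x u, dmap E (h t).diffeo x v] := fun w =>
      compCLM_two (w.val ((h t).diffeo x)) (dmap E (h t).diffeo x) u v
    have e5 : DForm.val ((hamInfinitesimal H J
        (fun x => F t x + G t ((g t).diffeo.symm x))).2.pullback (g t * h t).diffeo) x ![u, v] =
        (((hamInfinitesimal H J (F t)).2.pullback (g t).diffeo).pullback (h t).diffeo).val x
          ![u, v] + (((hamInfinitesimal H J (fun x => G t ((g t).diffeo.symm x))).2.pullback
          (g t).diffeo).pullback (h t).diffeo).val x ![u, v] := by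
      rw [e2]; rfl
    have e6 : ((hamInfinitesimal H J (G t)).2.pullback (h t).diffeo).val x ![u, v] = _ :=
      e4 (hamInfinitesimal H J (G t)).2
    refine Eq.trans ?_ e5.symm
    rw [e4, e4, e1]
    refine (congrArg (fun r : ℝ => _ + r) e6).trans ?_
    ring

end PathProduct

/-! ### The group of Hamiltonian symmetries -/

section HamGroup

variable {E : Type*} [NormedAddCommGroup E] [NormedSpace ℝ E]
  {M : Type*} [TopologicalSpace M] [ChartedSpace E M] [IsManifold 𝓘(ℝ, E) ∞ M]
  {H : DForm E M 3} {J : GenAlmostComplex E M}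

lemma hamInfinitesimal_add {f g : M → ℝ} (hf : ContMDiff 𝓘(ℝ, E) 𝓘(ℝ, ℝ) ∞ f)
    (hg : ContMDiff 𝓘(ℝ, E) 𝓘(ℝ, ℝ) ∞ g) : hamInfinitesimal H J (fun x => f x + g x) =
      hamInfinitesimal H J f + hamInfinitesimal H J g :=
  Prod.ext (hamInfinitesimal_add_fst hf hg) (hamInfinitesimal_add_snd hf hg)

lemma hamInfinitesimal_zero : hamInfinitesimal H J (fun _ => 0) = 0 := by
  have h := hamInfinitesimal_add (H := H) (J := J) (contMDiff_const (c := (0 : ℝ)))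
    (contMDiff_const (c := (0 : ℝ)))
  simp only [add_zero] at h
  exact left_eq_add.1 h

lemma hamInfinitesimal_neg {f : M → ℝ} (hf : ContMDiff 𝓘(ℝ, E) 𝓘(ℝ, ℝ) ∞ f) :
    hamInfinitesimal H J (fun x => -f x) = -hamInfinitesimal H J f := by
  have h := hamInfinitesimal_add (H := H) (J := J) hf (g := fun x => -f x) hf.neg
  simp only [add_neg_cancel] at h
  exact (neg_eq_of_add_eq_zero_right (h.symm.trans hamInfinitesimal_zero)).symm

variable (H J) in
/-- The constant path at the identity is Hamiltonian. -/
lemma isHamPath_one : IsHamPath H J (fun _ _ => 0) (fun _ => (1 : GenSym E M)) := by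
  refine ⟨contMDiff_const, contMDiff_snd, (DForm.smooth_zero 2).smoothFamily, rfl, ?_, ?_⟩
  · intro t x
    have h : VField.val (hamInfinitesimal H J (fun _ => 0)).1 x = 0 := by
      rw [hamInfinitesimal_zero]; rfl
    have e : ((1 : ℝ →L[ℝ] ℝ).smulRight (VField.val (hamInfinitesimal H J (fun _ => 0)).1 x) :
        ℝ →L[ℝ] E) = 0 := by
      rw [h]; exact ContinuousLinearMap.smulRight_zero _
    exact (congrArg (fun L : ℝ →L[ℝ] E => HasMFDerivAt 𝓘(ℝ, ℝ) 𝓘(ℝ, E) (fun _ : ℝ => x) t L)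
      e).mpr (hasMFDerivAt_const x t)
  · intro t x u v
    rw [hamInfinitesimal_zero]
    exact hasDerivAt_const t _

/-- Reversing the time of a Hamiltonian path, and composing with the inverse of its end point,
gives a Hamiltonian path. -/
lemma IsHamPath.reverse {F : ℝ → M → ℝ} {g : ℝ → GenSym E M} (hg : IsHamPath H J F g) :
    IsHamPath H J (fun t x => -F (1 - t) x) (fun t => g (1 - t) * (g 1)⁻¹) := by
  have hθ : ContDiff ℝ ∞ (fun t : ℝ => 1 - t) := contDiff_const.sub contDiff_id
  have hF : ∀ t, ContMDiff 𝓘(ℝ, E) 𝓘(ℝ, ℝ) ∞ (F t) := contMDiff_of_family hg.1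
  have hθ' : ContMDiff (𝓘(ℝ, ℝ).prod 𝓘(ℝ, E)) 𝓘(ℝ, ℝ) ∞ (fun p : ℝ × M => 1 - p.1) :=
    hθ.contMDiff.comp contMDiff_fst
  have hθd : ∀ t : ℝ, HasDerivAt (fun t : ℝ => 1 - t) (-1) t := fun t => by
    simpa using (hasDerivAt_id t).const_sub 1
  refine ⟨?_, ?_, ?_, ?_, ?_, ?_⟩
  · exact ContMDiff.neg (ContMDiff.comp (g := fun p : ℝ × M => F p.1 p.2)
      (f := fun p : ℝ × M => (1 - p.1, p.2)) hg.1 (hθ'.prodMk contMDiff_snd))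
  · exact ContMDiff.comp (g := fun p : ℝ × M => (g p.1).diffeo p.2)
      (f := fun p : ℝ × M => (1 - p.1, (g 1)⁻¹.diffeo p.2)) hg.2.smooth_diffeo
      (hθ'.prodMk ((g 1)⁻¹.diffeo.contMDiff.comp contMDiff_snd))
  · exact ((hg.2.smooth_bField.comp_left hθ.contMDiff).pullback (f := fun _ => (g 1)⁻¹.diffeo)
      ((g 1)⁻¹.diffeo.contMDiff.comp contMDiff_snd)).add (g 1)⁻¹.smooth.smoothFamily
  · simp only [sub_zero, mul_inv_cancel]
  · intro t x
    set y := (g 1)⁻¹.diffeo x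
    have h1 := HasMFDerivAt.comp t (hg.2.deriv_diffeo (1 - t) y)
      (hθd t).hasFDerivAt.hasMFDerivAt
    have e : ((1 : ℝ →L[ℝ] ℝ).smulRight (VField.val (hamInfinitesimal H J (F (1 - t))).1
          ((g (1 - t)).diffeo y)) : ℝ →L[ℝ] E) ∘L
        (ContinuousLinearMap.toSpanSingleton ℝ (-1 : ℝ)) =
        (1 : ℝ →L[ℝ] ℝ).smulRight (VField.val (hamInfinitesimal H J (fun x => -F (1 - t) x)).1
          ((g (1 - t)).diffeo y)) := by
      rw [hamInfinitesimal_neg (hF (1 - t))]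
      refine ContinuousLinearMap.ext_ring ?_
      have e1 : VField.val (-hamInfinitesimal H J (F (1 - t))).1 ((g (1 - t)).diffeo y) =
        -VField.val (hamInfinitesimal H J (F (1 - t))).1 ((g (1 - t)).diffeo y) := rfl
      rw [e1]
      simp
    exact (congrArg (fun L : ℝ →L[ℝ] E => HasMFDerivAt 𝓘(ℝ, ℝ) 𝓘(ℝ, E)
      (fun s : ℝ => (g (1 - s)).diffeo y) t L) e).mp h1
  · intro t x u v
    set y := (g 1)⁻¹.diffeo x with hy
    have h1 := ((hg.2.deriv_bField (1 - t) y (dmap E (g 1)⁻¹.diffeo x u)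
      (dmap E (g 1)⁻¹.diffeo x v)).scomp t (hθd t)).add_const ((g 1)⁻¹.bField x ![u, v])
    have e0 : ∀ w : DForm E M 2, (w.pullback (g 1)⁻¹.diffeo).val x ![u, v] =
        w.val y ![dmap E (g 1)⁻¹.diffeo x u, dmap E (g 1)⁻¹.diffeo x v] := fun w =>
      compCLM_two (w.val y) (dmap E (g 1)⁻¹.diffeo x) u v
    have e1 : (hamInfinitesimal H J (fun x => -F (1 - t) x)).2.pullback
        (g (1 - t) * (g 1)⁻¹).diffeo = -((hamInfinitesimal H J (F (1 - t))).2.pullback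
          (g (1 - t)).diffeo).pullback (g 1)⁻¹.diffeo := by
      have e2 : ((g (1 - t) * (g 1)⁻¹).diffeo : M → M) =
        (g (1 - t)).diffeo ∘ (g 1)⁻¹.diffeo := rfl
      rw [hamInfinitesimal_neg (hF (1 - t)), e2,
        DForm.pullback_comp _ (g (1 - t)).diffeo.contMDiff (g 1)⁻¹.diffeo.contMDiff]
      rfl
    have e3 : DForm.val ((hamInfinitesimal H J (fun x => -F (1 - t) x)).2.pullback
        (g (1 - t) * (g 1)⁻¹).diffeo) x ![u, v] =
        -(((hamInfinitesimal H J (F (1 - t))).2.pullback (g (1 - t)).diffeo).val y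
          ![dmap E (g 1)⁻¹.diffeo x u, dmap E (g 1)⁻¹.diffeo x v]) := by
      rw [e1, ← e0]; rfl
    have h2 : HasDerivAt (fun s => ((g (1 - s)).bField.pullback (g 1)⁻¹.diffeo).val x ![u, v] +
        (g 1)⁻¹.bField.val x ![u, v]) (-(((hamInfinitesimal H J (F (1 - t))).2.pullback
          (g (1 - t)).diffeo).val y
          ![dmap E (g 1)⁻¹.diffeo x u, dmap E (g 1)⁻¹.diffeo x v])) t := by
      simp only [e0]
      exact h1.congr_deriv (neg_one_smul ℝ _)
    exact h2.congr_deriv e3.symm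

/-- The Hamiltonian symmetries form a group. -/
def hamGroup [FiniteDimensional ℝ E] [T2Space M] (hH : H.Smooth) (hdH : H.d = 0)
    (hJ : J.Integrable H) : Subgroup (GenSym E M) where
  carrier := hamSet H J
  one_mem' := ⟨_, _, isHamPath_one H J, rfl⟩
  mul_mem' := by
    rintro _ _ ⟨F, g, hF, rfl⟩ ⟨G, h, hG, rfl⟩
    exact ⟨_, _, hF.mul hH hdH hJ hG, rfl⟩
  inv_mem' := by
    rintro _ ⟨F, g, hF, rfl⟩
    refine ⟨_, _, hF.reverse, ?_⟩
    rw [sub_self, hF.2.start, one_mul]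

end HamGroup

end GenGeom

end

theorem mainTheorem2 {E : Type*} [NormedAddCommGroup E] [NormedSpace ℝ E] [FiniteDimensional ℝ E]
    {M : Type*} [TopologicalSpace M] [ChartedSpace E M] [IsManifold 𝓘(ℝ, E) ∞ M]
    [T2Space M] [SecondCountableTopology M]
    (H : DForm E M 3) (hH : H.Smooth) (hdH : H.d = 0)
    (J : GenAlmostComplex E M) (hJ : J.Integrable H) :
    (∃ K : Subgroup (GenSym E M), (K : Set (GenSym E M)) = hamSet H J ∧ K ≤ symGroup H J) ∧
    (∀ (F G : ℝ → M → ℝ) (g h : ℝ → GenSym E M),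
      IsHamPath H J F g → IsHamPath H J G h →
        IsHamPath H J (fun t x => F t x + G t ((g t).diffeo.symm x)) (fun t => g t * h t)) := by
  refine ⟨⟨hamGroup hH hdH hJ, rfl, ?_⟩, fun F G g h hF hG => hF.mul hH hdH hJ hG⟩
  rintro _ ⟨F, g, hF, rfl⟩
  exact ⟨GenSym.preservesBracket_of_pullback_add_d (hF.pullback_add_d hH hdH 1),
    hF.preservesStructure hJ 1⟩
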